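/- Let $p\ge 2$ be an integer and let $a_1,\dots,a_{p+1},b_1,\dots,b_p\in\mathbb C$, none of them in $\mathbb Z_{\le 0}=\{0,-1,-2,\dots\}$. Write $(x)_n=x(x+1)\cdots(x+n-1)$, $s=\sum_{j=1}^p b_j-\sum_{j=1}^{p+1}a_j$, $${}_{p+1}F_p(z)=\sum_{n\ge0}\frac{(a_1)_n\cdots(a_{p+1})_n}{(b_1)_n\cdots(b_p)_n}\frac{z^n}{n!},\qquad \Phi(z)=\frac{\Gamma(a_1)\cdots\Gamma(a_{p+1})}{\Gamma(b_1)\cdots\Gamma(b_p)}\;{}_{p+1}F_p(z),$$ $B_i=(b_p+\dots+b_{i+1})-(a_{p+1}+\dots+a_{i+2})$ and $\beta_i=b_i-a_{i+2}$ for $1\le i\le p-1$. Define $A_k^{(p)}$ $(k\ge 0)$, with $k_1=k$, as the nested terminating sum $$A_k^{(p)}=\sum_{k_1\ge k_2\ge\dots\ge k_{p-1}\ge0}\ \left[\prod_{i=1}^{p-2}\frac{(B_i+k_{i+1})_{k_i-k_{i+1}}\,(\beta_i)_{k_i-k_{i+1}}}{(k_i-k_{i+1})!}\right]\frac{(B_{p-1})_{k_{p-1}}(\beta_{p-1})_{k_{p-1}}}{k_{p-1}!}$$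 (the sum is over $k_2,\dots,k_{p-1}$; for $p=2$ this is $A_k^{(2)}=(b_2-a_3)_k(b_1-a_3)_k/k!$). Then the following hold. (a) If $B_i\notin\mathbb Z_{\le0}$ and $\beta_i\notin\mathbb Z_{\le 0}$ for $1\le i\le p-2$, then for all $k\ge0$ $$A_k^{(p)}=\frac{(B_1)_k(\beta_1)_k}{k!}\sum_{k_2=0}^{k}\frac{(-k)_{k_2}}{(B_1)_{k_2}(1-\beta_1-k)_{k_2}}\cdot\frac{(B_2)_{k_2}(\beta_2)_{k_2}}{k_2!}\sum_{k_3=0}^{k_2}\cdots\sum_{k_{p-1}=0}^{k_{p-2}}\frac{(-k_{p-2})_{k_{p-1}}}{(B_{p-2})_{k_{p-1}}(1-\beta_{p-2}-k_{p-2})_{k_{p-1}}}\cdot\frac{(B_{p-1})_{k_{p-1}}(\beta_{p-1})_{k_{p-1}}}{k_{p-1}!}.$$ (b) If $\operatorname{Re}a_j>0$ for $3\le j\le p+1$, then for $|z|<1$ $$\Phi(z)=\sum_{k=0}^\infty A_k^{(p)}\,\frac{\Gamma(a_1)\Gamma(a_2)}{\Gamma(s+a_1+a_2+k)}\;{}_2F_1(a_1,a_2;s+a_1+a_2+k;z),$$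 with absolute convergence, where $\frac{1}{\Gamma(c)}{}_2F_1(\alpha,\beta;c;z)$ stands for $\sum_{n\ge0}\frac{(\alpha)_n(\beta)_n}{\Gamma(c+n)}\frac{z^n}{n!}$ (also if $c\in\mathbb Z_{\le0}$). (c) Suppose $s\notin\mathbb Z$ and $a_1+s,\ a_2+s\notin\mathbb Z_{\le0}$. For $n\ge 0$ and $r\in\{0,s\}$ put $$g_n(r)=(-1)^n\frac{\Gamma(a_1+r+n)\Gamma(a_2+r+n)\Gamma(s-2r-n)}{\Gamma(a_1+s)\Gamma(a_2+s)\,n!}\sum_{k=0}^\infty\frac{(s-r-n)_k}{(a_1+s)_k(a_2+s)_k}A_k^{(p)}.$$ For $r=s$ this series terminates (its terms with $k>n$ vanish); for $r=0$ it converges absolutely whenever $\operatorname{Re}(a_j+n)>0$ for $3\le j\le p+1$. The function $\Phi$ has an analytic continuation from the unit disc to its union with $D=\{z\ne1:\ |1-z|<1,\ |\arg(1-z)|<\pi\}$, and there are complex numbers $c_0,c_1,\dots$ such that $c_n=g_n(0)$ for every $n$ with $\operatorname{Re}(a_j+n)>0$ for $3\le j\le p+1$ (so for all $n$ if $\operatorname{Re}a_j>0$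 for $3\le j\le p+1$), and $$\Phi(z)=\sum_{n=0}^\infty c_n(1-z)^n+(1-z)^s\sum_{n=0}^\infty g_n(s)(1-z)^n\qquad(z\in D),$$ with the principal branch of $(1-z)^s$ and both series absolutely convergent. (d) If $\operatorname{Re}s>0$, $\operatorname{Re}a_j>0$ for $3\le j\le p+1$, and $a_1+s,\ a_2+s\notin\mathbb Z_{\le0}$, then the series below converge absolutely and $$\frac{\Gamma(a_1)\cdots\Gamma(a_{p+1})}{\Gamma(b_1)\cdots\Gamma(b_p)}\;{}_{p+1}F_p(1)=\frac{\Gamma(a_1)\Gamma(a_2)\Gamma(s)}{\Gamma(a_1+s)\Gamma(a_2+s)}\sum_{k=0}^\infty\frac{(s)_k}{(a_1+s)_k(a_2+s)_k}A_k^{(p)}.$$ -/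

import Mathlib

open scoped Nat

noncomputable section

/-- The Pochhammer symbol `(x)_n = x (x + 1) ⋯ (x + n - 1)`. -/
def poch (x : ℂ) (n : ℕ) : ℂ := (ascPochhammer ℂ n).eval x

/-- The `n`-th term of the series `_{p+1}F_p(a_1, …, a_{p+1}; b_1, …, b_p; z)`.
Only the entries `a 1, …, a (p + 1)` and `b 1, …, b p` of the sequences are used. -/
def hypTerm (p : ℕ) (a b : ℕ → ℂ) (z : ℂ) (n : ℕ) : ℂ :=
  (∏ j ∈ Finset.Icc 1 (p + 1), poch (a j) n) / (∏ j ∈ Finset.Icc 1 p, poch (b j) n)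
    * (z ^ n / (n ! : ℂ))

/-- The generalized hypergeometric series `_{p+1}F_p(a_1, …, a_{p+1}; b_1, …, b_p; z)`. -/
def hypF (p : ℕ) (a b : ℕ → ℂ) (z : ℂ) : ℂ := ∑' n : ℕ, hypTerm p a b z n

/-- The factor `Γ(a_1) ⋯ Γ(a_{p+1}) / (Γ(b_1) ⋯ Γ(b_p))`. -/
def gammaFactor (p : ℕ) (a b : ℕ → ℂ) : ℂ :=
  (∏ j ∈ Finset.Icc 1 (p + 1), Complex.Gamma (a j)) / ∏ j ∈ Finset.Icc 1 p, Complex.Gamma (b j)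

/-- `s = ∑_{j=1}^{p} b_j - ∑_{j=1}^{p+1} a_j`. -/
def excess (p : ℕ) (a b : ℕ → ℂ) : ℂ :=
  ∑ j ∈ Finset.Icc 1 p, b j - ∑ j ∈ Finset.Icc 1 (p + 1), a j

/-- The regularized Gauss series `∑ (α)_n (β)_n / Γ(c + n) · z^n / n!`, that is
`₂F₁(α, β; c; z) / Γ(c)`, extended by continuity to `c = 0, -1, -2, …`
(where `1 / Γ` is `0`, as it is in Mathlib); see `gaussReg_eq`. -/
def gaussReg (α β c z : ℂ) : ℂ :=
  ∑' n : ℕ, poch α n * poch β n / Complex.Gamma (c + n) * (z ^ n / (n ! : ℂ))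

/-- `B_i = (b_p + ⋯ + b_{i+1}) - (a_{p+1} + ⋯ + a_{i+2})`. -/
def tailDiff (p : ℕ) (a b : ℕ → ℂ) (i : ℕ) : ℂ :=
  ∑ j ∈ Finset.Icc (i + 1) p, b j - ∑ j ∈ Finset.Icc (i + 2) (p + 1), a j

/-- The nested terminating sum, from its level `i` inwards, with `d` further summations inside;
`k` is the summation index of the level outside. Written with quotients of Pochhammer symbols. -/
def nestedFrac (p : ℕ) (a b : ℕ → ℂ) : ℕ → ℕ → ℕ → ℂ
  | 0, i, k => poch (tailDiff p a b i) k * poch (b i - a (i + 2)) k / (k ! : ℂ)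
  | d + 1, i, k =>
      poch (tailDiff p a b i) k * poch (b i - a (i + 2)) k / (k ! : ℂ)
        * ∑ l ∈ Finset.range (k + 1),
            poch (-(k : ℂ)) l
              / (poch (tailDiff p a b i) l * poch (1 + a (i + 2) - b i - k) l)
              * nestedFrac p a b d (i + 1) l

/-- The coefficient `A_k^{(p)}` as a `(p-2)`-fold nested sum of quotients of Pochhammer symbols;
meaningful if no denominator vanishes. -/
def coeffAFrac (p : ℕ) (a b : ℕ → ℂ) (k : ℕ) : ℂ := nestedFrac p a b (p - 2) 1 k

/-- The same nested sum after the cancellations `(x)_k / (x)_l = (x + l)_{k-l}` and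
`(y)_k (-k)_l / ((1 - y - k)_l k!) = (y)_{k-l} / (k-l)!`, which hold for `l ≤ k`. -/
def nestedSum (p : ℕ) (a b : ℕ → ℂ) : ℕ → ℕ → ℕ → ℂ
  | 0, i, k => poch (tailDiff p a b i) k * poch (b i - a (i + 2)) k / (k ! : ℂ)
  | d + 1, i, k =>
      ∑ l ∈ Finset.range (k + 1),
        poch (tailDiff p a b i + l) (k - l) * poch (b i - a (i + 2)) (k - l) / ((k - l) ! : ℂ)
          * nestedSum p a b d (i + 1) l

/-- The coefficient `A_k^{(p)}`, a polynomial in the parameters. It is equal to `coeffAFrac`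
wherever the denominators there do not vanish, and extends it by continuity. -/
def coeffA (p : ℕ) (a b : ℕ → ℂ) (k : ℕ) : ℂ := nestedSum p a b (p - 2) 1 k

/-- The `k`-th term of the series
`∑_k (s - r - n)_k / ((a_1 + s)_k (a_2 + s)_k) · A_k^{(p)}`. -/
def gTerm (p : ℕ) (a b : ℕ → ℂ) (n : ℕ) (r : ℂ) (k : ℕ) : ℂ :=
  poch (excess p a b - r - n) k
    / (poch (a 1 + excess p a b) k * poch (a 2 + excess p a b) k) * coeffA p a b k

/-- The coefficient `g_n(r)`. -/
def gCoeff (p : ℕ) (a b : ℕ → ℂ) (n : ℕ) (r : ℂ) : ℂ :=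
  (-1) ^ n
    * (Complex.Gamma (a 1 + r + n) * Complex.Gamma (a 2 + r + n)
        * Complex.Gamma (excess p a b - 2 * r - n))
    / (Complex.Gamma (a 1 + excess p a b) * Complex.Gamma (a 2 + excess p a b) * (n ! : ℂ))
    * ∑' k : ℕ, gTerm p a b n r k

/-- The region `|1 - z| < 1`, `|arg (1 - z)| < π`, `z ≠ 1`. -/
def slitDisc : Set ℂ := {z | ‖1 - z‖ < 1 ∧ 1 - z ∈ Complex.slitPlane}

lemma poch_succ (x : ℂ) (n : ℕ) : poch x (n + 1) = poch x n * (x + n) := by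
  simp [poch, ascPochhammer_succ_eval]

lemma poch_ne_zero {x : ℂ} (hx : ∀ m : ℕ, x ≠ -(m : ℂ)) (n : ℕ) : poch x n ≠ 0 := by
  induction n with
  | zero => simp [poch]
  | succ n ih =>
    rw [poch_succ]
    exact mul_ne_zero ih fun h => hx n (eq_neg_of_add_eq_zero_left h)

lemma poch_add (x : ℂ) (l j : ℕ) : poch x (l + j) = poch x l * poch (x + l) j := by
  induction j with
  | zero => simp [poch]
  | succ j ih =>
    rw [← add_assoc, poch_succ, poch_succ, ih]
    push_cast
    ring

lemma poch_reflect (y : ℂ) (j l : ℕ) :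
    poch y (j + l) = (-1) ^ l * poch (1 - y - ((j + l : ℕ) : ℂ)) l * poch y j := by
  have key : ∀ (l : ℕ) (x : ℂ), poch (1 - x - l) l = (-1) ^ l * poch x l := by
    intro l
    induction l with
    | zero => intro x; simp [poch]
    | succ l ih =>
      intro x
      have h1 : poch (1 - x - ((l + 1 : ℕ) : ℂ)) (l + 1)
          = poch (1 - x - ((l + 1 : ℕ) : ℂ)) 1 * poch (1 - x - l) l := by
        rw [add_comm l 1, poch_add]
        congr 2
        push_cast
        ring
      rw [h1, ih, poch_succ x l]
      simp only [poch, ascPochhammer_one, Polynomial.eval_X]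
      push_cast
      ring
  have h := key l (y + j)
  have e : (1 : ℂ) - y - ((j + l : ℕ) : ℂ) = 1 - (y + j) - l := by push_cast; ring
  rw [e, h, poch_add]
  have : ((-1 : ℂ) ^ l) * (-1) ^ l = 1 := by rw [← mul_pow]; simp
  linear_combination (-(poch y j * poch (y + j) l)) * this

lemma Gamma_add_nat {c : ℂ} (hc : ∀ m : ℕ, c ≠ -(m : ℂ)) (n : ℕ) :
    Complex.Gamma (c + n) = Complex.Gamma c * poch c n := by
  induction n with
  | zero => simp [poch]
  | succ n ih =>
    have hn : c + n ≠ 0 := fun h => hc n (eq_neg_of_add_eq_zero_left h)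
    have e : c + ((n + 1 : ℕ) : ℂ) = (c + n) + 1 := by push_cast; ring
    rw [e, Complex.Gamma_add_one _ hn, ih, poch_succ]
    ring

/-- Where the Gauss series is defined, `gaussReg` is Mathlib's `₂F₁` divided by `Γ(c)`. -/
theorem gaussReg_eq {c : ℂ} (hc : ∀ m : ℕ, c ≠ -(m : ℂ)) (α β z : ℂ) :
    gaussReg α β c z = ordinaryHypergeometric α β c z / Complex.Gamma c := by
  rw [ordinaryHypergeometric_eq_tsum, gaussReg, ← tsum_div_const]
  congr 1
  funext n
  rw [Gamma_add_nat hc]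
  have h1 := poch_ne_zero hc n
  have h2 := Complex.Gamma_ne_zero hc
  simp only [poch, smul_eq_mul] at h1 ⊢
  field_simp

/-- Where no denominator vanishes, the two forms of `A_k^{(p)}` agree. -/
theorem coeffA_eq_coeffAFrac {p : ℕ} (a b : ℕ → ℂ)
    (hB : ∀ i ∈ Finset.Icc 1 (p - 2), ∀ m : ℕ, tailDiff p a b i ≠ -(m : ℂ))
    (hb : ∀ i ∈ Finset.Icc 1 (p - 2), ∀ m : ℕ, b i - a (i + 2) ≠ -(m : ℂ)) (k : ℕ) :
    coeffA p a b k = coeffAFrac p a b k := by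
  have main : ∀ d i k : ℕ, 1 ≤ i → i + d ≤ p - 2 + 1 →
      nestedSum p a b d i k = nestedFrac p a b d i k := by
    intro d
    induction d with
    | zero => intro i k _ _; rfl
    | succ d ih =>
      intro i k hi hd
      rw [nestedSum, nestedFrac, Finset.mul_sum]
      refine Finset.sum_congr rfl fun l hl => ?_
      rw [ih (i + 1) l (by omega) (by omega), ← mul_assoc]
      congr 1
      have hmem : i ∈ Finset.Icc 1 (p - 2) := by simp; omega
      have hlk : l ≤ k := by simpa [Nat.lt_succ_iff] using hl
      obtain ⟨j, rfl⟩ := Nat.exists_eq_add_of_le' hlk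
      have n1 := poch_ne_zero (hB i hmem) l
      have n2 := poch_ne_zero (hb i hmem) (j + l)
      have e1 := poch_reflect (b i - a (i + 2)) j l
      have e2 : poch (tailDiff p a b i) (j + l)
          = poch (tailDiff p a b i) l * poch (tailDiff p a b i + l) j := by
        rw [add_comm j l, poch_add]
      have e3 : (((j + l) ! : ℕ) : ℂ) = (-1) ^ l * poch (-((j + l : ℕ) : ℂ)) l * (j ! : ℂ) := by
        have := poch_reflect 1 j l
        have f : ∀ n : ℕ, poch 1 n = (n ! : ℂ) := fun n => by simp [poch]
        rw [f, f] at this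
        simpa using this
      have hx : 1 + a (i + 2) - b i - ((j + l : ℕ) : ℂ)
          = 1 - (b i - a (i + 2)) - ((j + l : ℕ) : ℂ) := by ring
      have n3 : (((j + l) ! : ℕ) : ℂ) ≠ 0 := by exact_mod_cast (j + l).factorial_ne_zero
      have n4 : ((j ! : ℕ) : ℂ) ≠ 0 := by exact_mod_cast j.factorial_ne_zero
      rw [hx, e2, Nat.add_sub_cancel]
      have n5 : poch (1 - (b i - a (i + 2)) - ((j + l : ℕ) : ℂ)) l ≠ 0 := by
        intro h; rw [e1, h] at n2; simp at n2
      rw [e1]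
      have n6 : (-1 : ℂ) ^ l * poch (-((j + l : ℕ) : ℂ)) l * (j ! : ℂ) ≠ 0 := e3 ▸ n3
      rw [e3]
      have n7 : poch (-((j + l : ℕ) : ℂ)) l ≠ 0 := by
        intro h; rw [h] at n6; simp at n6
      have n8 : ((-1 : ℂ)) ^ l ≠ 0 := by simp
      field_simp
  exact main (p - 2) 1 k le_rfl (by omega)

end

noncomputable section

section

open Filter Topology Asymptotics Finset Finset.HasAntidiagonal

/-! Everything rests on one identity, `tsum_coeffA`: if `Re (a_j + n) > 0` for `j ≥ 3`, then the sum
over `k` of `A_k / Γ(s + a_1 + a_2 + k + n)` is the product of the `Γ(a_j + n)`, `j ≥ 3`, divided by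
that of all `Γ(b_j + n)`. Up to `Γ(a_1 + n) Γ(a_2 + n) / n!` this is the `n`-th Taylor coefficient
of `Φ`. The identity is proved level by level: one level of the nested sum (`liftSeq`) multiplies a
factorial series by `Γ(a) / Γ(b)`, which is Gauss's theorem `hasSum_gaussTerm` applied inside a
double series (`tsum_liftSeq`). The shift by `n` is free, because `A_k` depends only on differences
of parameters.

Inserting the identity into `Φ` and exchanging the summations gives (b); at `z = 1` Gauss's theorem
sums the inner series and gives (d). The exchange needs the true growth of `A_k`, namely `A_k / k! =
O(k ^ (Re (s + a_1 + a_2) - δ - 2))` for every `δ` below all `Re a_j`, `j ≥ 3`. Absolute values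
inside the nested sum may be too crude for this: convolution with `(β)_m / m!` acts like a
fractional difference when `Re β < 0`. Hence the growth is recorded together with that of all finite
differences (`IsSymbol`), a class stable under these convolutions (`IsSymbol.binomConv`).

For (c), the Gauss series in (b) are continued to `z = 1` by the classical connection formula
`isConn`: Wronskians show that a connection exists, limits at `t = 1 - z → 0+` find one coefficient
for `Re S > 0` and the other for `Re S < 0`, and a contiguity relation reaches all other `S`.
Rearranging then yields the expansion with coefficients `g_n(0)` and `g_n(s)`, but the crude bounds
used give only a small disc (`exists_expansion`). The radius becomes `1` because `Φ` solves the
hypergeometric differential equation: uniqueness of expansions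
(`coeff_eq_zero_of_add_cpow_mul_eq_zero`) turns it into recurrences for the two coefficient
sequences, and these force convergence in the unit disc (`HasExpansion.convRad_one`).

Finally the condition `Re a_j > 0` is dropped by integration: `Φ'` is the same function with all
parameters raised by one. Each integration leaves a constant free, which is why finitely many `c_n`
may have no formula. Part (a) is `coeffA_eq_coeffAFrac`. -/

/-! ### Pochhammer symbols and the growth of Gamma along the integers. -/

lemma poch_zero (x : ℂ) : poch x 0 = 1 := by simp [poch]

lemma poch_eq_prod (x : ℂ) (n : ℕ) : poch x n = ∏ j ∈ range n, (x + j) := by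
  induction n with
  | zero => simp [poch]
  | succ n ih => rw [poch_succ, prod_range_succ, ih]

lemma poch_one (n : ℕ) : poch 1 n = (n ! : ℂ) := by simp [poch]

lemma poch_succ' (x : ℂ) (n : ℕ) : poch x (n + 1) = x * poch (x + 1) n := by
  rw [add_comm n 1, poch_add, poch_succ, poch_zero]
  simp

lemma poch_neg_eq_zero {m n : ℕ} (h : m < n) : poch (-(m : ℂ)) n = 0 := by
  rw [poch_eq_prod]
  exact prod_eq_zero (mem_range.2 h) (by simp)

lemma factorial_cast_ne_zero (n : ℕ) : (n ! : ℂ) ≠ 0 := by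
  exact_mod_cast n.factorial_ne_zero

lemma Gamma_nat_eq (n : ℕ) : Complex.Gamma (1 + n) = (n ! : ℂ) := by
  rw [add_comm, Complex.Gamma_nat_eq_factorial]

lemma tendsto_nat_div_add (x : ℂ) :
    Tendsto (fun n : ℕ => (n : ℂ) / (x + n)) atTop (𝓝 1) := by
  have h := tendsto_natCast_div_add_atTop (𝕜 := ℂ) x
  refine h.congr fun n => by rw [add_comm]

lemma eventually_add_nat_ne_zero (x : ℂ) : ∀ᶠ n : ℕ in atTop, x + n ≠ 0 := by
  filter_upwards [eventually_gt_atTop ⌈‖x‖⌉₊] with n hn h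
  have h1 : ‖x‖ < n := Nat.lt_of_ceil_lt hn
  rw [eq_neg_of_add_eq_zero_left h] at h1
  simp at h1

/-- Stirling-type asymptotics of `Γ(x + n)` along the natural numbers. -/
theorem tendsto_Gamma_add_nat (x : ℂ) :
    Tendsto (fun n : ℕ => Complex.Gamma (x + n) / ((n : ℂ) ^ (x - 1) * n !)) atTop (𝓝 1) := by
  have base : ∀ x : ℂ, (∀ m : ℕ, x ≠ -(m : ℂ)) →
      Tendsto (fun n : ℕ => Complex.Gamma (x + n + 1) / ((n : ℂ) ^ x * n !)) atTop (𝓝 1) := by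
    intro x hx
    have hG := Complex.Gamma_ne_zero hx
    have h := (tendsto_const_nhds (x := Complex.Gamma x)).div (Complex.GammaSeq_tendsto_Gamma x) hG
    rw [div_self hG] at h
    refine h.congr fun n => ?_
    have e : x + n + 1 = x + ((n + 1 : ℕ) : ℂ) := by push_cast; ring
    rw [Pi.div_apply, e, Gamma_add_nat hx, Complex.GammaSeq, poch_eq_prod, div_div_eq_mul_div]
  -- Descending from `x + 1` to `x` reaches the poles `x = -m`, which Euler's limit formula in
  -- `base` leaves out.
  have step : ∀ x : ℂ,
      Tendsto (fun n : ℕ => Complex.Gamma (x + 1 + n + 1) / ((n : ℂ) ^ (x + 1) * n !)) atTop (𝓝 1) →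
      Tendsto (fun n : ℕ => Complex.Gamma (x + n + 1) / ((n : ℂ) ^ x * n !)) atTop (𝓝 1) := by
    intro x h
    have h2 := h.mul (tendsto_nat_div_add (x + 1))
    rw [one_mul] at h2
    refine h2.congr' ?_
    filter_upwards [eventually_add_nat_ne_zero (x + 1), eventually_gt_atTop 0] with n hn hn0
    have hn0' : (n : ℂ) ≠ 0 := by exact_mod_cast hn0.ne'
    rw [Complex.Gamma_add_one _ hn, Complex.cpow_add _ _ hn0', Complex.cpow_one]
    have e : x + 1 + n = x + n + 1 := by ring
    rw [e] at hn ⊢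
    field_simp
  have all : ∀ x : ℂ,
      Tendsto (fun n : ℕ => Complex.Gamma (x + n + 1) / ((n : ℂ) ^ x * n !)) atTop (𝓝 1) := by
    intro x
    obtain ⟨N, hN⟩ := exists_nat_gt (-x.re)
    have key : ∀ M : ℕ, ∀ y : ℂ, 0 < (y + M).re →
        Tendsto (fun n : ℕ => Complex.Gamma (y + n + 1) / ((n : ℂ) ^ y * n !)) atTop (𝓝 1) := by
      intro M
      induction M with
      | zero =>
        intro y hy
        refine base y fun m hm => ?_
        rw [hm] at hy
        simp at hy
        have : (0 : ℝ) ≤ m := m.cast_nonneg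
        linarith
      | succ M ih =>
        intro y hy
        refine step y (ih (y + 1) ?_)
        simp at hy ⊢
        linarith
    exact key N x (by simp; linarith)
  refine (all (x - 1)).congr fun n => ?_
  congr 2
  ring

lemma tendsto_add_one_rpow_div (r : ℝ) :
    Tendsto (fun n : ℕ => (n : ℝ) ^ r / ((n : ℝ) + 1) ^ r) atTop (𝓝 1) := by
  have h : Tendsto (fun n : ℕ => (n : ℝ) / (n + 1)) atTop (𝓝 1) :=
    tendsto_natCast_div_add_atTop (𝕜 := ℝ) 1
  have h2 := h.rpow_const (p := r) (Or.inl one_ne_zero)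
  rw [Real.one_rpow] at h2
  refine h2.congr fun n => ?_
  rw [Real.div_rpow (by positivity) (by positivity)]

lemma tendsto_norm_Gamma_add_nat (x : ℂ) :
    Tendsto (fun n : ℕ => ‖Complex.Gamma (x + n)‖ / (((n : ℝ) + 1) ^ (x.re - 1) * n !))
      atTop (𝓝 1) := by
  have h := (tendsto_Gamma_add_nat x).norm.mul (tendsto_add_one_rpow_div (x.re - 1))
  rw [norm_one, one_mul] at h
  refine h.congr' ?_
  filter_upwards [eventually_gt_atTop 0] with n hn
  have h1 : (0 : ℝ) < (n : ℝ) ^ (x.re - 1) := by positivity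
  rw [norm_div, norm_mul, Complex.norm_natCast_cpow_of_pos hn]
  simp only [Complex.sub_re, Complex.one_re, RCLike.norm_natCast]
  field_simp

lemma exists_forall_le_of_tendsto {f : ℕ → ℝ} {l : ℝ} (h : Tendsto f atTop (𝓝 l)) :
    ∃ C : ℝ, 0 < C ∧ ∀ n, f n ≤ C := by
  obtain ⟨C, hC⟩ := h.bddAbove_range
  exact ⟨max C 1, by positivity, fun n => (hC ⟨n, rfl⟩).trans (le_max_left _ _)⟩

lemma norm_Gamma_add_nat_le (x : ℂ) : ∃ C : ℝ, 0 < C ∧ ∀ n : ℕ,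
    ‖Complex.Gamma (x + n)‖ ≤ C * (((n : ℝ) + 1) ^ (x.re - 1) * n !) := by
  obtain ⟨C, hC, h⟩ := exists_forall_le_of_tendsto (tendsto_norm_Gamma_add_nat x)
  refine ⟨C, hC, fun n => ?_⟩
  rw [← div_le_iff₀ (by positivity)]
  exact h n

lemma norm_inv_Gamma_add_nat_le (x : ℂ) : ∃ C : ℝ, 0 < C ∧ ∀ n : ℕ,
    ‖(Complex.Gamma (x + n))⁻¹‖ ≤ C * (((n : ℝ) + 1) ^ (1 - x.re) / n !) := by
  obtain ⟨C, hC, h⟩ := exists_forall_le_of_tendsto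
    ((tendsto_norm_Gamma_add_nat x).inv₀ one_ne_zero)
  refine ⟨C, hC, fun n => ?_⟩
  have h1 : (0 : ℝ) < (n : ℝ) + 1 := by positivity
  have h2 := h n
  have e : ((n : ℝ) + 1) ^ (1 - x.re) = (((n : ℝ) + 1) ^ (x.re - 1))⁻¹ := by
    rw [← Real.rpow_neg h1.le, neg_sub]
  rw [inv_div, mul_div_assoc, mul_comm, div_eq_mul_inv, ] at h2
  rw [e, norm_inv]
  have h3 : (0 : ℝ) < ((n : ℝ) + 1) ^ (x.re - 1) := by positivity
  have h4 : (0 : ℝ) < (n ! : ℝ) := by positivity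
  calc ‖Complex.Gamma (x + n)‖⁻¹
      = ((n ! : ℝ) * ‖Complex.Gamma (x + n)‖⁻¹ * ((n : ℝ) + 1) ^ (x.re - 1))
          * ((((n : ℝ) + 1) ^ (x.re - 1))⁻¹ / n !) := by field_simp
    _ ≤ C * ((((n : ℝ) + 1) ^ (x.re - 1))⁻¹ / n !) := by gcongr

lemma Gamma_add_nat_eventually (x : ℂ) :
    ∀ᶠ n : ℕ in atTop, Complex.Gamma (x + n) ≠ 0 := by
  filter_upwards [eventually_gt_atTop ⌈‖x‖⌉₊] with n hn
  refine Complex.Gamma_ne_zero fun m hm => ?_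
  have h1 : ‖x‖ < n := Nat.lt_of_ceil_lt hn
  have : x = -((m + n : ℕ) : ℂ) := by push_cast; linear_combination hm
  rw [this, norm_neg, Complex.norm_natCast] at h1
  push_cast at h1
  have : (0 : ℝ) ≤ m := m.cast_nonneg
  linarith

lemma norm_poch_le (x : ℂ) : ∃ C : ℝ, 0 < C ∧ ∀ n : ℕ,
    ‖poch x n‖ ≤ C * (((n : ℝ) + 1) ^ (x.re - 1) * n !) := by
  by_cases hx : ∀ m : ℕ, x ≠ -(m : ℂ)
  · obtain ⟨C, hC, h⟩ := norm_Gamma_add_nat_le x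
    have hG := norm_pos_iff.2 (Complex.Gamma_ne_zero hx)
    refine ⟨C / ‖Complex.Gamma x‖, by positivity, fun n => ?_⟩
    have h1 := h n
    rw [Gamma_add_nat hx, norm_mul] at h1
    rw [div_mul_eq_mul_div, le_div_iff₀ hG, mul_comm]
    exact h1
  · push Not at hx
    obtain ⟨m, rfl⟩ := hx
    have hlim : Tendsto (fun n : ℕ => ‖poch (-(m : ℂ)) n‖ /
        (((n : ℝ) + 1) ^ ((-(m : ℂ)).re - 1) * n !)) atTop (𝓝 0) := by
      refine tendsto_const_nhds.congr' ?_
      filter_upwards [eventually_gt_atTop m] with n hn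
      rw [poch_neg_eq_zero hn]
      simp
    obtain ⟨C, hC, h⟩ := exists_forall_le_of_tendsto hlim
    refine ⟨C, hC, fun n => ?_⟩
    rw [← div_le_iff₀ (by positivity)]
    exact h n

/-! ### Sequences of symbol type -/

/-- The weight `(n + 1) ^ r`. -/
def wt (r : ℝ) (n : ℕ) : ℝ := ((n : ℝ) + 1) ^ r

lemma wt_pos (r : ℝ) (n : ℕ) : 0 < wt r n := by unfold wt; positivity

lemma wt_add (r s : ℝ) (n : ℕ) : wt (r + s) n = wt r n * wt s n :=
  Real.rpow_add (by positivity) _ _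

/-- The weight has no zeros, so an eventual bound becomes a bound for all `n` after enlarging the
constant. -/
lemma isBigO_wt_iff {r : ℝ} {f : ℕ → ℂ} :
    f =O[atTop] wt r ↔ ∃ C, 0 < C ∧ ∀ n, ‖f n‖ ≤ C * wt r n := by
  rw [isBigO_nat_atTop_iff (fun n h => absurd h (wt_pos r n).ne')]
  constructor
  · rintro ⟨C, hC⟩
    refine ⟨max C 1, by positivity, fun n => (hC n).trans ?_⟩
    rw [Real.norm_of_nonneg (wt_pos r n).le]
    exact mul_le_mul_of_nonneg_right (le_max_left _ _) (wt_pos r n).le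
  · rintro ⟨C, _, hC⟩
    refine ⟨C, fun n => ?_⟩
    rw [Real.norm_of_nonneg (wt_pos r n).le]
    exact hC n

lemma wt_succ_isBigO (r : ℝ) : (fun n => wt r (n + 1)) =O[atTop] wt r := by
  have h := tendsto_add_one_rpow_div (-r)
  have h2 := (tendsto_add_atTop_iff_nat 1).2 h
  refine isBigO_of_div_tendsto_nhds (c := 1) (by filter_upwards with n hn; exact absurd hn (wt_pos r n).ne') ?_
  refine h2.congr fun n => ?_
  have h3 : (0 : ℝ) < (n : ℝ) + 1 := by positivity
  have h4 : (0 : ℝ) < (n : ℝ) + 1 + 1 := by positivity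
  simp only [wt, Pi.div_apply, Nat.cast_add, Nat.cast_one]
  rw [Real.rpow_neg h3.le, Real.rpow_neg h4.le]
  field_simp

lemma isBigO_shift {r : ℝ} {f : ℕ → ℂ} (h : f =O[atTop] wt r) :
    (fun n => f (n + 1)) =O[atTop] wt r :=
  (h.comp_tendsto (tendsto_add_atTop_nat 1)).trans (wt_succ_isBigO r)

lemma isBigO_of_shift {r : ℝ} {f : ℕ → ℂ} (h : (fun n => f (n + 1)) =O[atTop] wt r) :
    f =O[atTop] wt r := by
  have h2 : (fun n => wt r n) =O[atTop] fun n => wt r (n + 1) := by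
    have := (wt_succ_isBigO (-r)).inv_rev (by filter_upwards with n hn; exact absurd hn (wt_pos _ _).ne')
    refine (this.congr (fun n => ?_) fun n => ?_) <;>
    · unfold wt; rw [Real.rpow_neg (by positivity), inv_inv]
  have h3 := h.trans h2
  rw [isBigO_iff] at h3 ⊢
  obtain ⟨c, hc⟩ := h3
  refine ⟨c, ?_⟩
  obtain ⟨N, hN⟩ := eventually_atTop.1 hc
  filter_upwards [eventually_ge_atTop (N + 1)] with n hn
  obtain ⟨m, rfl⟩ := Nat.exists_eq_add_of_le' (Nat.one_le_of_lt hn)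
  exact hN m (by omega)

/-- `e` is of symbol type of order `r`: its `j`-th differences are `O(n ^ (r - j))`. -/
def IsSymbol (r : ℝ) (e : ℕ → ℂ) : Prop :=
  ∀ j : ℕ, (fwdDiff 1)^[j] e =O[atTop] wt (r - j)

lemma fwdDiff_iter_congr {e f : ℕ → ℂ} (h : e =ᶠ[atTop] f) (j : ℕ) :
    (fwdDiff 1)^[j] e =ᶠ[atTop] (fwdDiff 1)^[j] f := by
  induction j generalizing e f with
  | zero => exact h
  | succ j ih =>
    rw [Function.iterate_succ_apply, Function.iterate_succ_apply]
    refine ih ?_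
    filter_upwards [h, (tendsto_add_atTop_nat 1).eventually h] with n h1 h2
    simp only [fwdDiff]
    rw [h1, h2]

namespace IsSymbol

lemma congr {r : ℝ} {e f : ℕ → ℂ} (he : IsSymbol r e) (h : e =ᶠ[atTop] f) : IsSymbol r f :=
  fun j => (he j).congr' (fwdDiff_iter_congr h j) EventuallyEq.rfl

lemma isBigO {r : ℝ} {e : ℕ → ℂ} (he : IsSymbol r e) : e =O[atTop] wt r := by
  simpa using he 0

lemma fwdDiff {r : ℝ} {e : ℕ → ℂ} (he : IsSymbol r e) : IsSymbol (r - 1) (fwdDiff 1 e) := by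
  intro j
  have h := he (j + 1)
  rw [Function.iterate_succ_apply] at h
  convert h using 2
  push_cast
  ring

lemma shift {r : ℝ} {e : ℕ → ℂ} (he : IsSymbol r e) : IsSymbol r (fun n => e (n + 1)) := by
  intro j
  have : (_root_.fwdDiff 1)^[j] (fun n => e (n + 1))
      = fun n => (_root_.fwdDiff 1)^[j] e (n + 1) := by
    funext n
    exact fwdDiff_iter_comp_add 1 e 1 j n
  rw [this]
  exact isBigO_shift (he j)

/-- Discrete Leibniz rule: `Δ(e f)(n) = Δe(n) f(n + 1) + e(n) Δf(n)`, and both summands are products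
of symbols of total order one less. -/
lemma mul {r s : ℝ} {e f : ℕ → ℂ} (he : IsSymbol r e) (hf : IsSymbol s f) :
    IsSymbol (r + s) (fun n => e n * f n) := by
  intro j
  induction j generalizing r s e f with
  | zero =>
    have := he.isBigO.mul hf.isBigO
    simp only [Function.iterate_zero, id_eq, Nat.cast_zero, sub_zero]
    exact this.congr_right fun n => (wt_add r s n).symm
  | succ j ih =>
    rw [Function.iterate_succ_apply]
    have e1 : _root_.fwdDiff 1 (fun n => e n * f n)
        = (fun n => _root_.fwdDiff 1 e n * f (n + 1)) + fun n => e n * _root_.fwdDiff 1 f n := by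
      funext n
      simp only [_root_.fwdDiff, Pi.add_apply]
      ring
    rw [e1, fwdDiff_iter_add]
    have h1 := ih he.fwdDiff hf.shift
    have h2 := ih he hf.fwdDiff
    have e2 : r - 1 + s - j = r + s - (j + 1 : ℕ) := by push_cast; ring
    have e3 : r + (s - 1) - j = r + s - (j + 1 : ℕ) := by push_cast; ring
    rw [e2] at h1
    rw [e3] at h2
    exact h1.add h2

lemma const_mul {r : ℝ} {e : ℕ → ℂ} (he : IsSymbol r e) (c : ℂ) :
    IsSymbol r (fun n => c * e n) := by
  intro j
  have : (_root_.fwdDiff 1)^[j] (fun n => c * e n) = c • (_root_.fwdDiff 1)^[j] e := by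
    rw [← fwdDiff_iter_const_smul]
    rfl
  rw [this]
  exact (he j).const_smul_left c

end IsSymbol

/-- Quotients of Gamma functions are of symbol type. -/
lemma isSymbol_Gamma_div (x y : ℂ) :
    IsSymbol (x - y).re (fun n : ℕ => Complex.Gamma (x + n) / Complex.Gamma (y + n)) := by
  intro j
  induction j generalizing y with
  | zero =>
    obtain ⟨C, hC, h1⟩ := norm_Gamma_add_nat_le x
    obtain ⟨D, hD, h2⟩ := norm_inv_Gamma_add_nat_le y
    rw [isBigO_wt_iff]
    refine ⟨C * D, by positivity, fun n => ?_⟩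
    have h3 : (0 : ℝ) < n ! := by positivity
    simp only [Function.iterate_zero, id_eq, div_eq_mul_inv]
    rw [norm_mul]
    refine (mul_le_mul (h1 n) (h2 n) (norm_nonneg _) (by positivity)).trans_eq ?_
    have : (x - y).re - (0 : ℕ) = (x.re - 1) + (1 - y.re) := by simp
    rw [this, wt_add]
    unfold wt
    field_simp
  | succ j ih =>
    rw [Function.iterate_succ_apply]
    -- `Δ(Γ(x + n) / Γ(y + n)) = (x - y) Γ(x + n) / Γ(y + 1 + n)`: differencing stays in the family
    -- and raises `y` by one.
    have h := ((ih (y + 1)).const_smul_left (x - y))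
    rw [← fwdDiff_iter_const_smul] at h
    have e1 : (x - (y + 1)).re - (j : ℝ) = (x - y).re - ((j + 1 : ℕ) : ℝ) := by
      simp; ring
    rw [e1] at h
    refine h.congr' (fwdDiff_iter_congr ?_ j) EventuallyEq.rfl
    filter_upwards [eventually_add_nat_ne_zero x, eventually_add_nat_ne_zero y,
      Gamma_add_nat_eventually y] with n h1 h2 h3
    simp only [fwdDiff, Pi.smul_apply, smul_eq_mul, Nat.cast_add, Nat.cast_one]
    have e2 : y + 1 + n = y + n + 1 := by ring
    rw [e2, ← add_assoc, ← add_assoc, Complex.Gamma_add_one _ h1, Complex.Gamma_add_one _ h2]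
    field_simp
    ring

lemma IsSymbol.add {r : ℝ} {e f : ℕ → ℂ} (he : IsSymbol r e) (hf : IsSymbol r f) :
    IsSymbol r (fun n => e n + f n) := by
  intro j
  have : (_root_.fwdDiff 1)^[j] (fun n => e n + f n)
      = (_root_.fwdDiff 1)^[j] e + (_root_.fwdDiff 1)^[j] f := fwdDiff_iter_add 1 e f j
  rw [this]
  exact (he j).add (hf j)

lemma isSymbol_natCast : IsSymbol 1 (fun n : ℕ => (n : ℂ)) := by
  have h := isSymbol_Gamma_div 1 0
  simp only [sub_zero, Complex.one_re] at h
  refine h.congr ?_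
  filter_upwards [eventually_gt_atTop 0] with n hn
  obtain ⟨m, rfl⟩ := Nat.exists_eq_add_of_le' hn
  rw [Gamma_nat_eq, zero_add]
  have : ((m + 1 : ℕ) : ℂ) = 1 + m := by push_cast; ring
  rw [this, Gamma_nat_eq, Nat.factorial_succ]
  have := factorial_cast_ne_zero m
  push_cast
  field_simp
  ring

/-! ### Binomial convolution of symbols. -/

/-- Convolution with the coefficients `(β)_m / m!` of `(1 - t) ^ (-β)`. -/
def binomConv (β : ℂ) (e : ℕ → ℂ) (k : ℕ) : ℂ :=
  ∑ l ∈ range (k + 1), poch β (k - l) / ((k - l) ! : ℂ) * e l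

lemma poch_div_factorial_sub (β : ℂ) (m : ℕ) :
    poch β (m + 1) / ((m + 1) ! : ℂ) - poch β m / (m ! : ℂ)
      = poch (β - 1) (m + 1) / ((m + 1) ! : ℂ) := by
  rw [poch_succ, poch_succ' (β - 1), sub_add_cancel, Nat.factorial_succ]
  have h1 := factorial_cast_ne_zero m
  have h2 : ((m : ℂ) + 1) ≠ 0 := by exact_mod_cast m.succ_ne_zero
  push_cast
  field_simp
  ring

/-- On generating functions, differencing is multiplication by `1 - t`, which turns `(1 - t) ^ (-β)`
into `(1 - t) ^ (-(β - 1))`. -/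
lemma binomConv_succ_sub (β : ℂ) (e : ℕ → ℂ) (k : ℕ) :
    binomConv β e (k + 1) - binomConv β e k = binomConv (β - 1) e (k + 1) := by
  unfold binomConv
  rw [sum_range_succ, sum_range_succ _ (k + 1), add_sub_right_comm, ← sum_sub_distrib]
  congr 1
  · refine sum_congr rfl fun l hl => ?_
    have hl' : l ≤ k := Nat.lt_succ_iff.1 (mem_range.1 hl)
    rw [Nat.succ_sub hl', ← sub_mul]
    congr 1
    exact poch_div_factorial_sub β (k - l)
  · simp [poch_zero]

/-- If `f` has generating function `f̂` with `f̂(0) = 0`, then `Δf` has generating function `(1 - t)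
f̂ / t`; the factor `1 - t` is compensated by `β + 1`. -/
lemma binomConv_of_zero (β : ℂ) (f : ℕ → ℂ) (h0 : f 0 = 0) (k : ℕ) :
    binomConv β f (k + 1) = binomConv (β + 1) (fwdDiff 1 f) k := by
  have h := binomConv_succ_sub (β + 1) f k
  rw [add_sub_cancel_right] at h
  rw [← h]
  unfold binomConv
  rw [sum_range_succ', h0, mul_zero, add_zero, ← sum_sub_distrib]
  refine sum_congr rfl fun l hl => ?_
  simp only [fwdDiff, Nat.add_sub_add_right]
  ring

/-- This is the derivative of `(1 - t) ^ (-β) ê(t)`, written as `(1 - t) ^ (-β - 1) (β ê + (1 - t)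
ê')`; the coefficients of `(1 - t) ê'` are the differences of `l e_l`. It raises `β` by one, gains a
factor `k + 1`, and keeps the symbol order of the convolved sequence. -/
lemma succ_mul_binomConv (β : ℂ) (e : ℕ → ℂ) (k : ℕ) :
    ((k + 1 : ℕ) : ℂ) * binomConv β e (k + 1)
      = binomConv (β + 1) (fun n => β * e n + fwdDiff 1 (fun l : ℕ => (l : ℂ) * e l) n) k := by
  have h := binomConv_of_zero β (fun l : ℕ => (l : ℂ) * e l) (by simp) k
  have h2 : binomConv (β + 1) (fun n => β * e n + fwdDiff 1 (fun l : ℕ => (l : ℂ) * e l) n) k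
      = ∑ l ∈ range (k + 1), β * (poch (β + 1) (k - l) / ((k - l) ! : ℂ)) * e l
        + binomConv β (fun l : ℕ => (l : ℂ) * e l) (k + 1) := by
    rw [h]
    unfold binomConv
    rw [← sum_add_distrib]
    exact sum_congr rfl fun l _ => by ring
  rw [h2]
  unfold binomConv
  rw [sum_range_succ _ (k + 1), sum_range_succ _ (k + 1), mul_add, mul_sum, ← add_assoc,
    ← sum_add_distrib]
  congr 1
  · refine sum_congr rfl fun l hl => ?_
    have hl' : l ≤ k := Nat.lt_succ_iff.1 (mem_range.1 hl)
    obtain ⟨m, rfl⟩ := Nat.exists_eq_add_of_le' hl'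
    have e1 : m + l + 1 - l = m + 1 := by omega
    rw [e1, Nat.add_sub_cancel, poch_succ', Nat.factorial_succ]
    have h1 := factorial_cast_ne_zero m
    have h2 : ((m : ℂ) + 1) ≠ 0 := by exact_mod_cast m.succ_ne_zero
    push_cast
    field_simp
    ring
  · ring

lemma sum_wt_le {κ : ℝ} (hκ : 0 < κ) :
    ∃ C, 0 < C ∧ ∀ k : ℕ, ∑ l ∈ range (k + 1), wt (κ - 1) l ≤ C * wt κ k := by
  rcases le_total 1 κ with h1 | h1
  · refine ⟨1, one_pos, fun k => ?_⟩
    calc ∑ l ∈ range (k + 1), wt (κ - 1) l ≤ ∑ _l ∈ range (k + 1), wt (κ - 1) k := by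
          refine sum_le_sum fun l hl => ?_
          have hl' : (l : ℝ) ≤ k := by exact_mod_cast Nat.lt_succ_iff.1 (mem_range.1 hl)
          exact Real.rpow_le_rpow (by positivity) (by linarith) (by linarith)
      _ = wt 1 k * wt (κ - 1) k := by simp [wt]
      _ = 1 * wt κ k := by rw [← wt_add]; simp
  · refine ⟨1 / κ, by positivity, fun k => ?_⟩
    induction k with
    | zero =>
      simp only [zero_add, sum_range_one]
      rw [show wt (κ - 1) 0 = 1 by simp [wt], show wt κ 0 = 1 by simp [wt], mul_one,
        le_div_iff₀ hκ]
      linarith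
    | succ k ih =>
      rw [sum_range_succ]
      have hx : (0 : ℝ) < ((k + 1 : ℕ) : ℝ) + 1 := by positivity
      -- Bernoulli's inequality `(1 - 1/x) ^ κ ≤ 1 - κ/x` with `x = k + 2` is the induction step for
      -- the constant `1 / κ`.
      have hb := rpow_one_add_le_one_add_mul_self
        (s := -(1 / (((k + 1 : ℕ) : ℝ) + 1))) (p := κ) (by
          rw [neg_le_neg_iff, div_le_one hx]; linarith [(k + 1).cast_nonneg (α := ℝ)]) hκ.le h1
      have e1 : 1 + -(1 / (((k + 1 : ℕ) : ℝ) + 1)) = ((k : ℝ) + 1) / (((k + 1 : ℕ) : ℝ) + 1) := by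
        field_simp; push_cast; ring
      rw [e1, Real.div_rpow (by positivity) hx.le, div_le_iff₀ (by positivity)] at hb
      have e2 : wt (κ - 1) (k + 1) = wt κ (k + 1) / (((k + 1 : ℕ) : ℝ) + 1) := by
        unfold wt; rw [Real.rpow_sub_one hx.ne']
      have h3 : wt κ k ≤ (1 + κ * -(1 / (((k + 1 : ℕ) : ℝ) + 1))) * wt κ (k + 1) := hb
      have h4 : (1 / κ) * wt κ k ≤ (1 / κ) * wt κ (k + 1) - wt (κ - 1) (k + 1) := by
        refine (mul_le_mul_of_nonneg_left h3 (by positivity)).trans_eq ?_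
        rw [e2]
        field_simp
        ring
      linarith

/-- For `Re β ≥ 1` the bound for `(β)_m / m!` increases with `m`, and absolute values suffice. For
smaller `Re β` cancellation matters; `succ_mul_binomConv` leads back to `β + 1`, its factor `k + 1`
absorbing the change of exponent. -/
lemma binomConv_isBigO (β : ℂ) {κ : ℝ} (hκ : 0 < κ) {e : ℕ → ℂ} (he : IsSymbol (κ - 1) e) :
    binomConv β e =O[atTop] wt (κ + β.re - 1) := by
  obtain ⟨N, hN⟩ := exists_nat_gt (1 - β.re)
  replace hN : 1 ≤ β.re + N := by linarith
  induction N generalizing β e with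
  | zero =>
    simp only [Nat.cast_zero, add_zero] at hN
    obtain ⟨C, hC, h1⟩ := isBigO_wt_iff.1 he.isBigO
    obtain ⟨D, hD, h2⟩ := norm_poch_le β
    obtain ⟨E, hE, h3⟩ := sum_wt_le hκ
    refine isBigO_wt_iff.2 ⟨D * C * E, by positivity, fun k => ?_⟩
    unfold binomConv
    calc ‖∑ l ∈ range (k + 1), poch β (k - l) / ((k - l) ! : ℂ) * e l‖
        ≤ ∑ l ∈ range (k + 1), (D * wt (β.re - 1) k) * (C * wt (κ - 1) l) := by
          refine norm_sum_le_of_le _ fun l hl => ?_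
          rw [norm_mul]
          refine mul_le_mul ?_ (h1 l) (norm_nonneg _) (mul_pos hD (wt_pos _ _)).le
          rw [norm_div, Complex.norm_natCast, div_le_iff₀ (by positivity)]
          refine (h2 (k - l)).trans ?_
          rw [mul_assoc]
          refine mul_le_mul_of_nonneg_left ?_ hD.le
          refine mul_le_mul_of_nonneg_right ?_ (by positivity)
          refine Real.rpow_le_rpow (by positivity) ?_ (by linarith)
          have : ((k - l : ℕ) : ℝ) ≤ k := by exact_mod_cast Nat.sub_le k l
          linarith
      _ = D * C * wt (β.re - 1) k * ∑ l ∈ range (k + 1), wt (κ - 1) l := by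
          rw [mul_sum]
          exact sum_congr rfl fun l _ => by ring
      _ ≤ D * C * wt (β.re - 1) k * (E * wt κ k) := by
          have := wt_pos (β.re - 1) k
          gcongr
          exact h3 k
      _ = D * C * E * wt (κ + β.re - 1) k := by
          rw [show κ + β.re - 1 = (β.re - 1) + κ by ring, wt_add]
          ring
  | succ N ih =>
    have hs : IsSymbol (κ - 1)
        (fun n => β * e n + fwdDiff 1 (fun l : ℕ => (l : ℂ) * e l) n) := by
      refine (he.const_mul β).add ?_
      have := (isSymbol_natCast.mul he).fwdDiff
      rwa [show 1 + (κ - 1) - 1 = κ - 1 by ring] at this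
    have h := ih (β + 1) hs (by push_cast at hN; simp; linarith)
    refine isBigO_of_shift ?_
    rw [isBigO_wt_iff] at h ⊢
    obtain ⟨C, hC, h⟩ := h
    refine ⟨C, hC, fun k => ?_⟩
    have h1 := h k
    rw [← succ_mul_binomConv, norm_mul, Complex.norm_natCast] at h1
    have e1 : wt (κ + (β + 1).re - 1) k = ((k + 1 : ℕ) : ℝ) * wt (κ + β.re - 1) k := by
      rw [show κ + (β + 1).re - 1 = 1 + (κ + β.re - 1) by simp; ring, wt_add]
      simp [wt]
    rw [e1, ← mul_assoc, mul_comm C, mul_assoc] at h1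
    exact le_of_mul_le_mul_left h1 (by positivity)

/-- Convolution with `(β)_m / m!` raises the order of a symbol by `Re β`. -/
theorem IsSymbol.binomConv (β : ℂ) {κ : ℝ} (hκ : 0 < κ) {e : ℕ → ℂ} (he : IsSymbol (κ - 1) e) :
    IsSymbol (κ + β.re - 1) (binomConv β e) := by
  intro j
  -- Differences of the convolution are convolutions with `β - j`, so the plain bound for every `β`
  -- bounds all differences.
  have key : ∀ (j : ℕ) (β : ℂ), (_root_.fwdDiff 1)^[j] (_root_.binomConv β e)
      = fun k => _root_.binomConv (β - j) e (k + j) := by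
    intro j
    induction j with
    | zero => intro β; simp
    | succ j ih =>
      intro β
      rw [Function.iterate_succ_apply', ih]
      funext k
      simp only [_root_.fwdDiff]
      have := binomConv_succ_sub (β - j) e (k + j)
      rw [show k + 1 + j = k + j + 1 by ring, this]
      push_cast
      rw [sub_sub]
      rfl
  rw [key]
  have h := binomConv_isBigO (β - j) hκ he
  rw [show κ + (β - j).re - 1 = κ + β.re - 1 - j by simp; ring] at h
  have h2 : ∀ m : ℕ, (fun k => _root_.binomConv (β - j) e (k + m))
      =O[atTop] wt (κ + β.re - 1 - j) := by
    intro m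
    induction m with
    | zero => simpa using h
    | succ m ih =>
      refine (isBigO_shift ih).congr_left fun k => ?_
      rw [add_right_comm, add_assoc]
  exact h2 j

/-! ### Gauss's summation theorem. -/

lemma summable_wt {r : ℝ} (hr : r < -1) : Summable (wt r) := by
  have h := (summable_nat_add_iff 1).2 (Real.summable_nat_rpow.2 hr)
  refine h.congr fun n => ?_
  simp [wt]

/-- A Peetre-type inequality: for `r ≥ 0` from `n + k + 1 ≤ (n + 1)(k + 1)`, for `r ≤ 0` by
monotonicity. -/
lemma wt_add_le (r : ℝ) (n k : ℕ) : wt r (n + k) ≤ wt |r| n * wt r k := by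
  have h1 : (1 : ℝ) ≤ (n : ℝ) + 1 := by linarith [n.cast_nonneg (α := ℝ)]
  rcases le_total 0 r with h | h
  · rw [abs_of_nonneg h]
    unfold wt
    rw [← Real.mul_rpow (by positivity) (by positivity)]
    refine Real.rpow_le_rpow (by positivity) ?_ h
    push_cast
    nlinarith [mul_nonneg (n.cast_nonneg (α := ℝ)) (k.cast_nonneg (α := ℝ))]
  · have h2 : wt r (n + k) ≤ wt r k := by
      refine Real.rpow_le_rpow_of_nonpos (by positivity) ?_ h
      push_cast
      linarith [n.cast_nonneg (α := ℝ)]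
    have h3 : 1 ≤ wt |r| n := Real.one_le_rpow h1 (abs_nonneg r)
    nlinarith [wt_pos r k]

/-- An inverse binomial coefficient decreases in `N`, so its value at `N = K` gives decay `m ^ (-K)`
of any wanted order, uniformly in `N ≥ K`. This dominates the Gauss series. -/
lemma factorial_mul_div_le {K N : ℕ} (h : K ≤ N) (m : ℕ) :
    ((N ! : ℝ) * m !) / (N + m)! ≤ K ! * wt (-K) m := by
  have h1 : (K + m)! * N ! ≤ (N + m)! * K ! := by
    have := Nat.choose_le_choose m (Nat.add_le_add_right h m)
    have e1 := Nat.add_choose_mul_factorial_mul_factorial K m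
    have e2 := Nat.add_choose_mul_factorial_mul_factorial N m
    calc (K + m)! * N ! = (K + m).choose m * (K ! * m ! * N !) := by rw [← e1]; ring
      _ ≤ (N + m).choose m * (K ! * m ! * N !) := Nat.mul_le_mul_right _ this
      _ = (N + m)! * K ! := by rw [← e2]; ring
  have h2 : m ! * (m + 1) ^ K ≤ (K + m)! := by
    rw [add_comm K, ← Nat.factorial_mul_ascFactorial]
    exact Nat.mul_le_mul_left _ (Nat.pow_succ_le_ascFactorial (m + 1) K)
  have h3 : m ! * (m + 1) ^ K * N ! ≤ (N + m)! * K ! := (Nat.mul_le_mul_right _ h2).trans h1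
  have h3' : (m ! : ℝ) * ((m : ℝ) + 1) ^ K * N ! ≤ (N + m)! * K ! := by exact_mod_cast h3
  have e : wt (-K) m = (((m : ℝ) + 1) ^ K)⁻¹ := by
    unfold wt; rw [Real.rpow_neg (by positivity), Real.rpow_natCast]
  rw [e, div_le_iff₀ (by positivity), ← div_eq_mul_inv, div_mul_eq_mul_div,
    le_div_iff₀ (by positivity)]
  linarith

/-- True at the poles as well: `Γ` takes the value `0` there, so that its inverse is the entire
function `1 / Γ`. -/
lemma inv_Gamma_eq (x : ℂ) (m : ℕ) :
    (Complex.Gamma (x + m))⁻¹ = (x + m) * (Complex.Gamma (x + 1 + m))⁻¹ := by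
  rw [Complex.one_div_Gamma_eq_self_mul_one_div_Gamma_add_one, add_right_comm]

lemma poch_eventually_eq (x : ℂ) :
    ∀ᶠ n : ℕ in atTop, poch x n = Complex.Gamma (x + n) * (Complex.Gamma x)⁻¹ := by
  by_cases hx : ∀ m : ℕ, x ≠ -(m : ℂ)
  · filter_upwards with n
    rw [Gamma_add_nat hx]
    field_simp [Complex.Gamma_ne_zero hx]
  · push Not at hx
    obtain ⟨m, rfl⟩ := hx
    filter_upwards [eventually_gt_atTop m] with n hn
    rw [poch_neg_eq_zero hn, Complex.Gamma_neg_nat_eq_zero]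
    simp

/-- The terms of the regularized Gauss series at `1`. -/
def gaussTerm (α β c : ℂ) (m : ℕ) : ℂ :=
  poch α m * poch β m / (m ! : ℂ) * (Complex.Gamma (c + m))⁻¹

lemma norm_gaussTerm_le (α β c : ℂ) :
    ∃ C, 0 < C ∧ ∀ m, ‖gaussTerm α β c m‖ ≤ C * wt ((α + β - c).re - 1) m := by
  obtain ⟨C, hC, h1⟩ := norm_poch_le α
  obtain ⟨D, hD, h2⟩ := norm_poch_le β
  obtain ⟨E, hE, h3⟩ := norm_inv_Gamma_add_nat_le c
  refine ⟨C * D * E, by positivity, fun m => ?_⟩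
  have hm : (0 : ℝ) < m ! := by positivity
  unfold gaussTerm
  rw [norm_mul, norm_div, norm_mul, Complex.norm_natCast]
  calc _ ≤ C * (wt (α.re - 1) m * m !) * (D * (wt (β.re - 1) m * m !)) / m !
        * (E * (wt (1 - c.re) m / m !)) := by
        have := wt_pos (α.re - 1) m
        have := wt_pos (β.re - 1) m
        gcongr
        exacts [h1 m, h2 m, h3 m]
    _ = _ := by
        rw [show (α + β - c).re - 1 = (α.re - 1) + (β.re - 1) + (1 - c.re) by simp; ring,
          wt_add, wt_add]
        field_simp

lemma summable_gaussTerm {α β c : ℂ} (h : 0 < (c - α - β).re) : Summable (gaussTerm α β c) := by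
  obtain ⟨C, _, hC⟩ := norm_gaussTerm_le α β c
  refine Summable.of_norm_bounded ((summable_wt ?_).mul_left C) hC
  simp at h ⊢
  linarith

lemma tendsto_wt_zero {r : ℝ} (hr : r < 0) : Tendsto (wt r) atTop (𝓝 0) := by
  have h := tendsto_rpow_neg_atTop (neg_pos.2 hr)
  rw [neg_neg] at h
  have h2 := (h.comp tendsto_natCast_atTop_atTop).comp (tendsto_add_atTop_nat 1)
  refine h2.congr fun n => ?_
  simp [wt]

/-- Gauss's contiguity relation. The difference of the two series telescopes to `-M` times the
`M`-th term, which is `O(M ^ (-Re a))`. -/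
lemma gauss_shift {α β a : ℂ} (ha : 0 < a.re) :
    a * ∑' m, gaussTerm α β (α + β + a) m
      = (a + α) * (a + β) * ∑' m, gaussTerm α β (α + β + (a + 1)) m := by
  have s1 : Summable (gaussTerm α β (α + β + a)) :=
    summable_gaussTerm (by ring_nf; exact ha)
  have s2 : Summable (gaussTerm α β (α + β + (a + 1))) :=
    summable_gaussTerm (by ring_nf; simp; linarith)
  have h : HasSum (fun m => a * gaussTerm α β (α + β + a) m
      - (a + α) * (a + β) * gaussTerm α β (α + β + (a + 1)) m)
      (a * ∑' m, gaussTerm α β (α + β + a) m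
        - (a + α) * (a + β) * ∑' m, gaussTerm α β (α + β + (a + 1)) m) :=
    (s1.hasSum.mul_left a).sub (s2.hasSum.mul_left _)
  have tel : ∀ M : ℕ, ∑ m ∈ range M, (a * gaussTerm α β (α + β + a) m
      - (a + α) * (a + β) * gaussTerm α β (α + β + (a + 1)) m)
      = -(M * gaussTerm α β (α + β + a) M) := by
    intro M
    induction M with
    | zero => simp
    | succ M ih =>
      rw [sum_range_succ, ih]
      unfold gaussTerm
      rw [inv_Gamma_eq (α + β + a) M]
      have e : α + β + a + ((M + 1 : ℕ) : ℂ) = α + β + a + 1 + M := by push_cast; ring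
      have e2 : α + β + (a + 1) + M = α + β + a + 1 + M := by ring
      rw [e, e2, poch_succ, poch_succ, Nat.factorial_succ]
      have h1 := factorial_cast_ne_zero M
      have h2 : ((M : ℂ) + 1) ≠ 0 := by exact_mod_cast M.succ_ne_zero
      push_cast
      field_simp
      ring
  have lim : Tendsto (fun M : ℕ => -((M : ℂ) * gaussTerm α β (α + β + a) M)) atTop (𝓝 0) := by
    obtain ⟨C, hC, hb⟩ := norm_gaussTerm_le α β (α + β + a)
    have h0 := (tendsto_wt_zero (r := -a.re) (by linarith)).const_mul C
    rw [mul_zero] at h0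
    refine squeeze_zero_norm (fun M => ?_) h0
    rw [norm_neg, norm_mul, Complex.norm_natCast]
    calc (M : ℝ) * ‖gaussTerm α β (α + β + a) M‖
        ≤ wt 1 M * (C * wt ((α + β - (α + β + a)).re - 1) M) := by
          refine mul_le_mul ?_ (hb M) (norm_nonneg _) (wt_pos _ _).le
          simp [wt]
      _ = C * wt (-a.re) M := by
          rw [show (-a.re) = 1 + ((α + β - (α + β + a)).re - 1) by simp, wt_add]
          ring
  have h3 := h.tendsto_sum_nat
  simp only [tel] at h3
  exact sub_eq_zero.1 (tendsto_nhds_unique h3 lim)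

lemma tendsto_Gamma_quotient (x y u v : ℂ) (h : x + y = u + v) :
    Tendsto (fun n : ℕ => Complex.Gamma (x + n) * Complex.Gamma (y + n)
      * ((Complex.Gamma (u + n))⁻¹ * (Complex.Gamma (v + n))⁻¹)) atTop (𝓝 1) := by
  have H := ((tendsto_Gamma_add_nat x).mul (tendsto_Gamma_add_nat y)).mul
    (((tendsto_Gamma_add_nat u).inv₀ one_ne_zero).mul ((tendsto_Gamma_add_nat v).inv₀ one_ne_zero))
  simp only [mul_one, inv_one] at H
  refine H.congr' ?_
  filter_upwards [eventually_gt_atTop 0] with n hn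
  have hn0 : (n : ℂ) ≠ 0 := by exact_mod_cast hn.ne'
  have hp : (n : ℂ) ^ (x - 1) * (n : ℂ) ^ (y - 1) = (n : ℂ) ^ (u - 1) * (n : ℂ) ^ (v - 1) := by
    rw [← Complex.cpow_add _ _ hn0, ← Complex.cpow_add _ _ hn0]
    congr 1
    linear_combination h
  have h1 : (n : ℂ) ^ (x - 1) ≠ 0 := by simp [Complex.cpow_eq_zero_iff, hn0]
  have h2 : (n : ℂ) ^ (y - 1) ≠ 0 := by simp [Complex.cpow_eq_zero_iff, hn0]
  have h3 := factorial_cast_ne_zero n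
  have h4 : (n : ℂ) ^ (u - 1) ≠ 0 := by simp [Complex.cpow_eq_zero_iff, hn0]
  have h5 : (n : ℂ) ^ (v - 1) ≠ 0 := by simp [Complex.cpow_eq_zero_iff, hn0]
  simp only [inv_div]
  calc _ = (Complex.Gamma (x + n) * Complex.Gamma (y + n)
      * ((Complex.Gamma (u + n))⁻¹ * (Complex.Gamma (v + n))⁻¹))
      * (((n : ℂ) ^ (u - 1) * (n : ℂ) ^ (v - 1)) / ((n : ℂ) ^ (x - 1) * (n : ℂ) ^ (y - 1))) := by
        field_simp
    _ = _ := by rw [hp, div_self (mul_ne_zero h4 h5), mul_one]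

/-- Gauss's summation theorem, in regularized form. -/
theorem hasSum_gaussTerm {α β a : ℂ} (ha : 0 < a.re) :
    HasSum (gaussTerm α β (α + β + a))
      (Complex.Gamma a * ((Complex.Gamma (a + α))⁻¹ * (Complex.Gamma (a + β))⁻¹)) := by
  have s1 : Summable (gaussTerm α β (α + β + a)) :=
    summable_gaussTerm (by ring_nf; exact ha)
  refine (s1.hasSum_iff).2 ?_
  have hpole : ∀ m : ℕ, a ≠ -(m : ℂ) := by
    intro m hm
    rw [hm] at ha
    simp at ha
    linarith [m.cast_nonneg (α := ℝ)]
  have iter : ∀ N : ℕ, poch a N * ∑' m, gaussTerm α β (α + β + a) m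
      = poch (a + α) N * poch (a + β) N * ∑' m, gaussTerm α β (α + β + (a + N)) m := by
    intro N
    induction N with
    | zero => simp [poch_zero]
    | succ N ih =>
      have h := gauss_shift (α := α) (β := β) (a := a + N) (by
        simp; linarith [N.cast_nonneg (α := ℝ)])
      rw [poch_succ, mul_right_comm, ih, poch_succ, poch_succ]
      have e : a + ((N + 1 : ℕ) : ℂ) = a + N + 1 := by push_cast; ring
      rw [e]
      linear_combination (poch (a + α) N * poch (a + β) N) * h
  set R := Complex.Gamma a * ((Complex.Gamma (a + α))⁻¹ * (Complex.Gamma (a + β))⁻¹) with hR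
  set σ := α + β + a with hσ
  -- By `iter` the sum over `m` of `f N m` does not depend on `N`. As `N → ∞` only the term `m = 0`
  -- survives, and its limit is the Gamma quotient `R`.
  let f : ℕ → ℕ → ℂ := fun N m => poch (a + α) N * poch (a + β) N / poch a N
    * gaussTerm α β (σ + N) m
  have hf : ∀ N, ∑' m, f N m = ∑' m, gaussTerm α β σ m := by
    intro N
    have h := iter N
    rw [← add_assoc, ← hσ] at h
    simp only [f]
    rw [tsum_mul_left, div_mul_eq_mul_div, ← h]
    field_simp [poch_ne_zero hpole N]
  have hQ : Tendsto (fun N : ℕ => poch (a + α) N * poch (a + β) N / poch a N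
      * (Complex.Gamma (σ + N))⁻¹) atTop (𝓝 R) := by
    have h := (tendsto_Gamma_quotient (a + α) (a + β) a σ (by rw [hσ]; ring)).const_mul R
    rw [mul_one] at h
    refine h.congr' ?_
    filter_upwards [poch_eventually_eq (a + α), poch_eventually_eq (a + β)] with N h1 h2
    rw [h1, h2, hR, Gamma_add_nat hpole]
    field_simp [Complex.Gamma_ne_zero hpole]
  obtain ⟨C1, hC1, b1⟩ := norm_poch_le (a + α)
  obtain ⟨C2, hC2, b2⟩ := norm_poch_le (a + β)
  obtain ⟨C3, hC3, b3⟩ := norm_inv_Gamma_add_nat_le a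
  obtain ⟨C4, hC4, b4⟩ := norm_poch_le α
  obtain ⟨C5, hC5, b5⟩ := norm_poch_le β
  obtain ⟨C6, hC6, b6⟩ := norm_inv_Gamma_add_nat_le σ
  -- `K` makes the exponent of the dominating weight in `m` smaller than `-1`.
  obtain ⟨K, hK⟩ := exists_nat_gt (α.re - 1 + (β.re - 1) + |1 - σ.re| + 1)
  have hGa := norm_pos_iff.2 (Complex.Gamma_ne_zero hpole)
  let B : ℝ := C1 * C2 * C3 * ‖Complex.Gamma a‖ * C4 * C5 * C6 * (K ! : ℝ)
  have hbound : ∀ᶠ N in atTop, ∀ m, ‖f N m‖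
      ≤ B * wt (α.re - 1 + (β.re - 1) + |1 - σ.re| + -K) m := by
    filter_upwards [eventually_ge_atTop K] with N hN m
    have e1 : f N m = poch (a + α) N * poch (a + β) N
        * (Complex.Gamma a * (Complex.Gamma (a + N))⁻¹)
        * (poch α m * poch β m / (m ! : ℂ) * (Complex.Gamma (σ + (m + N : ℕ)))⁻¹) := by
      simp only [f, gaussTerm]
      rw [Gamma_add_nat hpole, show σ + (N : ℂ) + m = σ + ((m + N : ℕ) : ℂ) by push_cast; ring]
      field_simp [Complex.Gamma_ne_zero hpole, poch_ne_zero hpole N]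
    rw [e1]
    simp only [norm_mul, norm_div, Complex.norm_natCast]
    have w1 := wt_pos ((a + α).re - 1) N
    have w2 := wt_pos ((a + β).re - 1) N
    have w3 := wt_pos (1 - a.re) N
    have w4 := wt_pos (α.re - 1) m
    have w5 := wt_pos (β.re - 1) m
    have w6 := wt_pos (1 - σ.re) (m + N)
    have w7 := wt_pos (|1 - σ.re|) m
    have w8 := wt_pos (1 - σ.re) N
    calc _ ≤ (C1 * (wt ((a + α).re - 1) N * N !)) * (C2 * (wt ((a + β).re - 1) N * N !))
          * (‖Complex.Gamma a‖ * (C3 * (wt (1 - a.re) N / N !)))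
          * ((C4 * (wt (α.re - 1) m * m !)) * (C5 * (wt (β.re - 1) m * m !)) / m !
            * (C6 * (wt (1 - σ.re) (m + N) / (m + N)!))) := by
          gcongr
          exacts [b1 N, b2 N, b3 N, b4 m, b5 m, b6 (m + N)]
      _ = C1 * C2 * C3 * ‖Complex.Gamma a‖ * C4 * C5 * C6
          * (wt ((a + α).re - 1) N * wt ((a + β).re - 1) N * wt (1 - a.re) N)
          * (wt (α.re - 1) m * wt (β.re - 1) m) * wt (1 - σ.re) (m + N)
          * ((N ! : ℝ) * m ! / (N + m)!) := by
          rw [add_comm N m]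
          field_simp
      _ ≤ C1 * C2 * C3 * ‖Complex.Gamma a‖ * C4 * C5 * C6
          * (wt ((a + α).re - 1) N * wt ((a + β).re - 1) N * wt (1 - a.re) N)
          * (wt (α.re - 1) m * wt (β.re - 1) m) * (wt |1 - σ.re| m * wt (1 - σ.re) N)
          * (K ! * wt (-K) m) := by
          gcongr
          exacts [wt_add_le _ m N, factorial_mul_div_le hN m]
      _ = B * (wt (α.re - 1) m * wt (β.re - 1) m * wt |1 - σ.re| m * wt (-K) m)
          * (wt ((a + α).re - 1) N * wt ((a + β).re - 1) N * wt (1 - a.re) N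
            * wt (1 - σ.re) N) := by
          simp only [B]; ring
      _ = _ := by
          rw [← wt_add, ← wt_add, ← wt_add, ← wt_add, ← wt_add, ← wt_add]
          -- The powers of `N` cancel exactly, so the bound is uniform in `N`.
          have : (a + α).re - 1 + ((a + β).re - 1) + (1 - a.re) + (1 - σ.re) = 0 := by
            rw [hσ]; simp; ring
          rw [this]
          simp [wt]
  have hlim : ∀ m, Tendsto (fun N => f N m) atTop (𝓝 (if m = 0 then R else 0)) := by
    intro m
    rcases Nat.eq_zero_or_pos m with rfl | hm
    · simp only [if_true]
      refine hQ.congr fun N => ?_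
      simp [f, gaussTerm, poch_zero]
    · rw [if_neg hm.ne']
      have h1 : Tendsto (fun N : ℕ => Complex.Gamma (σ + N) / Complex.Gamma (σ + m + N))
          atTop (𝓝 0) := by
        have h2 := (isSymbol_Gamma_div σ (σ + m)).isBigO
        refine h2.trans_tendsto (tendsto_wt_zero ?_)
        simp [hm]
      have h3 := (hQ.mul h1).const_mul (poch α m * poch β m / (m ! : ℂ))
      rw [mul_zero, mul_zero] at h3
      refine h3.congr' ?_
      filter_upwards [Gamma_add_nat_eventually σ] with N hN
      simp only [f, gaussTerm]
      rw [show σ + (N : ℂ) + m = σ + m + N from add_right_comm _ _ _]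
      generalize Complex.Gamma (σ + N) = G at hN
      generalize Complex.Gamma (σ + m + N) = G'
      field_simp
  have hT := tendsto_tsum_of_dominated_convergence
    ((summable_wt (r := α.re - 1 + (β.re - 1) + |1 - σ.re| + -K) (by linarith)).mul_left B)
    hlim hbound
  simp only [hf, tsum_ite_eq] at hT
  exact tendsto_nhds_unique tendsto_const_nhds hT

/-! ### One level of the nested sum. -/

lemma hasSum_antidiagonal {f : ℕ × ℕ → ℂ} {s : ℂ} (h : HasSum f s) :
    HasSum (fun n => ∑ p ∈ antidiagonal n, f p) s := by
  have h2 := (Finset.HasAntidiagonal.sigmaAntidiagonalEquivProd (A := ℕ)).hasSum_iff.2 h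
  refine (h2.sigma fun n => hasSum_fintype _).congr_fun ?_
  intro n
  exact (Finset.sum_coe_sort (antidiagonal n) f).symm

lemma summable_of_antidiagonal_le {f : ℕ × ℕ → ℂ} {g : ℕ → ℝ} (hg : Summable g)
    (h : ∀ᶠ k in atTop, ∑ p ∈ antidiagonal k, ‖f p‖ ≤ g k) : Summable f := by
  refine Summable.of_norm ?_
  rw [← (Finset.HasAntidiagonal.sigmaAntidiagonalEquivProd (A := ℕ)).summable_iff]
  refine (summable_sigma_of_nonneg fun _ => norm_nonneg _).2 ⟨fun n => Summable.of_finite, ?_⟩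
  refine Summable.of_norm_bounded_eventually_nat hg ?_
  filter_upwards [h] with k hk
  rw [Real.norm_of_nonneg (tsum_nonneg fun _ => norm_nonneg _)]
  refine le_of_eq_of_le ?_ hk
  rw [tsum_fintype]
  exact Finset.sum_coe_sort (antidiagonal k) fun p => ‖f p‖

lemma sum_norm_binomConv_le {β : ℂ} (hβ : 1 ≤ β.re) {κ : ℝ} (hκ : 0 < κ) {e : ℕ → ℂ}
    (he : e =O[atTop] wt (κ - 1)) :
    ∃ C, 0 < C ∧ ∀ k, ∑ l ∈ range (k + 1), ‖poch β (k - l) / ((k - l) ! : ℂ)‖ * ‖e l‖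
      ≤ C * wt (κ + β.re - 1) k := by
  obtain ⟨C, hC, h1⟩ := isBigO_wt_iff.1 he
  obtain ⟨D, hD, h2⟩ := norm_poch_le β
  obtain ⟨E, hE, h3⟩ := sum_wt_le hκ
  refine ⟨D * C * E, by positivity, fun k => ?_⟩
  calc ∑ l ∈ range (k + 1), ‖poch β (k - l) / ((k - l) ! : ℂ)‖ * ‖e l‖
      ≤ ∑ l ∈ range (k + 1), (D * wt (β.re - 1) k) * (C * wt (κ - 1) l) := by
        refine sum_le_sum fun l hl => ?_
        refine mul_le_mul ?_ (h1 l) (norm_nonneg _) (mul_pos hD (wt_pos _ _)).le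
        rw [norm_div, Complex.norm_natCast, div_le_iff₀ (by positivity)]
        refine (h2 (k - l)).trans ?_
        rw [mul_assoc]
        refine mul_le_mul_of_nonneg_left ?_ hD.le
        refine mul_le_mul_of_nonneg_right ?_ (by positivity)
        refine Real.rpow_le_rpow (by positivity) ?_ (by linarith)
        have : ((k - l : ℕ) : ℝ) ≤ k := by exact_mod_cast Nat.sub_le k l
        linarith
    _ = D * C * wt (β.re - 1) k * ∑ l ∈ range (k + 1), wt (κ - 1) l := by
        rw [mul_sum]
        exact sum_congr rfl fun l _ => by ring
    _ ≤ D * C * wt (β.re - 1) k * (E * wt κ k) := by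
        have := wt_pos (β.re - 1) k
        gcongr
        exact h3 k
    _ = D * C * E * wt (κ + β.re - 1) k := by
        rw [show κ + β.re - 1 = (β.re - 1) + κ by ring, wt_add]
        ring

/-- One level of the nested sum. -/
def liftSeq (B β : ℂ) (α : ℕ → ℂ) (k : ℕ) : ℂ :=
  ∑ l ∈ range (k + 1), poch (B + l) (k - l) * poch β (k - l) / ((k - l) ! : ℂ) * α l

/-- The quotient separates `k` from `l`, which makes a level of the nested sum a binomial
convolution. For `B = -N` it needs `k > N`; both sides are then `0` for `l ≤ N`. -/
lemma poch_sub_eventually_eq (B : ℂ) : ∀ᶠ k : ℕ in atTop, ∀ l ≤ k,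
    poch (B + l) (k - l) = Complex.Gamma (B + k) * (Complex.Gamma (B + l))⁻¹ := by
  have main : ∀ (k l : ℕ), l ≤ k → (∀ m : ℕ, B + l ≠ -(m : ℂ)) →
      poch (B + l) (k - l) = Complex.Gamma (B + k) * (Complex.Gamma (B + l))⁻¹ := by
    intro k l hl h
    have e : B + k = B + l + ((k - l : ℕ) : ℂ) := by push_cast [hl]; ring
    rw [e, Gamma_add_nat h]
    field_simp [Complex.Gamma_ne_zero h]
  by_cases hB : ∀ m : ℕ, B ≠ -(m : ℂ)
  · filter_upwards with k l hl
    refine main k l hl fun m hm => hB (m + l) ?_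
    push_cast
    linear_combination hm
  · push Not at hB
    obtain ⟨N, rfl⟩ := hB
    filter_upwards [eventually_gt_atTop N] with k hk l hl
    rcases le_or_gt l N with h | h
    · have e : -(N : ℂ) + l = -((N - l : ℕ) : ℂ) := by push_cast [h]; ring
      rw [e, poch_neg_eq_zero (by omega), Complex.Gamma_neg_nat_eq_zero]
      simp
    · refine main k l hl fun m hm => ?_
      have h1 : ((l + m : ℕ) : ℂ) = (N : ℕ) := by push_cast; linear_combination hm
      have h2 : l + m = N := by exact_mod_cast h1
      omega

lemma liftSeq_eventually_eq (B β : ℂ) (α : ℕ → ℂ) : ∀ᶠ k : ℕ in atTop,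
    liftSeq B β α k
      = Complex.Gamma (B + k) * binomConv β (fun l => α l * (Complex.Gamma (B + l))⁻¹) k := by
  filter_upwards [poch_sub_eventually_eq B] with k hk
  unfold liftSeq binomConv
  rw [mul_sum]
  refine sum_congr rfl fun l hl => ?_
  rw [hk l (Nat.lt_succ_iff.1 (mem_range.1 hl))]
  ring

lemma isSymbol_mul_inv_Gamma {r : ℝ} {α : ℕ → ℂ} (hα : IsSymbol r fun l => α l / (l ! : ℂ))
    (B : ℂ) : IsSymbol (r + 1 - B.re) (fun l => α l * (Complex.Gamma (B + l))⁻¹) := by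
  have h := hα.mul (isSymbol_Gamma_div 1 B)
  rw [show r + (1 - B).re = r + 1 - B.re by simp; ring] at h
  refine h.congr (Eventually.of_forall fun l => ?_)
  have := factorial_cast_ne_zero l
  simp only [Gamma_nat_eq]
  field_simp

/-- Division by `Γ(σ - a + l)`, convolution with `β = b - a`, multiplication by `Γ(σ - a + k)`: the
orders add up so that the margin `δ` is the same before and after. The condition `δ < Re a` is the
`κ > 0` of `IsSymbol.binomConv`. -/
lemma isSymbol_liftSeq {a b σ : ℂ} {δ : ℝ} {α : ℕ → ℂ}
    (hα : IsSymbol (σ.re - δ - 2) fun l => α l / (l ! : ℂ)) (hδ : δ < a.re) :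
    IsSymbol ((σ - a + b).re - δ - 2) fun k => liftSeq (σ - a) (b - a) α k / (k ! : ℂ) := by
  have h1 := isSymbol_mul_inv_Gamma hα (σ - a)
  rw [show σ.re - δ - 2 + 1 - (σ - a).re = (a.re - δ) - 1 by simp; ring] at h1
  have h2 := (h1.binomConv (b - a) (sub_pos.2 hδ)).mul (isSymbol_Gamma_div (σ - a) 1)
  rw [show a.re - δ + (b - a).re - 1 + (σ - a - 1).re = (σ - a + b).re - δ - 2 by
    simp; ring] at h2
  refine h2.congr ?_
  filter_upwards [liftSeq_eventually_eq (σ - a) (b - a) α] with k hk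
  rw [hk, Gamma_nat_eq]
  ring

lemma norm_mul_inv_Gamma_le {r : ℝ} {α : ℕ → ℂ} (hα : IsSymbol r fun l => α l / (l ! : ℂ))
    (σ : ℂ) : ∃ C, 0 < C ∧ ∀ l, ‖α l * (Complex.Gamma (σ + l))⁻¹‖ ≤ C * wt (r + 1 - σ.re) l :=
  isBigO_wt_iff.1 (isSymbol_mul_inv_Gamma hα σ).isBigO

lemma summable_mul_inv_Gamma {σ : ℂ} {δ : ℝ} (hδ : 0 < δ) {α : ℕ → ℂ}
    (hα : IsSymbol (σ.re - δ - 2) fun l => α l / (l ! : ℂ)) :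
    Summable fun l => α l * (Complex.Gamma (σ + l))⁻¹ := by
  obtain ⟨C, _, h⟩ := norm_mul_inv_Gamma_le hα σ
  refine Summable.of_norm_bounded ((summable_wt ?_).mul_left C) h
  linarith

lemma liftSeq_zero (B β : ℂ) (α : ℕ → ℂ) : liftSeq B β α 0 = α 0 := by
  simp [liftSeq, poch_zero]

/-- The analogue of `binomConv_succ_sub` with the factor `(B + l)_{k-l}`; it permits the descent
from `β + 1` to `β` in `tsum_liftSeq`. -/
lemma liftSeq_succ (B β : ℂ) (α : ℕ → ℂ) (k : ℕ) :
    liftSeq B β α (k + 1) = liftSeq B (β + 1) α (k + 1) - (B + k) * liftSeq B (β + 1) α k := by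
  unfold liftSeq
  rw [sum_range_succ, sum_range_succ _ (k + 1), add_sub_right_comm, mul_sum, ← sum_sub_distrib]
  congr 1
  · refine sum_congr rfl fun l hl => ?_
    obtain ⟨m, rfl⟩ := Nat.exists_eq_add_of_le' (Nat.lt_succ_iff.1 (mem_range.1 hl))
    have e1 : m + l + 1 - l = m + 1 := by omega
    have h := poch_div_factorial_sub (β + 1) m
    rw [add_sub_cancel_right] at h
    rw [e1, Nat.add_sub_cancel, poch_succ (B + l) m, mul_div_assoc, ← h]
    push_cast
    ring
  · simp [poch_zero]

/-- One level of the nested sum multiplies the factorial series by `Γ(a) / Γ(b)`. -/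
theorem tsum_liftSeq {a σ : ℂ} {δ : ℝ} {α : ℕ → ℂ} (hδ : 0 < δ)
    (hα : IsSymbol (σ.re - δ - 2) fun l => α l / (l ! : ℂ)) (ha : δ < a.re) (b : ℂ) :
    ∑' k, liftSeq (σ - a) (b - a) α k * (Complex.Gamma (σ - a + b + k))⁻¹
      = Complex.Gamma a * (Complex.Gamma b)⁻¹ * ∑' l, α l * (Complex.Gamma (σ + l))⁻¹ := by
  -- Absolute convergence of the double series is available for `Re (b - a) ≥ 1`; the other `b` are
  -- reached by induction from `b + 1` to `b`.
  obtain ⟨N, hN⟩ := exists_nat_gt (1 + a.re - b.re)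
  replace hN : 1 ≤ (b - a).re + N := by simp; linarith
  induction N generalizing b with
  | zero =>
    simp only [Nat.cast_zero, add_zero] at hN
    let B := σ - a
    -- A row of `F` is a Gauss series at `1`, with excess `a`; an antidiagonal is a term of the
    -- lifted series.
    let F : ℕ × ℕ → ℂ := fun q => α q.1 * gaussTerm (B + q.1) (b - a) (B + q.1 + (b - a) + a) q.2
    have hanti : ∀ k, ∀ g : ℂ → ℝ, ∑ q ∈ antidiagonal k, g (F q) = ∑ l ∈ range (k + 1),
        g (poch (B + l) (k - l) * poch (b - a) (k - l) / ((k - l) ! : ℂ) * α l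
          * (Complex.Gamma (B + b + k))⁻¹) := by
      intro k g
      rw [Finset.Nat.sum_antidiagonal_eq_sum_range_succ (fun i j => g (F (i, j)))]
      refine sum_congr rfl fun l hl => ?_
      have hl' : l ≤ k := Nat.lt_succ_iff.1 (mem_range.1 hl)
      simp only [F, gaussTerm]
      rw [show B + l + (b - a) + a + ((k - l : ℕ) : ℂ) = B + b + k by push_cast [hl']; ring]
      congr 1
      ring
    have hanti' : ∀ k, ∑ q ∈ antidiagonal k, F q
        = liftSeq B (b - a) α k * (Complex.Gamma (B + b + k))⁻¹ := by
      intro k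
      rw [Finset.Nat.sum_antidiagonal_eq_sum_range_succ (fun i j => F (i, j))]
      unfold liftSeq
      rw [sum_mul]
      refine sum_congr rfl fun l hl => ?_
      have hl' : l ≤ k := Nat.lt_succ_iff.1 (mem_range.1 hl)
      simp only [F, gaussTerm]
      rw [show B + l + (b - a) + a + ((k - l : ℕ) : ℂ) = B + b + k by push_cast [hl']; ring]
      ring
    have h1 := isSymbol_mul_inv_Gamma hα B
    rw [show σ.re - δ - 2 + 1 - B.re = (a.re - δ) - 1 by simp [B]; ring] at h1
    obtain ⟨C, hC, hs⟩ := sum_norm_binomConv_le hN (sub_pos.2 ha) h1.isBigO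
    obtain ⟨D, hD, hG⟩ := isBigO_wt_iff.1 (isSymbol_Gamma_div B (B + b)).isBigO
    have hF : Summable F := by
      refine summable_of_antidiagonal_le
        ((summable_wt (r := -1 - δ) (by linarith)).mul_left (D * C)) ?_
      filter_upwards [poch_sub_eventually_eq B] with k hk
      rw [hanti k norm]
      calc _ = ‖Complex.Gamma (B + k) / Complex.Gamma (B + b + k)‖ *
            ∑ l ∈ range (k + 1), ‖poch (b - a) (k - l) / ((k - l) ! : ℂ)‖
              * ‖α l * (Complex.Gamma (B + l))⁻¹‖ := by
            rw [mul_sum]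
            refine sum_congr rfl fun l hl => ?_
            rw [hk l (Nat.lt_succ_iff.1 (mem_range.1 hl))]
            simp only [norm_mul, norm_div, norm_inv]
            ring
        _ ≤ D * wt (B - (B + b)).re k * (C * wt (a.re - δ + (b - a).re - 1) k) :=
            mul_le_mul (hG k) (hs k) (sum_nonneg fun _ _ => by positivity)
              (mul_pos hD (wt_pos _ _)).le
        _ = _ := by
            rw [show (-1 - δ : ℝ) = (B - (B + b)).re + (a.re - δ + (b - a).re - 1) by
              simp; ring, wt_add]
            ring
    have hrow : ∀ l, ∑' m, F (l, m)
        = Complex.Gamma a * (Complex.Gamma b)⁻¹ * (α l * (Complex.Gamma (σ + l))⁻¹) := by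
      intro l
      have h := (hasSum_gaussTerm (α := B + l) (β := b - a) (hδ.trans ha)).mul_left (α l)
      rw [show a + (B + l) = σ + l by simp [B]; ring, show a + (b - a) = b by ring] at h
      rw [h.tsum_eq]
      ring
    have t1 := (hasSum_antidiagonal hF.hasSum).tsum_eq
    rw [hF.tsum_prod] at t1
    simp only [hanti', hrow] at t1
    rw [tsum_mul_left] at t1
    exact t1
  | succ N ih =>
    have h := ih (b + 1) (by push_cast at hN; simp at hN ⊢; linarith)
    let B := σ - a
    have hB : σ - a = B := rfl
    have hsym := isSymbol_liftSeq (b := b) hα ha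
    have hsym' := isSymbol_liftSeq (b := b + 1) hα ha
    rw [show b + 1 - a = b - a + 1 by ring] at hsym' h
    rw [hB] at hsym hsym' h ⊢
    have s := (summable_mul_inv_Gamma hδ hsym).hasSum.tendsto_sum_nat
    have s' := (summable_mul_inv_Gamma hδ hsym').hasSum.tendsto_sum_nat
    -- Summation by parts through `liftSeq_succ`; the boundary term is `O(K ^ (-δ))`.
    have tel : ∀ K : ℕ, ∑ k ∈ range (K + 1),
          liftSeq B (b - a) α k * (Complex.Gamma (B + b + k))⁻¹
        = b * ∑ k ∈ range (K + 1),
            liftSeq B (b - a + 1) α k * (Complex.Gamma (B + (b + 1) + k))⁻¹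
          + (B + K) * (liftSeq B (b - a + 1) α K * (Complex.Gamma (B + (b + 1) + K))⁻¹) := by
      intro K
      induction K with
      | zero =>
        simp only [zero_add, sum_range_one, liftSeq_zero, Nat.cast_zero, add_zero]
        have := inv_Gamma_eq (B + b) 0
        simp only [Nat.cast_zero, add_zero] at this
        rw [this, add_assoc B b 1]
        ring
      | succ K ihK =>
        rw [sum_range_succ, ihK, sum_range_succ _ (K + 1), liftSeq_succ]
        have e1 := inv_Gamma_eq (B + b) (K + 1)
        rw [e1, show B + b + 1 + ((K + 1 : ℕ) : ℂ) = B + (b + 1) + ((K + 1 : ℕ) : ℂ) by ring]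
        have e2 := inv_Gamma_eq (B + (b + 1)) K
        rw [e2, show B + (b + 1) + 1 + (K : ℂ) = B + (b + 1) + ((K + 1 : ℕ) : ℂ) by
          push_cast; ring]
        push_cast
        ring
    obtain ⟨C, hC, hb⟩ := norm_mul_inv_Gamma_le hsym' (B + (b + 1))
    obtain ⟨D, hD, hBk⟩ : ∃ D : ℝ, 0 < D ∧ ∀ K : ℕ, ‖B + K‖ ≤ D * wt 1 K := by
      refine ⟨‖B‖ + 1, by positivity, fun K => (norm_add_le _ _).trans ?_⟩
      simp only [wt, Real.rpow_one, Complex.norm_natCast]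
      nlinarith [norm_nonneg B, K.cast_nonneg (α := ℝ),
        mul_nonneg (norm_nonneg B) (K.cast_nonneg (α := ℝ))]
    have hz : Tendsto (fun K : ℕ => (B + K) * (liftSeq B (b - a + 1) α K
        * (Complex.Gamma (B + (b + 1) + K))⁻¹)) atTop (𝓝 0) := by
      have h0 := (tendsto_wt_zero (r := -δ) (by linarith)).const_mul (D * C)
      rw [mul_zero] at h0
      refine squeeze_zero_norm (fun K => ?_) h0
      rw [norm_mul]
      refine (mul_le_mul (hBk K) (hb K) (norm_nonneg _)
        (mul_pos hD (wt_pos _ _)).le).trans_eq ?_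
      rw [show -δ = 1 + ((B + (b + 1)).re - δ - 2 + 1 - (B + (b + 1)).re) by ring, wt_add]
      ring
    have lim := ((s'.comp (tendsto_add_atTop_nat 1)).const_mul b).add hz
    have lim2 := s.comp (tendsto_add_atTop_nat 1)
    have := tendsto_nhds_unique (lim2.congr fun K => tel K) lim
    rw [this, h, add_zero]
    have e := Complex.one_div_Gamma_eq_self_mul_one_div_Gamma_add_one b
    rw [e]
    ring

/-! ### The coefficients -/

/-- The innermost level is the lift of the unit sequence at `0`, so all levels are treated alike. -/
lemma nestedSum_zero_eq (p : ℕ) (a b : ℕ → ℂ) (i : ℕ) :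
    nestedSum p a b 0 i
      = liftSeq (tailDiff p a b i) (b i - a (i + 2)) (fun l => if l = 0 then 1 else 0) := by
  funext k
  simp [liftSeq, nestedSum]

lemma nestedSum_succ_eq (p : ℕ) (a b : ℕ → ℂ) (d i : ℕ) :
    nestedSum p a b (d + 1) i
      = liftSeq (tailDiff p a b i) (b i - a (i + 2)) (nestedSum p a b d (i + 1)) := rfl

lemma tailDiff_eq {p i : ℕ} (a b : ℕ → ℂ) (hi : i + 1 ≤ p) :
    tailDiff p a b i = tailDiff p a b (i + 1) + b (i + 1) - a (i + 2) := by
  unfold tailDiff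
  have e1 : Icc (i + 1) p = insert (i + 1) (Icc (i + 1 + 1) p) := by
    ext x; simp; omega
  have e2 : Icc (i + 2) (p + 1) = insert (i + 2) (Icc (i + 1 + 2) (p + 1)) := by
    ext x; simp; omega
  rw [e1, e2, sum_insert (by simp), sum_insert (by simp)]
  ring

lemma isSymbol_single (r : ℝ) :
    IsSymbol r (fun l : ℕ => (if l = 0 then (1 : ℂ) else 0) / (l ! : ℂ)) := by
  have h0 : IsSymbol r (fun _ => (0 : ℂ)) := by
    intro j
    have : (fwdDiff 1)^[j] (fun _ : ℕ => (0 : ℂ)) = fun _ => 0 := by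
      induction j with
      | zero => rfl
      | succ j ih => rw [Function.iterate_succ_apply', ih, fwdDiff_const]
    rw [this]
    exact isBigO_zero _ _
  refine h0.congr ?_
  filter_upwards [eventually_gt_atTop 0] with n hn
  simp [hn.ne']

/-- Induction from the innermost level outwards, with `σ = tailDiff p a b (i + 1) + b (i + 1)` in
`tsum_liftSeq`. Each level contributes `Γ(a_{i+2}) / Γ(b_i)`, and its symbol order gives the
convergence needed at the next. The order is also used with negative `δ`; only the summation needs
`δ > 0`. -/
theorem nestedSum_spec {p : ℕ} {a b : ℕ → ℂ} {δ : ℝ} (d i : ℕ) (hi : i + d + 1 = p)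
    (hδ : ∀ j ∈ Icc (i + 2) (p + 1), δ < (a j).re) :
    IsSymbol ((tailDiff p a b i + b i).re - δ - 2) (fun k => nestedSum p a b d i k / (k ! : ℂ)) ∧
    (0 < δ → ∑' k, nestedSum p a b d i k * (Complex.Gamma (tailDiff p a b i + b i + k))⁻¹
      = (∏ j ∈ Icc (i + 2) (p + 1), Complex.Gamma (a j))
          * ∏ j ∈ Icc i p, (Complex.Gamma (b j))⁻¹) := by
  have hT := tailDiff_eq a b (show i + 1 ≤ p by omega)
  have ha := hδ (i + 2) (by simp; omega)
  have e1 : Icc i p = insert i (Icc (i + 1) p) := by ext x; simp; omega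
  have e2 : Icc (i + 2) (p + 1) = insert (i + 2) (Icc (i + 1 + 2) (p + 1)) := by
    ext x; simp; omega
  have fin : ∀ S T : ℂ, Complex.Gamma (a (i + 2)) * (Complex.Gamma (b i))⁻¹ * (S * T)
      = Complex.Gamma (a (i + 2)) * S * ((Complex.Gamma (b i))⁻¹ * T) := fun S T => by ring
  rw [e1, e2, prod_insert (by simp), prod_insert (by simp)]
  rw [hT]
  induction d generalizing i with
  | zero =>
    have hs := isSymbol_single ((tailDiff p a b (i + 1) + b (i + 1)).re - δ - 2)
    rw [nestedSum_zero_eq, hT]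
    refine ⟨isSymbol_liftSeq hs ha, fun h0 => ?_⟩
    rw [tsum_liftSeq h0 hs ha, ← fin]
    congr 1
    -- Inside the last level `tailDiff p a b p = 0`, and the factorial series is the single term `1
    -- / Γ(b_p)`.
    have : i + 1 = p := by omega
    subst this
    simp [tailDiff]
  | succ d ih =>
    have h := ih (i + 1) (by omega) (fun j hj => hδ j (by simp at hj ⊢; omega))
      (tailDiff_eq a b (by omega)) (hδ _ (by simp; omega)) (by ext x; simp; omega)
      (by ext x; simp; omega) (fun S T => by ring)
    rw [← tailDiff_eq a b (by omega)] at h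
    rw [nestedSum_succ_eq, hT]
    refine ⟨isSymbol_liftSeq h.1 ha, fun h0 => ?_⟩
    rw [tsum_liftSeq h0 h.1 ha, h.2 h0, ← fin]
    congr 1
    have e1 : Icc (i + 1) p = insert (i + 1) (Icc (i + 1 + 1) p) := by ext x; simp; omega
    have e2 : Icc (i + 1 + 2) (p + 1) = insert (i + 1 + 2) (Icc (i + 1 + 1 + 2) (p + 1)) := by
      ext x; simp; omega
    rw [e1, e2, prod_insert (by simp), prod_insert (by simp)]

/-- `B_i` contains as many `b_j` as `a_j`, so a common shift cancels. Hence the same `A_k` serve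
every Taylor coefficient of `Φ`, and also `Φ'`. -/
lemma tailDiff_shift (p : ℕ) (a b : ℕ → ℂ) (x : ℂ) (i : ℕ) :
    tailDiff p (fun j => a j + x) (fun j => b j + x) i = tailDiff p a b i := by
  have h : p + 1 + 1 - (i + 2) = p + 1 - (i + 1) := by omega
  simp only [tailDiff, sum_add_distrib, sum_const, Nat.card_Icc, h]
  ring

lemma nestedSum_shift (p : ℕ) (a b : ℕ → ℂ) (x : ℂ) (d i k : ℕ) :
    nestedSum p (fun j => a j + x) (fun j => b j + x) d i k = nestedSum p a b d i k := by
  induction d generalizing i k with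
  | zero => simp only [nestedSum, tailDiff_shift, add_sub_add_right_eq_sub]
  | succ d ih => simp only [nestedSum, tailDiff_shift, add_sub_add_right_eq_sub, ih]

lemma coeffA_shift (p : ℕ) (a b : ℕ → ℂ) (x : ℂ) (k : ℕ) :
    coeffA p (fun j => a j + x) (fun j => b j + x) k = coeffA p a b k :=
  nestedSum_shift p a b x _ _ k

lemma prod_Icc_eq_mul {M : Type*} [CommMonoid M] (f : ℕ → M) {p : ℕ} (hp : 2 ≤ p) :
    ∏ j ∈ Icc 1 (p + 1), f j = f 1 * f 2 * ∏ j ∈ Icc 3 (p + 1), f j := by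
  have e : Icc 1 (p + 1) = insert 1 (insert 2 (Icc 3 (p + 1))) := by ext x; simp; omega
  rw [e, prod_insert (by simp), prod_insert (by simp), mul_assoc]

lemma sum_Icc_eq_add {M : Type*} [AddCommMonoid M] (f : ℕ → M) {p : ℕ} (hp : 2 ≤ p) :
    ∑ j ∈ Icc 1 (p + 1), f j = f 1 + f 2 + ∑ j ∈ Icc 3 (p + 1), f j := by
  have e : Icc 1 (p + 1) = insert 1 (insert 2 (Icc 3 (p + 1))) := by ext x; simp; omega
  rw [e, sum_insert (by simp), sum_insert (by simp), add_assoc]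

lemma tailDiff_one_add {p : ℕ} (hp : 2 ≤ p) (a b : ℕ → ℂ) :
    tailDiff p a b 1 + b 1 = excess p a b + a 1 + a 2 := by
  have e : Icc 1 p = insert 1 (Icc 2 p) := by ext x; simp; omega
  rw [tailDiff, excess, sum_Icc_eq_add a hp, e, sum_insert (by simp)]
  ring

lemma exists_between_re {x : ℝ} {p : ℕ} {a : ℕ → ℂ} (h : ∀ j ∈ Icc 3 (p + 1), x < (a j).re) :
    ∃ δ, x < δ ∧ ∀ j ∈ Icc 3 (p + 1), δ < (a j).re := by
  have h1 : ∀ᶠ δ in 𝓝[>] x, ∀ j ∈ Icc 3 (p + 1), δ < (a j).re :=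
    (eventually_all_finset _).2 fun j hj =>
      (eventually_lt_nhds (h j hj)).filter_mono nhdsWithin_le_nhds
  obtain ⟨δ, h2, h3⟩ := (eventually_mem_nhdsWithin.and h1).exists
  exact ⟨δ, h2, h3⟩

lemma isSymbol_coeffA {p : ℕ} (hp : 2 ≤ p) {a b : ℕ → ℂ} {δ : ℝ}
    (h : ∀ j ∈ Icc 3 (p + 1), δ < (a j).re) :
    IsSymbol ((excess p a b + a 1 + a 2).re - δ - 2) fun k => coeffA p a b k / (k ! : ℂ) := by
  have := (nestedSum_spec (p := p) (a := a) (b := b) (p - 2) 1 (by omega) h).1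
  rwa [tailDiff_one_add hp] at this

/-- The key identity: `nestedSum_spec` at the outermost level, for all parameters shifted by `n`. -/
lemma tsum_coeffA {p : ℕ} (hp : 2 ≤ p) {a b : ℕ → ℂ} (n : ℕ)
    (h : ∀ j ∈ Icc 3 (p + 1), 0 < (a j + n).re) :
    ∑' k, coeffA p a b k * (Complex.Gamma (excess p a b + a 1 + a 2 + k + n))⁻¹
      = (∏ j ∈ Icc 3 (p + 1), Complex.Gamma (a j + n))
          * ∏ j ∈ Icc 1 p, (Complex.Gamma (b j + n))⁻¹ := by
  obtain ⟨δ, h0, hδ⟩ := exists_between_re (a := fun j => a j + n) h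
  have := (nestedSum_spec (p := p) (a := fun j => a j + n) (b := fun j => b j + n)
    (p - 2) 1 (by omega) hδ).2 h0
  simp only [nestedSum_shift, tailDiff_shift, ← add_assoc] at this
  rw [tailDiff_one_add hp] at this
  rw [← this]
  refine tsum_congr fun k => ?_
  rw [add_right_comm (excess p a b + a 1 + a 2)]
  rfl

lemma gammaFactor_mul_hypTerm {p : ℕ} {a b : ℕ → ℂ}
    (ha : ∀ j ∈ Icc 1 (p + 1), ∀ m : ℕ, a j ≠ -(m : ℂ))
    (hb : ∀ j ∈ Icc 1 p, ∀ m : ℕ, b j ≠ -(m : ℂ)) (z : ℂ) (n : ℕ) :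
    gammaFactor p a b * hypTerm p a b z n
      = (∏ j ∈ Icc 1 (p + 1), Complex.Gamma (a j + n))
        * (∏ j ∈ Icc 1 p, (Complex.Gamma (b j + n))⁻¹) / (n ! : ℂ) * z ^ n := by
  rw [prod_congr rfl fun j hj => Gamma_add_nat (ha j hj) n,
    prod_congr rfl fun j hj => congrArg Inv.inv (Gamma_add_nat (hb j hj) n)]
  unfold gammaFactor hypTerm
  simp only [mul_inv, prod_mul_distrib, prod_inv_distrib]
  field_simp

/-! ### The expansion in Gauss series and the value at `1`. -/

lemma gaussReg_eq_tsum (α β c z : ℂ) : gaussReg α β c z = ∑' n, gaussTerm α β c n * z ^ n := by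
  refine tsum_congr fun n => ?_
  unfold gaussTerm
  ring

lemma summable_wt_mul_pow (r : ℝ) {x : ℝ} (h0 : 0 ≤ x) (h1 : x < 1) :
    Summable fun n => wt r n * x ^ n := by
  rcases h0.eq_or_lt with rfl | h0
  · refine summable_of_ne_finset_zero (s := {0}) fun n hn => ?_
    simp at hn
    simp [hn]
  · refine summable_of_ratio_test_tendsto_lt_one (l := x) h1
      (Eventually.of_forall fun n => (mul_pos (wt_pos r n) (pow_pos h0 n)).ne') ?_
    have h := (tendsto_add_atTop_iff_nat 1).2 (tendsto_add_one_rpow_div (-r))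
    have h2 := h.mul_const x
    rw [one_mul] at h2
    refine h2.congr fun n => ?_
    have w1 := wt_pos r n
    have w2 := wt_pos r (n + 1)
    rw [Real.norm_of_nonneg (by positivity), Real.norm_of_nonneg (by positivity)]
    have h3 : (0 : ℝ) < (n : ℝ) + 1 := by positivity
    have h4 : (0 : ℝ) < (n : ℝ) + 1 + 1 := by positivity
    simp only [wt, Nat.cast_add, Nat.cast_one]
    rw [Real.rpow_neg h3.le, Real.rpow_neg h4.le]
    field_simp
    rw [pow_succ]
    ring

lemma summable_prod_of_eventually_le {f : ℕ × ℕ → ℂ} {g h : ℕ → ℝ} (hg : Summable g)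
    (hh : Summable h) (h1 : ∀ k, Summable fun n => f (k, n))
    (hb : ∀ᶠ k in atTop, ∀ n, ‖f (k, n)‖ ≤ h k * g n) : Summable f := by
  refine Summable.of_norm ?_
  refine (summable_prod_of_nonneg fun _ => norm_nonneg _).2 ⟨fun k => (h1 k).norm, ?_⟩
  refine Summable.of_norm_bounded_eventually_nat (hh.mul_right (∑' n, g n)) ?_
  filter_upwards [hb] with k hk
  rw [Real.norm_of_nonneg (tsum_nonneg fun _ => norm_nonneg _), ← tsum_mul_left]
  exact (h1 k).norm.tsum_le_tsum hk (hg.mul_left _)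

/-- The terms of the double series behind the expansion in Gauss series. -/
def doubleTerm (p : ℕ) (a b : ℕ → ℂ) (z : ℂ) (q : ℕ × ℕ) : ℂ :=
  coeffA p a b q.1 * (Complex.Gamma (a 1) * Complex.Gamma (a 2)
    * (gaussTerm (a 1) (a 2) (excess p a b + a 1 + a 2 + q.1) q.2 * z ^ q.2))

/-- The decay `k ^ (-1 - δ)` combines the order of `A_k / k!` with the size of `1 / Γ(s + a_1 + a_2
+ k)`. The inverse binomial coefficient is kept because at `z = 1` it supplies the decay in `n`. -/
lemma norm_doubleTerm_le {p : ℕ} (hp : 2 ≤ p) {a b : ℕ → ℂ} {δ : ℝ}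
    (h : ∀ j ∈ Icc 3 (p + 1), δ < (a j).re) : ∃ C, 0 < C ∧ ∀ z k n,
    ‖doubleTerm p a b z (k, n)‖ ≤ C * (wt (-1 - δ) k
      * (wt ((a 1).re + (a 2).re - 2 + |1 - (excess p a b + a 1 + a 2).re|) n * ‖z‖ ^ n)
      * ((k ! : ℝ) * n ! / (k + n)!)) := by
  set σ := excess p a b + a 1 + a 2 with hσ
  obtain ⟨C1, hC1, b1⟩ := isBigO_wt_iff.1 (isSymbol_coeffA hp (b := b) h).isBigO
  obtain ⟨C2, hC2, b2⟩ := norm_poch_le (a 1)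
  obtain ⟨C3, hC3, b3⟩ := norm_poch_le (a 2)
  obtain ⟨C4, hC4, b4⟩ := norm_inv_Gamma_add_nat_le σ
  refine ⟨C1 * C2 * C3 * C4 * (‖Complex.Gamma (a 1)‖ * ‖Complex.Gamma (a 2)‖ + 1),
    by positivity, fun z k n => ?_⟩
  have b1' : ‖coeffA p a b k‖ ≤ C1 * wt (σ.re - δ - 2) k * k ! := by
    have := b1 k
    rwa [norm_div, Complex.norm_natCast, div_le_iff₀ (by positivity)] at this
  have b4' := b4 (n + k)
  rw [show σ + ((n + k : ℕ) : ℂ) = σ + k + n by push_cast; ring] at b4'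
  have w1 := wt_pos (σ.re - δ - 2) k
  have w2 := wt_pos ((a 1).re - 1) n
  have w3 := wt_pos ((a 2).re - 1) n
  have w4 := wt_pos (1 - σ.re) (n + k)
  have w5 := wt_pos (|1 - σ.re|) n
  have w6 := wt_pos (1 - σ.re) k
  simp only [doubleTerm, gaussTerm, ← hσ]
  simp only [norm_mul, norm_div, Complex.norm_natCast, norm_pow]
  calc _ ≤ (C1 * wt (σ.re - δ - 2) k * k !)
        * ((‖Complex.Gamma (a 1)‖ * ‖Complex.Gamma (a 2)‖ + 1)
        * ((C2 * (wt ((a 1).re - 1) n * n !)) * (C3 * (wt ((a 2).re - 1) n * n !)) / n !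
          * (C4 * (wt (1 - σ.re) (n + k) / (n + k)!)) * ‖z‖ ^ n)) := by
        gcongr
        · linarith
        · exact b2 n
        · exact b3 n
        · exact b4'
    _ ≤ (C1 * wt (σ.re - δ - 2) k * k !)
        * ((‖Complex.Gamma (a 1)‖ * ‖Complex.Gamma (a 2)‖ + 1)
        * ((C2 * (wt ((a 1).re - 1) n * n !)) * (C3 * (wt ((a 2).re - 1) n * n !)) / n !
          * (C4 * ((wt |1 - σ.re| n * wt (1 - σ.re) k) / (n + k)!)) * ‖z‖ ^ n)) := by
        gcongr
        exact wt_add_le _ n k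
    _ = _ := by
        rw [show (-1 - δ : ℝ) = (σ.re - δ - 2) + (1 - σ.re) by ring, wt_add,
          show (a 1).re + (a 2).re - 2 + |1 - σ.re| = ((a 1).re - 1) + ((a 2).re - 1) + |1 - σ.re|
            by ring, wt_add, wt_add, add_comm n k]
        field_simp

lemma norm_gaussTerm_mul_pow_summable (α β c : ℂ) {z : ℂ} (hz : ‖z‖ < 1) :
    Summable fun n => gaussTerm α β c n * z ^ n := by
  obtain ⟨C, _, h⟩ := norm_gaussTerm_le α β c
  refine Summable.of_norm_bounded ((summable_wt_mul_pow ((α + β - c).re - 1)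
    (norm_nonneg z) hz).mul_left C) fun n => ?_
  rw [norm_mul, norm_pow, ← mul_assoc]
  exact mul_le_mul_of_nonneg_right (h n) (by positivity)

lemma summable_doubleTerm {p : ℕ} (hp : 2 ≤ p) {a b : ℕ → ℂ}
    (h : ∀ j ∈ Icc 3 (p + 1), 0 < (a j).re) {z : ℂ} (hz : ‖z‖ < 1) :
    Summable (doubleTerm p a b z) := by
  obtain ⟨δ, h0, hδ⟩ := exists_between_re h
  obtain ⟨C, hC, hb⟩ := norm_doubleTerm_le hp (b := b) hδ
  refine summable_prod_of_eventually_le (summable_wt_mul_pow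
      ((a 1).re + (a 2).re - 2 + |1 - (excess p a b + a 1 + a 2).re|) (norm_nonneg z) hz)
    ((summable_wt (r := -1 - δ) (by linarith)).mul_left C) (fun k => ?_)
    (Eventually.of_forall fun k n => (hb z k n).trans ?_)
  · simp only [doubleTerm]
    exact ((norm_gaussTerm_mul_pow_summable _ _ _ hz).mul_left _).mul_left _
  · rw [mul_assoc C]
    refine mul_le_mul_of_nonneg_left ?_ hC.le
    refine mul_le_of_le_one_right ?_ ?_
    · have := wt_pos (-1 - δ) k
      have := wt_pos ((a 1).re + (a 2).re - 2 + |1 - (excess p a b + a 1 + a 2).re|) n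
      positivity
    · have := factorial_mul_div_le (Nat.zero_le k) n
      simpa [wt] using this

/-- For `k ≥ K` the inverse binomial coefficient beats the polynomial growth in `n`; the finitely
many rows with `k < K` converge since `Re s > 0`. -/
lemma summable_doubleTerm_one {p : ℕ} (hp : 2 ≤ p) {a b : ℕ → ℂ}
    (h : ∀ j ∈ Icc 3 (p + 1), 0 < (a j).re) (hs : 0 < (excess p a b).re) :
    Summable (doubleTerm p a b 1) := by
  obtain ⟨δ, h0, hδ⟩ := exists_between_re h
  obtain ⟨C, hC, hb⟩ := norm_doubleTerm_le hp (b := b) hδ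
  set M := (a 1).re + (a 2).re - 2 + |1 - (excess p a b + a 1 + a 2).re|
  obtain ⟨K, hK⟩ := exists_nat_gt (M + 1)
  refine summable_prod_of_eventually_le
    ((summable_wt (r := M + -K) (by linarith)).mul_left (K ! : ℝ))
    ((summable_wt (r := -1 - δ) (by linarith)).mul_left C) (fun k => ?_) ?_
  · simp only [doubleTerm, one_pow, mul_one]
    refine ((summable_gaussTerm ?_).mul_left _).mul_left _
    rw [show excess p a b + a 1 + a 2 + k - a 1 - a 2 = excess p a b + k by ring]
    simp
    positivity
  · filter_upwards [eventually_ge_atTop K] with k hk n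
    refine (hb 1 k n).trans ?_
    rw [mul_assoc C]
    refine mul_le_mul_of_nonneg_left ?_ hC.le
    have w1 := wt_pos (-1 - δ) k
    have w2 := wt_pos M n
    rw [norm_one, one_pow, mul_one, wt_add M, mul_assoc (wt (-1 - δ) k)]
    refine mul_le_mul_of_nonneg_left ?_ w1.le
    calc _ ≤ wt M n * (K ! * wt (-K) n) :=
          mul_le_mul_of_nonneg_left (factorial_mul_div_le hk n) w2.le
      _ = _ := by ring

lemma tsum_doubleTerm_snd {p : ℕ} (hp : 2 ≤ p) {a b : ℕ → ℂ}
    (ha : ∀ j ∈ Icc 1 (p + 1), ∀ m : ℕ, a j ≠ -(m : ℂ))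
    (hb : ∀ j ∈ Icc 1 p, ∀ m : ℕ, b j ≠ -(m : ℂ))
    (h : ∀ j ∈ Icc 3 (p + 1), 0 < (a j).re) (z : ℂ) (n : ℕ) :
    ∑' k, doubleTerm p a b z (k, n) = gammaFactor p a b * hypTerm p a b z n := by
  have h1 := tsum_coeffA hp (b := b) n (fun j hj => by
    have := h j hj
    simp
    positivity)
  rw [gammaFactor_mul_hypTerm ha hb, prod_Icc_eq_mul _ hp,
    Gamma_add_nat (ha 1 (by simp)), Gamma_add_nat (ha 2 (by simp; omega))]
  have h2 : ∀ k, doubleTerm p a b z (k, n)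
      = Complex.Gamma (a 1) * Complex.Gamma (a 2) * (poch (a 1) n * poch (a 2) n / (n ! : ℂ)) * z ^ n
        * (coeffA p a b k * (Complex.Gamma (excess p a b + a 1 + a 2 + k + n))⁻¹) := by
    intro k
    simp only [doubleTerm, gaussTerm]
    ring
  simp only [h2]
  rw [tsum_mul_left, h1]
  ring

theorem hasSum_gauss_expansion {p : ℕ} (hp : 2 ≤ p) {a b : ℕ → ℂ}
    (ha : ∀ j ∈ Icc 1 (p + 1), ∀ m : ℕ, a j ≠ -(m : ℂ))
    (hb : ∀ j ∈ Icc 1 p, ∀ m : ℕ, b j ≠ -(m : ℂ))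
    (h : ∀ j ∈ Icc 3 (p + 1), 0 < (a j).re) {z : ℂ} (hz : ‖z‖ < 1) :
    HasSum (fun k : ℕ => coeffA p a b k * (Complex.Gamma (a 1) * Complex.Gamma (a 2) *
        gaussReg (a 1) (a 2) (excess p a b + a 1 + a 2 + k) z))
      (gammaFactor p a b * hypF p a b z) := by
  have hS := summable_doubleTerm hp (b := b) h hz
  have h1 := hS.hasSum.prod_fiberwise fun k => (hS.prod_factor k).hasSum
  rw [hS.tsum_prod, ← Summable.tsum_comm (f := fun k n => doubleTerm p a b z (k, n)) hS] at h1
  simp only [tsum_doubleTerm_snd hp ha hb h, tsum_mul_left] at h1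
  refine h1.congr_fun fun k => ?_
  simp only [doubleTerm, tsum_mul_left, gaussReg_eq_tsum]

/-- The double series at `z = 1` summed in both orders: over `k` first it gives `Φ(1)`, over `n`
first Gauss's theorem applies with excess `s + k`. -/
theorem gauss_summation {p : ℕ} (hp : 2 ≤ p) {a b : ℕ → ℂ}
    (ha : ∀ j ∈ Icc 1 (p + 1), ∀ m : ℕ, a j ≠ -(m : ℂ))
    (hb : ∀ j ∈ Icc 1 p, ∀ m : ℕ, b j ≠ -(m : ℂ)) (hs : 0 < (excess p a b).re)
    (h : ∀ j ∈ Icc 3 (p + 1), 0 < (a j).re)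
    (h1 : ∀ m : ℕ, a 1 + excess p a b ≠ -(m : ℂ))
    (h2 : ∀ m : ℕ, a 2 + excess p a b ≠ -(m : ℂ)) :
    Summable (hypTerm p a b 1) ∧
      Summable (fun k : ℕ => poch (excess p a b) k /
        (poch (a 1 + excess p a b) k * poch (a 2 + excess p a b) k) * coeffA p a b k) ∧
      gammaFactor p a b * hypF p a b 1 =
        Complex.Gamma (a 1) * Complex.Gamma (a 2) * Complex.Gamma (excess p a b) /
          (Complex.Gamma (a 1 + excess p a b) * Complex.Gamma (a 2 + excess p a b)) *
          ∑' k : ℕ, poch (excess p a b) k /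
            (poch (a 1 + excess p a b) k * poch (a 2 + excess p a b) k) * coeffA p a b k := by
  have hS := summable_doubleTerm_one hp (b := b) h hs
  set s := excess p a b with hsdef
  have hspole : ∀ m : ℕ, s ≠ -(m : ℂ) := by
    intro m hm
    rw [hm] at hs
    simp at hs
    linarith [m.cast_nonneg (α := ℝ)]
  have hG : gammaFactor p a b ≠ 0 :=
    div_ne_zero (prod_ne_zero_iff.2 fun j hj => Complex.Gamma_ne_zero (ha j hj))
      (prod_ne_zero_iff.2 fun j hj => Complex.Gamma_ne_zero (hb j hj))
  have hrow : ∀ k, ∑' n, doubleTerm p a b 1 (k, n)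
      = Complex.Gamma (a 1) * Complex.Gamma (a 2) * Complex.Gamma s /
          (Complex.Gamma (a 1 + s) * Complex.Gamma (a 2 + s)) *
          (poch s k / (poch (a 1 + s) k * poch (a 2 + s) k) * coeffA p a b k) := by
    intro k
    have hg := hasSum_gaussTerm (α := a 1) (β := a 2) (a := s + k) (by simp; positivity)
    have e : ∀ n, doubleTerm p a b 1 (k, n) = coeffA p a b k * (Complex.Gamma (a 1)
        * Complex.Gamma (a 2)) * gaussTerm (a 1) (a 2) (a 1 + a 2 + (s + k)) n := by
      intro n
      simp only [doubleTerm, one_pow, mul_one]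
      rw [show a 1 + a 2 + (s + k) = s + a 1 + a 2 + k by ring]
      ring
    simp only [e]
    rw [tsum_mul_left, hg.tsum_eq, show s + k + a 1 = a 1 + s + k by ring,
      show s + k + a 2 = a 2 + s + k by ring, Gamma_add_nat hspole, Gamma_add_nat h1,
      Gamma_add_nat h2]
    field_simp [Complex.Gamma_ne_zero h1, Complex.Gamma_ne_zero h2, poch_ne_zero h1 k,
      poch_ne_zero h2 k]
  have hc : Complex.Gamma (a 1) * Complex.Gamma (a 2) * Complex.Gamma s /
      (Complex.Gamma (a 1 + s) * Complex.Gamma (a 2 + s)) ≠ 0 := by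
    have := Complex.Gamma_ne_zero (ha 1 (by simp))
    have := Complex.Gamma_ne_zero (ha 2 (by simp; omega))
    have := Complex.Gamma_ne_zero hspole
    have := Complex.Gamma_ne_zero h1
    have := Complex.Gamma_ne_zero h2
    positivity
  refine ⟨?_, ?_, ?_⟩
  · have := hS.prod_symm.prod
    simp only [Prod.swap_prod_mk] at this
    simp only [tsum_doubleTerm_snd hp ha hb h] at this
    exact (summable_mul_left_iff hG).1 this
  · have := hS.prod
    simp only [hrow] at this
    exact (summable_mul_left_iff hc).1 this
  · have := Summable.tsum_comm (f := fun k n => doubleTerm p a b 1 (k, n)) hS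
    simp only [hrow, tsum_doubleTerm_snd hp ha hb h, tsum_mul_left] at this
    exact this

/-- The terms are `O(k ^ (-1 - n - δ))`, where `δ > -n` may be negative. -/
lemma summable_gTerm_zero {p : ℕ} (hp : 2 ≤ p) {a b : ℕ → ℂ}
    (h1 : ∀ m : ℕ, a 1 + excess p a b ≠ -(m : ℂ))
    (h2 : ∀ m : ℕ, a 2 + excess p a b ≠ -(m : ℂ)) (n : ℕ)
    (h : ∀ j ∈ Icc 3 (p + 1), 0 < (a j + n).re) : Summable (gTerm p a b n 0) := by
  obtain ⟨δ, h0, hδ⟩ := exists_between_re (x := -n) (a := a) (fun j hj => by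
    have := h j hj
    simp at this
    linarith)
  set s := excess p a b with hs
  obtain ⟨C1, hC1, b1⟩ := isBigO_wt_iff.1 (isSymbol_coeffA hp (b := b) hδ).isBigO
  obtain ⟨C2, hC2, b2⟩ := norm_poch_le (s - n)
  obtain ⟨C3, hC3, b3⟩ := norm_inv_Gamma_add_nat_le (a 1 + s)
  obtain ⟨C4, hC4, b4⟩ := norm_inv_Gamma_add_nat_le (a 2 + s)
  rw [← hs] at b1
  refine Summable.of_norm_bounded ((summable_wt (r := -1 - n - δ) (by linarith)).mul_left
    (C1 * C2 * C3 * C4 * ‖Complex.Gamma (a 1 + s) * Complex.Gamma (a 2 + s)‖)) fun k => ?_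
  have b1' : ‖coeffA p a b k‖ ≤ C1 * wt ((s + a 1 + a 2).re - δ - 2) k * k ! := by
    have := b1 k
    rwa [norm_div, Complex.norm_natCast, div_le_iff₀ (by positivity)] at this
  have e : gTerm p a b n 0 k = Complex.Gamma (a 1 + s) * Complex.Gamma (a 2 + s)
      * (poch (s - n) k * (Complex.Gamma (a 1 + s + k))⁻¹ * (Complex.Gamma (a 2 + s + k))⁻¹
        * coeffA p a b k) := by
    rw [gTerm, Gamma_add_nat h1, Gamma_add_nat h2, sub_zero, ← hs]
    field_simp [Complex.Gamma_ne_zero h1, Complex.Gamma_ne_zero h2, poch_ne_zero h1 k,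
      poch_ne_zero h2 k]
  rw [e, norm_mul, norm_mul (_ * _ * _), norm_mul (_ * _), norm_mul (poch _ _)]
  have w1 := wt_pos ((s + a 1 + a 2).re - δ - 2) k
  have w2 := wt_pos ((s - n).re - 1) k
  have w3 := wt_pos (1 - (a 1 + s).re) k
  have w4 := wt_pos (1 - (a 2 + s).re) k
  calc _ ≤ ‖Complex.Gamma (a 1 + s) * Complex.Gamma (a 2 + s)‖
        * ((C2 * (wt ((s - n).re - 1) k * k !)) * (C3 * (wt (1 - (a 1 + s).re) k / k !))
          * (C4 * (wt (1 - (a 2 + s).re) k / k !))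
          * (C1 * wt ((s + a 1 + a 2).re - δ - 2) k * k !)) := by
        gcongr
        exacts [b2 k, b3 k, b4 k]
    _ = _ := by
        rw [show (-1 - n - δ : ℝ) = ((s - n).re - 1) + (1 - (a 1 + s).re) + (1 - (a 2 + s).re)
          + ((s + a 1 + a 2).re - δ - 2) by simp; ring, wt_add, wt_add, wt_add]
        field_simp

/-! ### Power series -/

/-- The sum of the power series with coefficients `c`. -/
def PS (c : ℕ → ℂ) (z : ℂ) : ℂ := ∑' n, c n * z ^ n

/-- The power series with coefficients `c` converges for `‖z‖ < R`. -/
def ConvRad (R : ℝ) (c : ℕ → ℂ) : Prop := ∀ z : ℂ, ‖z‖ < R → Summable fun n => c n * z ^ n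

/-- The coefficients of the derivative. -/
def dcoeff (c : ℕ → ℂ) (n : ℕ) : ℂ := (n + 1) * c (n + 1)

/-- The coefficients of the product with the variable. -/
def zcoeff (c : ℕ → ℂ) : ℕ → ℂ
  | 0 => 0
  | n + 1 => c n

lemma PS_zero (c : ℕ → ℂ) : PS c 0 = c 0 := by
  unfold PS
  rw [tsum_eq_single 0 (fun n hn => by simp [hn])]
  simp

namespace ConvRad

variable {R : ℝ} {c d : ℕ → ℂ}

lemma hasSum (h : ConvRad R c) {z : ℂ} (hz : ‖z‖ < R) :
    HasSum (fun n => c n * z ^ n) (PS c z) := (h z hz).hasSum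

lemma summable_norm (h : ConvRad R c) {r : ℝ} (h0 : 0 ≤ r) (hr : r < R) :
    Summable fun n => ‖c n‖ * r ^ n := by
  have := (h r (by rwa [Complex.norm_real, Real.norm_of_nonneg h0])).norm
  refine this.congr fun n => ?_
  rw [norm_mul, norm_pow, Complex.norm_real, Real.norm_of_nonneg h0]

lemma of_norm_le {C r : ℝ} (h : ∀ n, ‖c n‖ ≤ C * wt r n) : ConvRad 1 c := by
  intro z hz
  refine Summable.of_norm_bounded ((summable_wt_mul_pow r (norm_nonneg z) hz).mul_left C)
    fun n => ?_
  rw [norm_mul, norm_pow, ← mul_assoc]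
  exact mul_le_mul_of_nonneg_right (h n) (by positivity)

lemma add (hc : ConvRad R c) (hd : ConvRad R d) : ConvRad R (fun n => c n + d n) := by
  intro z hz
  refine ((hc z hz).add (hd z hz)).congr fun n => by ring

lemma const_mul (hc : ConvRad R c) (x : ℂ) : ConvRad R (fun n => x * c n) := by
  intro z hz
  refine ((hc z hz).mul_left x).congr fun n => by ring

lemma hasSum_z {z s : ℂ} (h : HasSum (fun n => c n * z ^ n) s) :
    HasSum (fun n => zcoeff c n * z ^ n) (z * s) := by
  rw [← hasSum_nat_add_iff' 1]
  simp only [range_one, sum_singleton, zcoeff, zero_mul, sub_zero]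
  refine (h.mul_left z).congr_fun fun n => ?_
  rw [pow_succ]
  ring

lemma zcoeff (hc : ConvRad R c) : ConvRad R (zcoeff c) :=
  fun _ hz => (hasSum_z (hc.hasSum hz)).summable

lemma dcoeff (h : ConvRad R c) : ConvRad R (dcoeff c) := by
  intro z hz
  obtain ⟨r, h1, h2⟩ := exists_between hz
  have hr : 0 < r := (norm_nonneg _).trans_lt h1
  obtain ⟨C, hC, hb⟩ := exists_forall_le_of_tendsto
    (h.summable_norm hr.le h2).tendsto_atTop_zero
  have hx : ‖z‖ / r < 1 := (div_lt_one hr).2 h1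
  refine Summable.of_norm_bounded
    ((summable_wt_mul_pow 1 (by positivity) hx).mul_left (C / r)) fun n => ?_
  have h3 := hb (n + 1)
  have h4 : ‖c (n + 1)‖ ≤ C / r ^ (n + 1) := by
    rwa [le_div_iff₀ (by positivity)]
  have e : ‖(n : ℂ) + 1‖ = (n : ℝ) + 1 := by
    rw [← Nat.cast_succ, Complex.norm_natCast, Nat.cast_succ]
  simp only [_root_.dcoeff, norm_mul, norm_pow, e, wt, Real.rpow_one]
  calc ((n : ℝ) + 1) * ‖c (n + 1)‖ * ‖z‖ ^ n
      ≤ ((n : ℝ) + 1) * (C / r ^ (n + 1)) * ‖z‖ ^ n := by gcongr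
    _ = _ := by rw [div_pow, pow_succ]; field_simp

lemma hasDerivAt (h : ConvRad R c) {z : ℂ} (hz : ‖z‖ < R) :
    HasDerivAt (PS c) (PS (_root_.dcoeff c) z) z := by
  obtain ⟨r, h1, h2⟩ := exists_between hz
  have hr : 0 < r := (norm_nonneg z).trans_lt h1
  have hd : ∀ n, ∀ y : ℂ, HasDerivAt (fun y => c n * y ^ n) (c n * (n * y ^ (n - 1))) y :=
    fun n y => (hasDerivAt_pow n y).const_mul (c n)
  have hs : Summable fun n => ‖c n‖ * (n * r ^ (n - 1)) := by
    rw [← summable_nat_add_iff 1]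
    refine (h.dcoeff.summable_norm hr.le h2).congr fun n => ?_
    have e : ‖(n : ℂ) + 1‖ = (n : ℝ) + 1 := by
      rw [← Nat.cast_succ, Complex.norm_natCast, Nat.cast_succ]
    simp only [_root_.dcoeff, norm_mul, e, Nat.cast_add, Nat.cast_one, Nat.add_sub_cancel]
    ring
  have key := hasDerivAt_tsum_of_isPreconnected hs Metric.isOpen_ball
    (convex_ball (0 : ℂ) r).isPreconnected (fun n y _ => hd n y)
    (fun n y hy => by
      rw [norm_mul, norm_mul, norm_pow, Complex.norm_natCast]
      have : ‖y‖ ≤ r := (mem_ball_zero_iff.1 hy).le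
      gcongr) (mem_ball_zero_iff.2 h1) (h z hz) (mem_ball_zero_iff.2 h1)
  refine key.congr_deriv ?_
  have s2 : Summable fun n => c n * (n * z ^ (n - 1)) := by
    refine Summable.of_norm_bounded hs fun n => ?_
    rw [norm_mul, norm_mul, norm_pow, Complex.norm_natCast]
    gcongr
  rw [s2.tsum_eq_zero_add]
  simp only [Nat.cast_zero, zero_mul, mul_zero, zero_add, Nat.add_sub_cancel]
  refine tsum_congr fun n => ?_
  simp only [_root_.dcoeff]
  push_cast
  ring

lemma continuousAt (h : ConvRad R c) {z : ℂ} (hz : ‖z‖ < R) : ContinuousAt (PS c) z :=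
  (h.hasDerivAt hz).continuousAt

lemma eq_zero (h : ConvRad R c) (hR : 0 < R) (h0 : PS c =ᶠ[𝓝 0] 0) : c = 0 := by
  funext n
  induction n generalizing c with
  | zero =>
    have := h0.eq_of_nhds
    rwa [PS_zero] at this
  | succ n ih =>
    have h1 : PS (_root_.dcoeff c) =ᶠ[𝓝 0] 0 := by
      filter_upwards [h0.eventuallyEq_nhds, Metric.ball_mem_nhds (0 : ℂ) hR] with z hz hzR
      have h2 := h.hasDerivAt (mem_ball_zero_iff.1 hzR)
      have h3 := (hasDerivAt_const z (0 : ℂ)).congr_of_eventuallyEq hz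
      exact h2.unique h3
    have := ih h.dcoeff h1
    simp only [_root_.dcoeff, Pi.zero_apply, mul_eq_zero] at this
    exact this.resolve_left (by exact_mod_cast n.succ_ne_zero)

end ConvRad

/-! ### Uniqueness of expansions with a power of non-integral exponent. -/

/-- The lens `‖t‖ < R`, `‖1 - t‖ < 1`. -/
def lens (R : ℝ) : Set ℂ := Metric.ball 0 R ∩ Metric.ball 1 1

lemma mem_lens {R : ℝ} {t : ℂ} : t ∈ lens R ↔ ‖t‖ < R ∧ ‖1 - t‖ < 1 := by
  rw [lens, Set.mem_inter_iff, mem_ball_zero_iff, mem_ball_iff_norm, norm_sub_rev t 1]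

lemma isOpen_lens (R : ℝ) : IsOpen (lens R) := Metric.isOpen_ball.inter Metric.isOpen_ball

lemma convex_lens (R : ℝ) : Convex ℝ (lens R) := (convex_ball _ _).inter (convex_ball _ _)

lemma re_pos_of_norm_one_sub_lt {t : ℂ} (h : ‖1 - t‖ < 1) : 0 < t.re := by
  have := (Complex.re_le_norm (1 - t)).trans_lt h
  simp at this
  exact this

lemma ofReal_mem_lens {R x : ℝ} (h0 : 0 < x) (h1 : x < 2) (hR : x < R) : (x : ℂ) ∈ lens R := by
  rw [mem_lens, ← Complex.ofReal_one, ← Complex.ofReal_sub, Complex.norm_real, Complex.norm_real,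
    Real.norm_of_nonneg h0.le, Real.norm_eq_abs, abs_lt]
  exact ⟨hR, by linarith, by linarith⟩

/-- An analytic function and `t ^ ρ` times an analytic function cancel only if both vanish. -/
theorem coeff_eq_zero_of_add_cpow_mul_eq_zero {R : ℝ} (hR : 0 < R) {ρ : ℂ}
    (hρ : ∀ m : ℤ, ρ ≠ m) {c d : ℕ → ℂ} (hc : ConvRad R c) (hd : ConvRad R d)
    (h : ∀ t ∈ lens R, PS c t + t ^ ρ * PS d t = 0) : c = 0 ∧ d = 0 := by
  let H : Set ℂ := {w | w.re < Real.log R}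
  have hHopen : IsOpen H := isOpen_lt Complex.continuous_re continuous_const
  have hHconv : IsPreconnected H := (convex_halfSpace_re_lt (Real.log R)).isPreconnected
  have hexp : ∀ w ∈ H, ‖Complex.exp w‖ < R := by
    intro w hw
    rw [Complex.norm_exp]
    exact (Real.lt_log_iff_exp_lt hR).1 hw
  -- The substitution `t = exp w` unrolls the punctured disc into a half-plane, where `t ^ ρ`
  -- becomes single-valued. The relation holds near one real point, hence on the whole half-plane.
  let F : ℂ → ℂ := fun w => PS c (Complex.exp w) + Complex.exp (ρ * w) * PS d (Complex.exp w)
  have hF : AnalyticOnNhd ℂ F H := by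
    refine DifferentiableOn.analyticOnNhd (fun w hw => ?_) hHopen
    have h1 := (hc.hasDerivAt (hexp w hw)).differentiableAt
    have h2 := (hd.hasDerivAt (hexp w hw)).differentiableAt
    have h3 : DifferentiableAt ℂ (fun w => PS c (Complex.exp w)) w :=
      h1.comp w Complex.differentiable_exp.differentiableAt
    have h4 : DifferentiableAt ℂ (fun w => PS d (Complex.exp w)) w :=
      h2.comp w Complex.differentiable_exp.differentiableAt
    have h5 : DifferentiableAt ℂ (fun w => Complex.exp (ρ * w)) w := by fun_prop
    exact (h3.add (h5.mul h4)).differentiableWithinAt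
  have hx : 0 < min R 1 / 2 := by positivity
  have hx1 : min R 1 / 2 < R := by linarith [min_le_left R 1]
  have hx2 : min R 1 / 2 < 2 := by linarith [min_le_right R 1]
  let w0 : ℂ := (Real.log (min R 1 / 2) : ℝ)
  have hw0 : Complex.exp w0 = ((min R 1 / 2 : ℝ) : ℂ) := by
    rw [← Complex.ofReal_exp, Real.exp_log hx]
  have hw0H : w0 ∈ H := by
    change (w0).re < _
    rw [Complex.ofReal_re]
    exact Real.log_lt_log hx hx1
  have hF0 : F =ᶠ[𝓝 w0] 0 := by
    have e1 : ∀ᶠ w in 𝓝 w0, Complex.exp w ∈ lens R :=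
      Complex.continuous_exp.continuousAt.eventually_mem
        ((isOpen_lens R).mem_nhds (by rw [hw0]; exact ofReal_mem_lens hx hx2 hx1))
    have e2 : ∀ᶠ w : ℂ in 𝓝 w0, |w.im| < Real.pi := by
      have : ContinuousAt (fun w : ℂ => |w.im|) w0 := by fun_prop
      refine this.eventually_lt_const ?_
      simp [w0, Real.pi_pos]
    filter_upwards [e1, e2] with w hw1 hw2
    have := h _ hw1
    rw [abs_lt] at hw2
    rwa [Complex.cpow_def_of_ne_zero (Complex.exp_ne_zero w), Complex.log_exp hw2.1 hw2.2.le,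
      mul_comm w] at this
  have hFz : Set.EqOn F 0 H := hF.eqOn_zero_of_preconnected_of_eventuallyEq_zero hHconv hw0H hF0
  have hq : Complex.exp (ρ * (2 * Real.pi * Complex.I)) ≠ 1 := by
    intro h1
    obtain ⟨n, hn⟩ := Complex.exp_eq_one_iff.1 h1
    exact hρ n (mul_right_cancel₀ Complex.two_pi_I_ne_zero hn)
  have hd0 : ∀ t : ℂ, t ≠ 0 → ‖t‖ < R → PS d t = 0 ∧ PS c t = 0 := by
    intro t ht htR
    have hw : Complex.log t ∈ H := by
      change (Complex.log t).re < _
      rw [Complex.log_re]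
      exact Real.log_lt_log (norm_pos_iff.2 ht) htR
    have hw' : Complex.log t + 2 * Real.pi * Complex.I ∈ H := by
      change (Complex.log t + 2 * Real.pi * Complex.I).re < _
      have : (Complex.log t).re < Real.log R := hw
      simpa using this
    have f1 := hFz hw
    have f2 := hFz hw'
    simp only [F, Pi.zero_apply, Complex.exp_periodic (Complex.log t), Complex.exp_log ht,
      mul_add, Complex.exp_add] at f1 f2
    -- Passing from `w` to `w + 2πi` changes only the second summand, by the factor `exp (2πiρ) ≠
    -- 1`.
    have f3 : Complex.exp (ρ * Complex.log t)
        * (Complex.exp (ρ * (2 * Real.pi * Complex.I)) - 1) * PS d t = 0 := by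
      linear_combination f2 - f1
    have hdz : PS d t = 0 := by
      rcases mul_eq_zero.1 f3 with h | h
      · rcases mul_eq_zero.1 h with h | h
        · exact absurd h (Complex.exp_ne_zero _)
        · exact absurd (sub_eq_zero.1 h) hq
      · exact h
    rw [hdz, mul_zero, add_zero] at f1
    exact ⟨hdz, f1⟩
  have ext : ∀ {e : ℕ → ℂ}, ConvRad R e → (∀ t : ℂ, t ≠ 0 → ‖t‖ < R → PS e t = 0) → e = 0 := by
    intro e he h0
    refine he.eq_zero hR ?_
    have hp : PS e =ᶠ[𝓝[≠] 0] 0 := by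
      filter_upwards [self_mem_nhdsWithin,
        nhdsWithin_le_nhds (Metric.ball_mem_nhds (0 : ℂ) hR)] with t ht htR
      exact h0 t ht (mem_ball_zero_iff.1 htR)
    have hcont := he.continuousAt (z := 0) (by simpa using hR)
    have hz : PS e 0 = 0 :=
      tendsto_nhds_unique (hcont.tendsto.mono_left nhdsWithin_le_nhds)
        (tendsto_const_nhds.congr' hp.symm)
    filter_upwards [Metric.ball_mem_nhds (0 : ℂ) hR] with t htR
    by_cases ht : t = 0
    · rw [ht, hz]; rfl
    · exact h0 t ht (mem_ball_zero_iff.1 htR)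
  exact ⟨ext hc fun t h1 h2 => (hd0 t h1 h2).2, ext hd fun t h1 h2 => (hd0 t h1 h2).1⟩

/-! ### Gauss's differential equation and the existence of a connection. -/

lemma gaussTerm_succ (α β c : ℂ) (n : ℕ) :
    (c + n) * (n + 1) * gaussTerm α β c (n + 1) = (α + n) * (β + n) * gaussTerm α β c n := by
  unfold gaussTerm
  rw [inv_Gamma_eq c n, poch_succ, poch_succ, Nat.factorial_succ,
    show c + ((n + 1 : ℕ) : ℂ) = c + 1 + n by push_cast; ring]
  have h1 := factorial_cast_ne_zero n
  have h2 : ((n : ℂ) + 1) ≠ 0 := by exact_mod_cast n.succ_ne_zero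
  push_cast
  field_simp

lemma convRad_gaussTerm (α β c : ℂ) : ConvRad 1 (gaussTerm α β c) :=
  fun _ hz => norm_gaussTerm_mul_pow_summable α β c hz

lemma gaussTerm_ode (α β c : ℂ) {x : ℂ} (hx : ‖x‖ < 1) :
    x * (1 - x) * PS (dcoeff (dcoeff (gaussTerm α β c))) x
      + (c - (α + β + 1) * x) * PS (dcoeff (gaussTerm α β c)) x
      - α * β * PS (gaussTerm α β c) x = 0 := by
  set g := gaussTerm α β c with hg
  have h0 := (convRad_gaussTerm α β c)
  have h1 := h0.dcoeff.hasSum hx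
  have h2 := h0.dcoeff.dcoeff.hasSum hx
  have h3 := ConvRad.hasSum_z h1
  have h4 := ConvRad.hasSum_z h2
  have h5 := ConvRad.hasSum_z h4
  have H := (((h4.sub h5).add (h1.mul_left c)).sub (h3.mul_left (α + β + 1))).sub
    ((h0.hasSum hx).mul_left (α * β))
  have Z : HasSum (fun _ : ℕ => (0 : ℂ)) 0 := hasSum_zero
  rw [← H.unique (Z.congr_fun fun n => ?_)]
  · ring
  · have hr := gaussTerm_succ α β c n
    rw [← hg] at hr ⊢
    rcases n with _ | _ | n
    · simp only [zcoeff, dcoeff] at hr ⊢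
      push_cast at hr ⊢
      linear_combination hr
    · simp only [zcoeff, dcoeff] at hr ⊢
      push_cast at hr ⊢
      linear_combination x * hr
    · simp only [zcoeff, dcoeff] at hr ⊢
      push_cast at hr ⊢
      linear_combination x ^ (n + 1 + 1) * hr

/-- `y` solves Gauss's differential equation on the lens; `y'`, `y''` are its derivatives. -/
def IsGaussSol (α β c : ℂ) (y y' y'' : ℂ → ℂ) : Prop :=
  ∀ t ∈ lens 1, HasDerivAt y (y' t) t ∧ HasDerivAt y' (y'' t) t ∧
    t * (1 - t) * y'' t + (c - (α + β + 1) * t) * y' t - α * β * y t = 0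

lemma isGaussSol_gaussTerm (α β c : ℂ) : IsGaussSol α β c (PS (gaussTerm α β c))
    (PS (dcoeff (gaussTerm α β c))) (PS (dcoeff (dcoeff (gaussTerm α β c)))) := by
  intro t ht
  have ht1 := (mem_lens.1 ht).1
  exact ⟨(convRad_gaussTerm α β c).hasDerivAt ht1,
    (convRad_gaussTerm α β c).dcoeff.hasDerivAt ht1, gaussTerm_ode α β c ht1⟩

/-- The equation is invariant under `t ↦ 1 - t` if `c` becomes `α + β + 1 - c`; here `c = S + α + β`
becomes `1 - S`. -/
lemma isGaussSol_reflect (α β S : ℂ) : IsGaussSol α β (1 - S)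
    (fun t => PS (gaussTerm α β (S + α + β)) (1 - t))
    (fun t => -PS (dcoeff (gaussTerm α β (S + α + β))) (1 - t))
    (fun t => PS (dcoeff (dcoeff (gaussTerm α β (S + α + β)))) (1 - t)) := by
  intro t ht
  have ht1 := (mem_lens.1 ht).2
  have hc := convRad_gaussTerm α β (S + α + β)
  have hsub : HasDerivAt (fun t : ℂ => 1 - t) (-1) t := by
    simpa using (hasDerivAt_id t).const_sub 1
  refine ⟨?_, ?_, ?_⟩
  · exact ((hc.hasDerivAt ht1).comp t hsub).congr_deriv (by ring)
  · exact ((hc.dcoeff.hasDerivAt ht1).comp t hsub).neg.congr_deriv (by ring)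
  · have := gaussTerm_ode α β (S + α + β) ht1
    linear_combination this

/-- The second Frobenius solution at `0`, with exponent `1 - c = S`. -/
lemma isGaussSol_cpow (α β S : ℂ) : IsGaussSol α β (1 - S)
    (fun t => t ^ S * PS (gaussTerm (α + S) (β + S) (1 + S)) t)
    (fun t => t ^ S * (PS (dcoeff (gaussTerm (α + S) (β + S) (1 + S))) t
      + S * PS (gaussTerm (α + S) (β + S) (1 + S)) t / t))
    (fun t => t ^ S * (PS (dcoeff (dcoeff (gaussTerm (α + S) (β + S) (1 + S)))) t
      + 2 * S * PS (dcoeff (gaussTerm (α + S) (β + S) (1 + S))) t / t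
      + S * (S - 1) * PS (gaussTerm (α + S) (β + S) (1 + S)) t / t ^ 2)) := by
  intro t ht
  obtain ⟨ht1, ht2⟩ := mem_lens.1 ht
  have hre := re_pos_of_norm_one_sub_lt ht2
  have ht0 : t ≠ 0 := by rintro rfl; simp at hre
  have hc := convRad_gaussTerm (α + S) (β + S) (1 + S)
  have hv := hc.hasDerivAt ht1
  have hv' := hc.dcoeff.hasDerivAt ht1
  have hp : HasDerivAt (fun t : ℂ => t ^ S) (S * t ^ S / t) t := by
    have := (hasDerivAt_id t).cpow_const (c := S) (Or.inl hre)
    refine this.congr_deriv ?_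
    simp only [id_eq]
    rw [Complex.cpow_sub _ _ ht0, Complex.cpow_one]
    ring
  refine ⟨?_, ?_, ?_⟩
  · refine (hp.mul hv).congr_deriv ?_
    field_simp
    ring
  · refine (hp.mul (hv'.add ((hv.const_mul S).div (hasDerivAt_id t) ht0))).congr_deriv ?_
    simp only [id_eq, Pi.add_apply, Pi.div_apply]
    field_simp
    ring
  · have h := gaussTerm_ode (α + S) (β + S) (1 + S) ht1
    simp only []
    field_simp
    linear_combination t ^ S * t * h

/-- Abel's identity, with integrating factor `t ^ c (1 - t) ^ (α + β + 1 - c)` for `c = 1 - S`. -/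
lemma wronskian_const {α β S : ℂ} {y y' y'' w w' w'' : ℂ → ℂ}
    (hy : IsGaussSol α β (1 - S) y y' y'') (hw : IsGaussSol α β (1 - S) w w' w'') :
    ∃ K : ℂ, ∀ t ∈ lens 1,
      t ^ (1 - S) * (1 - t) ^ (S + α + β) * (y t * w' t - y' t * w t) = K := by
  have hd : ∀ t ∈ lens 1, HasDerivAt
      (fun t => t ^ (1 - S) * (1 - t) ^ (S + α + β) * (y t * w' t - y' t * w t)) 0 t := by
    intro t ht
    obtain ⟨ht1, ht2⟩ := mem_lens.1 ht
    have hre := re_pos_of_norm_one_sub_lt ht2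
    have hre2 : 0 < (1 - t).re := re_pos_of_norm_one_sub_lt (by simpa using ht1)
    have ht0 : t ≠ 0 := by rintro rfl; simp at hre
    have ht10 : 1 - t ≠ 0 := by intro h; rw [h] at hre2; simp at hre2
    obtain ⟨y1, y2, y3⟩ := hy t ht
    obtain ⟨w1, w2, w3⟩ := hw t ht
    have hp : HasDerivAt (fun t : ℂ => t ^ (1 - S)) ((1 - S) * t ^ (1 - S) / t) t := by
      have := (hasDerivAt_id t).cpow_const (c := 1 - S) (Or.inl hre)
      refine this.congr_deriv ?_
      simp only [id_eq]
      rw [Complex.cpow_sub _ _ ht0, Complex.cpow_one]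
      ring
    have hq : HasDerivAt (fun t : ℂ => (1 - t) ^ (S + α + β))
        (-((S + α + β) * (1 - t) ^ (S + α + β) / (1 - t))) t := by
      have := ((hasDerivAt_id t).const_sub 1).cpow_const (c := S + α + β) (Or.inl hre2)
      refine this.congr_deriv ?_
      simp only [id_eq]
      rw [Complex.cpow_sub _ _ ht10, Complex.cpow_one]
      ring
    refine ((hp.mul hq).mul ((y1.mul w2).sub (y2.mul w1))).congr_deriv ?_
    simp only [Pi.mul_apply, Pi.sub_apply]
    field_simp
    linear_combination t ^ (1 - S) * (1 - t) ^ (S + α + β) * (y t * w3 - w t * y3)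
  obtain ⟨t0, ht0⟩ : (lens 1).Nonempty :=
    ⟨((1 / 2 : ℝ) : ℂ), ofReal_mem_lens (by norm_num) (by norm_num) (by norm_num)⟩
  exact ⟨_, fun t ht => (isOpen_lens 1).is_const_of_deriv_eq_zero (convex_lens 1).isPreconnected
    (fun t ht => (hd t ht).differentiableAt.differentiableWithinAt)
    (fun t ht => (hd t ht).deriv) ht ht0⟩

lemma tendsto_one_div_lens (R : ℝ) (hR : 0 < R) :
    Tendsto (fun n : ℕ => ((1 / ((n : ℝ) + 1) : ℝ) : ℂ)) atTop (𝓝 0) ∧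
    ∀ᶠ n : ℕ in atTop, ((1 / ((n : ℝ) + 1) : ℝ) : ℂ) ∈ lens R := by
  have h := tendsto_one_div_add_atTop_nhds_zero_nat (𝕜 := ℝ)
  have h0 := (Complex.continuous_ofReal.tendsto 0).comp h
  rw [Complex.ofReal_zero] at h0
  refine ⟨h0, ?_⟩
  filter_upwards [h.eventually_lt_const (show (0 : ℝ) < min R 2 by positivity)] with n hn
  exact ofReal_mem_lens (by positivity) (hn.trans_le (min_le_right _ _))
    (hn.trans_le (min_le_left _ _))

/-- Numbers `X`, `Y` connect the Gauss series at `0` with those at `1`. -/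
def IsConn (α β S X Y : ℂ) : Prop := ∀ t ∈ lens 1,
  PS (gaussTerm α β (S + α + β)) (1 - t)
    = X * PS (gaussTerm α β (1 - S)) t
      + Y * (t ^ S * PS (gaussTerm (α + S) (β + S) (1 + S)) t)

lemma inv_Gamma_one_add_ne_zero {S : ℂ} (hS : ∀ m : ℤ, S ≠ m) :
    (Complex.Gamma (1 + S))⁻¹ ≠ 0 ∧ (Complex.Gamma (1 - S))⁻¹ ≠ 0 := by
  constructor
  · refine inv_ne_zero (Complex.Gamma_ne_zero fun m hm => hS (-m - 1) ?_)
    push_cast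
    linear_combination hm
  · refine inv_ne_zero (Complex.Gamma_ne_zero fun m hm => hS (m + 1) ?_)
    push_cast
    linear_combination -hm

lemma gaussTerm_zero (α β c : ℂ) : gaussTerm α β c 0 = (Complex.Gamma c)⁻¹ := by
  simp [gaussTerm, poch_zero]

/-- Cramer's rule with Wronskians. The determinant `K`, that of the two solutions at `0`, is found
by letting `t → 0`: it is `S / (Γ(1 - S) Γ(1 + S))`, nonzero for non-integral `S`. -/
lemma exists_isConn (α β : ℂ) {S : ℂ} (hS : ∀ m : ℤ, S ≠ m) : ∃ X Y, IsConn α β S X Y := by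
  have sR := isGaussSol_reflect α β S
  have s1 := isGaussSol_gaussTerm α β (1 - S)
  have s2 := isGaussSol_cpow α β S
  obtain ⟨K1, h1⟩ := wronskian_const sR s2
  obtain ⟨K2, h2⟩ := wronskian_const sR s1
  obtain ⟨K, h⟩ := wronskian_const s1 s2
  have hS0 : S ≠ 0 := by simpa using hS 0
  set u := gaussTerm α β (1 - S) with hu
  set v := gaussTerm (α + S) (β + S) (1 + S) with hv
  have cu : ConvRad 1 u := convRad_gaussTerm _ _ _
  have cv : ConvRad 1 v := convRad_gaussTerm _ _ _
  have hK : K ≠ 0 := by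
    obtain ⟨l1, l2⟩ := tendsto_one_div_lens 1 one_pos
    have e : ∀ t ∈ lens 1, (1 - t) ^ (S + α + β) *
        (PS u t * (t * PS (dcoeff v) t + S * PS v t) - t * PS (dcoeff u) t * PS v t) = K := by
      intro t ht
      rw [← h t ht]
      have hre := re_pos_of_norm_one_sub_lt (mem_lens.1 ht).2
      have ht0 : t ≠ 0 := by rintro rfl; simp at hre
      have e2 : t ^ (1 - S) * t ^ S = t := by
        rw [← Complex.cpow_add _ _ ht0, sub_add_cancel, Complex.cpow_one]
      have e3 : t * (PS (dcoeff v) t + S * PS v t / t) = t * PS (dcoeff v) t + S * PS v t := by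
        field_simp
      rw [← e3]
      linear_combination (-(1 - t) ^ (S + α + β) * (PS u t * (PS (dcoeff v) t + S * PS v t / t)
        - PS (dcoeff u) t * PS v t)) * e2
    have hz : ‖(0 : ℂ)‖ < 1 := by simp
    have c1 := cu.continuousAt hz
    have c2 := cv.continuousAt hz
    have c3 := cu.dcoeff.continuousAt hz
    have c4 := cv.dcoeff.continuousAt hz
    have c5 : ContinuousAt (fun t : ℂ => (1 - t) ^ (S + α + β)) 0 := by
      refine ContinuousAt.cpow (by fun_prop) continuousAt_const ?_
      simp
    have c : ContinuousAt (fun t : ℂ => (1 - t) ^ (S + α + β) *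
        (PS u t * (t * PS (dcoeff v) t + S * PS v t) - t * PS (dcoeff u) t * PS v t)) 0 :=
      c5.mul ((c1.mul ((continuousAt_id.mul c4).add (continuousAt_const.mul c2))).sub
        ((continuousAt_id.mul c3).mul c2))
    have lim := c.tendsto.comp l1
    have hKeq := tendsto_nhds_unique lim (tendsto_const_nhds.congr' (by
      filter_upwards [l2] with n hn
      exact (e _ hn).symm))
    rw [← hKeq]
    simp only [sub_zero, Complex.one_cpow, zero_mul, zero_add, one_mul, PS_zero]
    rw [hu, hv, gaussTerm_zero, gaussTerm_zero]
    obtain ⟨n1, n2⟩ := inv_Gamma_one_add_ne_zero hS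
    exact mul_ne_zero n2 (mul_ne_zero hS0 n1)
  refine ⟨K1 / K, -K2 / K, fun t ht => ?_⟩
  have h1' := h1 t ht
  have h2' := h2 t ht
  have h' := h t ht
  field_simp
  linear_combination (PS u t) * h1' - (t ^ S * PS v t) * h2'
    - (PS (gaussTerm α β (S + α + β)) (1 - t)) * h'

/-! ### The connection coefficients. -/

lemma convRad_binom (a : ℂ) : ConvRad 1 (fun n => poch a n / (n ! : ℂ)) := by
  obtain ⟨C, _, h⟩ := norm_poch_le a
  refine ConvRad.of_norm_le (C := C) (r := a.re - 1) fun n => ?_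
  rw [norm_div, Complex.norm_natCast, div_le_iff₀ (by positivity), mul_assoc]
  exact h n

/-- The binomial series. -/
theorem PS_binom_mul_cpow (a : ℂ) {z : ℂ} (hz : ‖z‖ < 1) :
    PS (fun n => poch a n / (n ! : ℂ)) z * (1 - z) ^ a = 1 := by
  set c : ℕ → ℂ := fun n => poch a n / (n ! : ℂ) with hc
  have hC : ConvRad 1 c := convRad_binom a
  have ode : ∀ z : ℂ, ‖z‖ < 1 → (1 - z) * PS (dcoeff c) z = a * PS c z := by
    intro z hz
    have h1 := hC.dcoeff.hasSum hz
    have H := (h1.sub (ConvRad.hasSum_z h1)).sub ((hC.hasSum hz).mul_left a)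
    have Z : HasSum (fun _ : ℕ => (0 : ℂ)) 0 := hasSum_zero
    have := H.unique (Z.congr_fun fun n => ?_)
    · linear_combination this
    · have h2 := factorial_cast_ne_zero n
      have h3 : ((n : ℂ) + 1) ≠ 0 := by exact_mod_cast n.succ_ne_zero
      rcases n with _ | n
      · simp [hc, zcoeff, dcoeff, poch_succ, poch_zero]
      · simp only [hc, zcoeff, dcoeff]
        rw [poch_succ a (n + 1), Nat.factorial_succ (n + 1)]
        push_cast at h3 ⊢
        field_simp
        ring
  have hre : ∀ z : ℂ, ‖z‖ < 1 → 0 < (1 - z).re :=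
    fun z hz => re_pos_of_norm_one_sub_lt (by simpa using hz)
  have hd : ∀ z ∈ Metric.ball (0 : ℂ) 1, HasDerivAt (fun z => PS c z * (1 - z) ^ a) 0 z := by
    intro z hz
    have hz' := mem_ball_zero_iff.1 hz
    have h10 : 1 - z ≠ 0 := by
      intro h; have := hre z hz'; rw [h] at this; simp at this
    have hq : HasDerivAt (fun z : ℂ => (1 - z) ^ a) (-(a * (1 - z) ^ a / (1 - z))) z := by
      have := ((hasDerivAt_id z).const_sub 1).cpow_const (c := a) (Or.inl (hre z hz'))
      refine this.congr_deriv ?_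
      simp only [id_eq]
      rw [Complex.cpow_sub _ _ h10, Complex.cpow_one]
      ring
    refine ((hC.hasDerivAt hz').mul hq).congr_deriv ?_
    field_simp
    linear_combination ((1 - z) ^ a) * ode z hz'
  have := Metric.isOpen_ball.is_const_of_deriv_eq_zero (convex_ball (0 : ℂ) 1).isPreconnected
    (fun t ht => (hd t ht).differentiableAt.differentiableWithinAt)
    (fun t ht => (hd t ht).deriv) (mem_ball_zero_iff.2 hz) (Metric.mem_ball_self one_pos)
  rw [this]
  simp [PS_zero, hc, poch_zero]

lemma poch_ofReal (v : ℝ) (n : ℕ) : poch v n = ((∏ j ∈ range n, (v + j) : ℝ) : ℂ) := by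
  rw [poch_eq_prod]
  push_cast
  rfl

/-- An Abelian theorem: the asymptotics of the coefficients give the behaviour at `1`. -/
theorem tendsto_cpow_mul_PS {d : ℕ → ℂ} {a L : ℂ} (ha : 0 < a.re)
    (h : Tendsto (fun n => d n / (poch a n / (n ! : ℂ))) atTop (𝓝 L)) (hd : ConvRad 1 d)
    {t : ℕ → ℝ} (ht : Tendsto t atTop (𝓝 0)) (ht0 : ∀ n, 0 < t n) :
    Tendsto (fun n => (t n : ℂ) ^ a * PS d (1 - t n)) atTop (𝓝 L) := by
  set b : ℕ → ℂ := fun n => poch a n / (n ! : ℂ) with hb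
  set v : ℝ := a.re with hv
  -- The numbers `(v)_n / n!` with `v = Re a` are positive, dominate `b`, and have the explicit sum
  -- `t ^ (-v)` at `1 - t`; `b` itself may be complex.
  set w : ℕ → ℝ := fun n => (∏ j ∈ range n, (v + j)) / (n ! : ℝ) with hw
  have hpole : ∀ x : ℂ, 0 < x.re → ∀ m : ℕ, x ≠ -(m : ℂ) := by
    intro x hx m hm
    rw [hm] at hx
    simp at hx
    linarith [m.cast_nonneg (α := ℝ)]
  have hwpos : ∀ n, 0 < w n := by
    intro n
    refine div_pos (prod_pos fun j _ => ?_) (by positivity)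
    positivity
  have hwc : ∀ n, (w n : ℂ) = poch v n / (n ! : ℂ) := by
    intro n
    rw [poch_ofReal, hw]
    push_cast
    rfl
  obtain ⟨C, hC, hbw⟩ : ∃ C, 0 < C ∧ ∀ n, ‖b n‖ ≤ C * w n := by
    obtain ⟨C1, hC1, b1⟩ := norm_poch_le a
    obtain ⟨C2, hC2, b2⟩ := norm_inv_Gamma_add_nat_le v
    have hG := norm_pos_iff.2 (Complex.Gamma_ne_zero (hpole v (by simpa using ha)))
    refine ⟨C1 * C2 * ‖Complex.Gamma v‖, by positivity, fun n => ?_⟩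
    have h2 := b2 n
    rw [Gamma_add_nat (hpole v (by simpa using ha)), norm_inv, norm_mul] at h2
    have e1 : ‖poch v n‖ = w n * n ! := by
      have := hwc n
      rw [eq_div_iff (factorial_cast_ne_zero n)] at this
      rw [← this, norm_mul, Complex.norm_natCast, Complex.norm_real,
        Real.norm_of_nonneg (hwpos n).le]
    rw [e1, inv_le_iff_one_le_mul₀ (by have := hwpos n; positivity)] at h2
    simp only [hb, norm_div, Complex.norm_natCast]
    rw [div_le_iff₀ (by positivity)]
    have w1 : (0 : ℝ) < ((n : ℝ) + 1) ^ (a.re - 1) := by positivity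
    have e2 : ((n : ℝ) + 1) ^ (a.re - 1) * ((n : ℝ) + 1) ^ (1 - (v : ℂ).re) = 1 := by
      rw [← Real.rpow_add (by positivity)]
      simp [hv]
    calc ‖poch a n‖ ≤ C1 * (((n : ℝ) + 1) ^ (a.re - 1) * n !) * 1 := by rw [mul_one]; exact b1 n
      _ ≤ C1 * (((n : ℝ) + 1) ^ (a.re - 1) * n !) *
          (C2 * (((n : ℝ) + 1) ^ (1 - (v : ℂ).re) / n !)
            * (‖Complex.Gamma v‖ * (w n * n !))) := by gcongr
      _ = C1 * C2 * ‖Complex.Gamma v‖ * w n * n !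
          * (((n : ℝ) + 1) ^ (a.re - 1) * ((n : ℝ) + 1) ^ (1 - (v : ℂ).re)) := by
          field_simp
      _ = _ := by rw [e2, mul_one]
  have hbne : ∀ n, b n ≠ 0 := fun n =>
    div_ne_zero (poch_ne_zero (hpole a ha) n) (factorial_cast_ne_zero n)
  have hbc : ConvRad 1 b := convRad_binom a
  set e : ℕ → ℂ := fun n => d n + (-L) * b n with he
  have hec : ConvRad 1 e := hd.add (hbc.const_mul (-L))
  have hew : ∀ η : ℝ, 0 < η → ∀ᶠ n in atTop, ‖e n‖ ≤ η * w n := by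
    intro η hη
    have h1 := (tendsto_iff_norm_sub_tendsto_zero.1 h).eventually_lt_const
      (show 0 < η / C by positivity)
    filter_upwards [h1] with n hn
    have e1 : e n = (d n / b n - L) * b n := by
      simp only [he]
      field_simp [hbne n]
      ring
    rw [e1, norm_mul]
    calc _ ≤ η / C * (C * w n) := mul_le_mul hn.le (hbw n) (norm_nonneg _) (by positivity)
      _ = η * w n := by field_simp
  have ht1 : ∀ᶠ n in atTop, t n < 1 := ht.eventually_lt_const one_pos
  have hx : ∀ n, t n < 1 → ‖(1 : ℂ) - t n‖ < 1 := by
    intro n hn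
    rw [← Complex.ofReal_one, ← Complex.ofReal_sub, Complex.norm_real, Real.norm_eq_abs, abs_lt]
    constructor <;> linarith [ht0 n]
  have key : Tendsto (fun n => (t n : ℂ) ^ a * PS e (1 - t n)) atTop (𝓝 0) := by
    rw [tendsto_zero_iff_norm_tendsto_zero]
    refine tendsto_order.2 ⟨fun x hx => Eventually.of_forall fun n => hx.trans_le (norm_nonneg _),
      fun η hη => ?_⟩
    -- The tail of `e` is at most `η / 2` times the comparison series, and the finite head is killed
    -- by `t ^ v → 0`.
    obtain ⟨N, hN⟩ := eventually_atTop.1 (hew (η / 2) (by positivity))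
    set M : ℝ := ∑ n ∈ range N, ‖e n‖ with hM
    have hlim : Tendsto (fun n => t n ^ v * M) atTop (𝓝 0) := by
      have := ((Real.continuousAt_rpow_const 0 v (Or.inr ha.le)).tendsto.comp ht).mul_const M
      simpa [Real.zero_rpow ha.ne'] using this
    filter_upwards [ht1, hlim.eventually_lt_const (show 0 < η / 2 by positivity)] with n hn1 hn2
    set x : ℝ := 1 - t n with hxdef
    have hx0 : 0 < x := by simp only [hxdef]; linarith
    have hx1 : x < 1 := by simp only [hxdef]; linarith [ht0 n]
    have hxc : (1 : ℂ) - t n = x := by rw [hxdef]; push_cast; rfl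
    have hW : HasSum (fun k => w k * x ^ k) ((t n ^ v)⁻¹) := by
      have h1 := (convRad_binom v).hasSum (hx n hn1)
      have h2 := PS_binom_mul_cpow v (hx n hn1)
      rw [sub_sub_cancel, ← Complex.ofReal_cpow (ht0 n).le] at h2
      have h3 : PS (fun n => poch v n / (n ! : ℂ)) (1 - t n) = ((t n ^ v)⁻¹ : ℝ) := by
        rw [Complex.ofReal_inv]
        exact eq_inv_of_mul_eq_one_left h2
      rw [h3, hxc] at h1
      rw [← Complex.hasSum_ofReal]
      refine h1.congr_fun fun k => ?_
      rw [← hwc]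
      push_cast
      rfl
    have htv : 0 < t n ^ v := Real.rpow_pos_of_pos (ht0 n) v
    have hsum : ‖PS e (1 - t n)‖ ≤ η / 2 * (t n ^ v)⁻¹ + M := by
      have hfin : HasSum (fun k => if k < N then ‖e k‖ else 0) M := by
        have : HasSum (fun k => if k < N then ‖e k‖ else 0)
            (∑ k ∈ range N, if k < N then ‖e k‖ else 0) :=
          hasSum_sum_of_ne_finset_zero fun k hk => if_neg (by simpa using hk)
        convert this using 1
        exact sum_congr rfl fun k hk => by simp [mem_range.1 hk]
      refine tsum_of_norm_bounded ((hW.mul_left (η / 2)).add hfin) fun k => ?_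
      rw [norm_mul, norm_pow, hxc, Complex.norm_real, Real.norm_of_nonneg hx0.le]
      split_ifs with hk
      · have h1 : ‖e k‖ * x ^ k ≤ ‖e k‖ :=
          mul_le_of_le_one_right (norm_nonneg _) (pow_le_one₀ hx0.le hx1.le)
        have := hwpos k
        have : 0 ≤ η / 2 * (w k * x ^ k) := by positivity
        linarith
      · rw [add_zero, ← mul_assoc]
        exact mul_le_mul_of_nonneg_right (hN k (not_lt.1 hk)) (by positivity)
    rw [norm_mul, Complex.norm_cpow_eq_rpow_re_of_pos (ht0 n)]
    calc t n ^ a.re * ‖PS e (1 - t n)‖ ≤ t n ^ v * (η / 2 * (t n ^ v)⁻¹ + M) := by gcongr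
      _ = η / 2 + t n ^ v * M := by field_simp
      _ < η := by linarith
  have h2 := key.add_const L
  rw [zero_add] at h2
  refine h2.congr' ?_
  filter_upwards [ht1] with n hn
  have h3 := (hd.hasSum (hx n hn)).add ((hbc.const_mul (-L)).hasSum (hx n hn))
  have h4 := (hbc.hasSum (hx n hn)).mul_left (-L)
  have h5 := PS_binom_mul_cpow a (hx n hn)
  rw [sub_sub_cancel] at h5
  have h6 : PS e (1 - t n) = PS d (1 - t n) + -L * PS b (1 - t n) := by
    refine (hec.hasSum (hx n hn)).unique (((hd.hasSum (hx n hn)).add h4).congr_fun fun k => ?_)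
    simp only [he]
    ring
  rw [h6]
  linear_combination (-L) * h5

/-- The operator `γ + z d/dz` lowers the regularized Gauss series from `γ + 1` to `γ`. Applied to
the connection at `S + 1`, where it takes `t ^ (S + 1)` to powers starting at `t ^ S`, it yields a
second connection at `S`. By uniqueness of expansions the difference `P + t ^ S Q` vanishes, and the
constant terms of `P` and `Q` are the two relations. -/
lemma IsConn.succ {α β S X Y X' Y' : ℂ} (hS : ∀ m : ℤ, S ≠ m) (h : IsConn α β S X Y)
    (h' : IsConn α β (S + 1) X' Y') : X = -(X' * ((S + α) * (S + β))) ∧ Y = -Y' := by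
  have cf := convRad_gaussTerm α β (S + 1 + α + β)
  have cu := convRad_gaussTerm α β (1 - S)
  have cv := convRad_gaussTerm (α + S) (β + S) (1 + S)
  have cu' := convRad_gaussTerm α β (1 - (S + 1))
  have cv' := convRad_gaussTerm (α + (S + 1)) (β + (S + 1)) (1 + (S + 1))
  set f := gaussTerm α β (S + 1 + α + β) with hf
  set u := gaussTerm α β (1 - S) with hu
  set v := gaussTerm (α + S) (β + S) (1 + S) with hv
  set u' := gaussTerm α β (1 - (S + 1)) with hu'
  set v' := gaussTerm (α + (S + 1)) (β + (S + 1)) (1 + (S + 1)) with hv'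
  set γ := S + α + β with hγ
  have hfS : ∀ z : ℂ, ‖z‖ < 1 → PS (gaussTerm α β γ) z = γ * PS f z + z * PS (dcoeff f) z := by
    intro z hz
    have H := ((cf.hasSum hz).mul_left γ).add (ConvRad.hasSum_z (cf.dcoeff.hasSum hz))
    refine ((convRad_gaussTerm α β γ).hasSum hz).unique (H.congr_fun fun n => ?_)
    have e : gaussTerm α β γ n = (γ + n) * f n := by
      simp only [hf, gaussTerm]
      rw [inv_Gamma_eq γ n, show S + 1 + α + β + n = γ + 1 + n by rw [hγ]; ring]
      ring
    rw [e]
    rcases n with _ | n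
    · simp [zcoeff]
    · simp only [zcoeff, dcoeff]
      push_cast
      ring
  let P : ℕ → ℂ := fun n => γ * X' * u' n + (-X') * dcoeff u' n + (X' * zcoeff (dcoeff u') n
    + (-X) * u n)
  let Q : ℕ → ℂ := fun n => γ * Y' * zcoeff v' n + (-Y') * zcoeff (dcoeff v') n
    + ((-Y' * (S + 1)) * v' n + Y' * zcoeff (zcoeff (dcoeff v')) n)
    + ((Y' * (S + 1)) * zcoeff v' n + (-Y) * v n)
  have cP : ConvRad 1 P :=
    ((cu'.const_mul _).add (cu'.dcoeff.const_mul _)).add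
      ((cu'.dcoeff.zcoeff.const_mul _).add (cu.const_mul _))
  have cQ : ConvRad 1 Q :=
    (((cv'.zcoeff.const_mul _).add (cv'.dcoeff.zcoeff.const_mul _)).add
      ((cv'.const_mul _).add (cv'.dcoeff.zcoeff.zcoeff.const_mul _))).add
      ((cv'.zcoeff.const_mul _).add (cv.const_mul _))
  have hPQ : ∀ t ∈ lens 1, PS P t + t ^ S * PS Q t = 0 := by
    intro t ht
    obtain ⟨ht1, ht2⟩ := mem_lens.1 ht
    have hre := re_pos_of_norm_one_sub_lt ht2
    have ht0 : t ≠ 0 := by rintro rfl; simp at hre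
    have eP : PS P t = γ * X' * PS u' t + (-X') * PS (dcoeff u') t
        + (X' * (t * PS (dcoeff u') t) + (-X) * PS u t) := by
      refine (cP.hasSum ht1).unique (HasSum.congr_fun ((((cu'.hasSum ht1).mul_left _).add
        ((cu'.dcoeff.hasSum ht1).mul_left _)).add
        (((ConvRad.hasSum_z (cu'.dcoeff.hasSum ht1)).mul_left _).add
          ((cu.hasSum ht1).mul_left _))) fun n => ?_)
      simp only [P]
      ring
    have eQ : PS Q t = γ * Y' * (t * PS v' t) + (-Y') * (t * PS (dcoeff v') t)
        + ((-Y' * (S + 1)) * PS v' t + Y' * (t * (t * PS (dcoeff v') t)))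
        + ((Y' * (S + 1)) * (t * PS v' t) + (-Y) * PS v t) := by
      have z1 := ConvRad.hasSum_z (cv'.hasSum ht1)
      have z2 := ConvRad.hasSum_z (cv'.dcoeff.hasSum ht1)
      refine (cQ.hasSum ht1).unique (HasSum.congr_fun ((((z1.mul_left _).add (z2.mul_left _)).add
        (((cv'.hasSum ht1).mul_left _).add ((ConvRad.hasSum_z z2).mul_left _))).add
        ((z1.mul_left _).add ((cv.hasSum ht1).mul_left _))) fun n => ?_)
      simp only [Q]
      ring
    have e1 := h t ht
    have e2 := h' t ht
    have e3 := hfS (1 - t) ht2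
    have d1 := (isGaussSol_reflect α β (S + 1) t ht).1
    have d2 := (((isGaussSol_gaussTerm α β (1 - (S + 1))) t ht).1.const_mul X').add
      ((((isGaussSol_cpow α β (S + 1)) t ht).1).const_mul Y')
    have d3 := d1.unique (d2.congr_of_eventuallyEq (by
      filter_upwards [(isOpen_lens 1).mem_nhds ht] with x hx
      exact h' x hx))
    have e4 : t ^ (S + 1) = t ^ S * t := by
      rw [Complex.cpow_add _ _ ht0, Complex.cpow_one]
    simp only [← hf, ← hu', ← hv', e4] at d3 e2
    rw [e3] at e1
    rw [eP, eQ]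
    have d3' : -PS (dcoeff f) (1 - t) = X' * PS (dcoeff u') t
        + Y' * (t ^ S * (t * PS (dcoeff v') t + (S + 1) * PS v' t)) := by
      rw [d3]
      field_simp
    linear_combination (γ) * (-e2) - (1 - t) * (-d3') + e1
  obtain ⟨hP, hQ⟩ := coeff_eq_zero_of_add_cpow_mul_eq_zero one_pos hS cP cQ hPQ
  have P0 := congrFun hP 0
  have Q0 := congrFun hQ 0
  obtain ⟨n1, n2⟩ := inv_Gamma_one_add_ne_zero hS
  have hS1 : S + 1 ≠ 0 := fun h0 => hS (-1) (by push_cast; linear_combination h0)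
  have g1 : (Complex.Gamma (1 - (S + 1)))⁻¹ = -S * (Complex.Gamma (1 - S))⁻¹ := by
    rw [Complex.one_div_Gamma_eq_self_mul_one_div_Gamma_add_one (1 - (S + 1))]
    ring_nf
  have g2 : (Complex.Gamma (1 + S))⁻¹ = (1 + S) * (Complex.Gamma (1 + (S + 1)))⁻¹ := by
    rw [Complex.one_div_Gamma_eq_self_mul_one_div_Gamma_add_one (1 + S)]
    ring_nf
  have e1 : u' 1 = α * β * (Complex.Gamma (1 - S))⁻¹ := by
    simp only [hu', gaussTerm, poch_succ, poch_zero]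
    simp only [Nat.cast_zero, add_zero, one_mul, Nat.factorial_one, Nat.cast_one, div_one]
    ring_nf
  have g3 : (Complex.Gamma (1 + (S + 1)))⁻¹ ≠ 0 := fun h0 => n1 (by rw [g2, h0, mul_zero])
  simp only [P, zcoeff, dcoeff, Pi.zero_apply, Nat.cast_zero, zero_add, one_mul, mul_zero,
    e1] at P0
  simp only [hu', hu, gaussTerm_zero, g1] at P0
  simp only [Q, zcoeff, Pi.zero_apply, mul_zero, zero_add, add_zero] at Q0
  simp only [hv', hv, gaussTerm_zero, g2] at Q0
  constructor
  · refine mul_right_cancel₀ n2 ?_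
    rw [hγ] at P0
    linear_combination -P0
  · have hS1' : 1 + S ≠ 0 := by rwa [add_comm]
    refine mul_right_cancel₀ (mul_ne_zero hS1' g3) ?_
    linear_combination -Q0

lemma tendsto_PS_one_sub {d : ℕ → ℂ} (hd : Summable d) {t : ℕ → ℝ}
    (ht : Tendsto t atTop (𝓝 0)) (ht0 : ∀ n, 0 < t n) :
    Tendsto (fun n => PS d (1 - t n)) atTop (𝓝 (∑' k, d k)) := by
  refine tendsto_tsum_of_dominated_convergence hd.norm (fun k => ?_) ?_
  · have h1 : Tendsto (fun n => (1 : ℂ) - t n) atTop (𝓝 1) := by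
      have := ((Complex.continuous_ofReal.tendsto 0).comp ht).const_sub (1 : ℂ)
      simpa using this
    simpa using (h1.pow k).const_mul (d k)
  · filter_upwards [ht.eventually_lt_const one_pos] with n hn k
    rw [norm_mul, norm_pow]
    refine mul_le_of_le_one_right (norm_nonneg _) (pow_le_one₀ (norm_nonneg _) ?_)
    rw [← Complex.ofReal_one, ← Complex.ofReal_sub, Complex.norm_real, Real.norm_eq_abs, abs_le]
    constructor <;> linarith [ht0 n]

lemma tendsto_cpow_zero {a : ℂ} (ha : 0 < a.re) {t : ℕ → ℝ}
    (ht : Tendsto t atTop (𝓝 0)) (ht0 : ∀ n, 0 < t n) :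
    Tendsto (fun n => (t n : ℂ) ^ a) atTop (𝓝 0) := by
  rw [tendsto_zero_iff_norm_tendsto_zero]
  have := (Real.continuousAt_rpow_const 0 a.re (Or.inr ha.le)).tendsto.comp ht
  rw [Real.zero_rpow ha.ne'] at this
  refine this.congr fun n => ?_
  rw [Complex.norm_cpow_eq_rpow_re_of_pos (ht0 n)]
  rfl

/-- The connection coefficient of the analytic solution at `1`. -/
def connX (α β S : ℂ) : ℂ := Complex.Gamma S * Complex.Gamma (1 - S)
  * ((Complex.Gamma (S + α))⁻¹ * (Complex.Gamma (S + β))⁻¹)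

/-- The connection coefficient of the singular solution at `1`. -/
def connY (α β S : ℂ) : ℂ := Complex.Gamma (-S) * Complex.Gamma (1 + S)
  * ((Complex.Gamma α)⁻¹ * (Complex.Gamma β)⁻¹)

lemma tendsto_ofReal_PS {c : ℕ → ℂ} (hc : ConvRad 1 c) {t : ℕ → ℝ}
    (ht : Tendsto t atTop (𝓝 0)) : Tendsto (fun n => PS c (t n)) atTop (𝓝 (c 0)) := by
  have h := (hc.continuousAt (z := 0) (by simp)).tendsto
  rw [PS_zero] at h
  have h1 := (Complex.continuous_ofReal.tendsto 0).comp ht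
  rw [Complex.ofReal_zero] at h1
  exact h.comp h1

/-- As `t → 0+` the singular solution vanishes and the left side tends to Gauss's sum. -/
lemma IsConn.eq_of_re_pos {α β S X Y : ℂ} (hS : ∀ m : ℤ, S ≠ m) (h0 : 0 < S.re)
    (h : IsConn α β S X Y) : X = connX α β S := by
  obtain ⟨-, l2⟩ := tendsto_one_div_lens 1 one_pos
  have l1 := tendsto_one_div_add_atTop_nhds_zero_nat (𝕜 := ℝ)
  have lp : ∀ n : ℕ, 0 < 1 / ((n : ℝ) + 1) := fun n => by positivity
  have hg := hasSum_gaussTerm (α := α) (β := β) h0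
  rw [show α + β + S = S + α + β by ring] at hg
  have A := tendsto_PS_one_sub hg.summable l1 lp
  rw [hg.tsum_eq] at A
  have B := ((tendsto_ofReal_PS (convRad_gaussTerm α β (1 - S)) l1).const_mul X).add
    (((tendsto_cpow_zero h0 l1 lp).mul
      (tendsto_ofReal_PS (convRad_gaussTerm (α + S) (β + S) (1 + S)) l1)).const_mul Y)
  rw [zero_mul, mul_zero, add_zero, gaussTerm_zero] at B
  have e := tendsto_nhds_unique (A.congr' (by filter_upwards [l2] with n hn using h _ hn)) B
  obtain ⟨-, n2⟩ := inv_Gamma_one_add_ne_zero hS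
  refine mul_right_cancel₀ n2 ?_
  rw [← e, connX]
  have := inv_ne_zero n2
  rw [inv_inv] at this
  field_simp

/-- After multiplication by `t ^ (-S)` only the singular solution survives as `t → 0+`; on the left
the Abelian theorem applies, comparing with `(-S)_n / n!`. -/
lemma IsConn.eq_of_re_neg {α β S X Y : ℂ} (hS : ∀ m : ℤ, S ≠ m) (h0 : S.re < 0)
    (h : IsConn α β S X Y) : Y = connY α β S := by
  obtain ⟨-, l2⟩ := tendsto_one_div_lens 1 one_pos
  have l1 := tendsto_one_div_add_atTop_nhds_zero_nat (𝕜 := ℝ)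
  have lp : ∀ n : ℕ, 0 < 1 / ((n : ℝ) + 1) := fun n => by positivity
  have h0' : 0 < (-S).re := by simpa using h0
  have hpole : ∀ m : ℕ, -S ≠ -(m : ℂ) := by
    intro m hm
    exact hS m (by push_cast; exact neg_injective hm)
  have hG := Complex.Gamma_ne_zero hpole
  have hlim : Tendsto (fun n => gaussTerm α β (S + α + β) n / (poch (-S) n / (n ! : ℂ))) atTop
      (𝓝 (Complex.Gamma (-S) * ((Complex.Gamma α)⁻¹ * (Complex.Gamma β)⁻¹))) := by
    have := (tendsto_Gamma_quotient α β (S + α + β) (-S) (by ring)).const_mul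
      (Complex.Gamma (-S) * ((Complex.Gamma α)⁻¹ * (Complex.Gamma β)⁻¹))
    rw [mul_one] at this
    refine this.congr' ?_
    filter_upwards [poch_eventually_eq α, poch_eventually_eq β] with n h1 h2
    rw [gaussTerm, h1, h2, Gamma_add_nat hpole]
    field_simp [factorial_cast_ne_zero n, poch_ne_zero hpole n]
  have A := tendsto_cpow_mul_PS h0' hlim (convRad_gaussTerm α β (S + α + β)) l1 lp
  have B := (((tendsto_cpow_zero h0' l1 lp).mul
    (tendsto_ofReal_PS (convRad_gaussTerm α β (1 - S)) l1)).const_mul X).add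
    ((tendsto_ofReal_PS (convRad_gaussTerm (α + S) (β + S) (1 + S)) l1).const_mul Y)
  rw [zero_mul, mul_zero, zero_add, gaussTerm_zero] at B
  have e := tendsto_nhds_unique (A.congr' (by
    filter_upwards [l2] with n hn
    rw [h _ hn]
    have hx : ((1 / ((n : ℝ) + 1) : ℝ) : ℂ) ≠ 0 := by
      exact_mod_cast (lp n).ne'
    have e1 : ((1 / ((n : ℝ) + 1) : ℝ) : ℂ) ^ (-S) * ((1 / ((n : ℝ) + 1) : ℝ) : ℂ) ^ S = 1 := by
      rw [← Complex.cpow_add _ _ hx]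
      simp
    rw [mul_add, mul_left_comm _ X, mul_left_comm _ Y, ← mul_assoc (_ ^ (-S)) (_ ^ S), e1,
      one_mul])) B
  obtain ⟨n1, -⟩ := inv_Gamma_one_add_ne_zero hS
  refine mul_right_cancel₀ n1 ?_
  rw [← e, connY]
  have := inv_ne_zero n1
  rw [inv_inv] at this
  field_simp

/-- `IsConn.succ` carries `X` down from `Re S > 0` and `Y` up from `Re S < 0`. In these directions
it never requires a division. -/
theorem IsConn.eq {α β S X Y : ℂ} (hS : ∀ m : ℤ, S ≠ m) (h : IsConn α β S X Y) :
    X = connX α β S ∧ Y = connY α β S := by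
  constructor
  · obtain ⟨N, hN⟩ := exists_nat_gt (-S.re)
    replace hN : 0 < S.re + N := by linarith
    induction N generalizing S X Y with
    | zero => exact h.eq_of_re_pos hS (by simpa using hN)
    | succ N ih =>
      have hS' : ∀ m : ℤ, S + 1 ≠ m := fun m hm => hS (m - 1) (by
        push_cast; linear_combination hm)
      obtain ⟨X', Y', h'⟩ := exists_isConn α β hS'
      have e := ih hS' h' (by push_cast at hN; simp; linarith)
      rw [(h.succ hS h').1, e, connX, connX]
      have g1 : Complex.Gamma (S + 1) = S * Complex.Gamma S :=
        Complex.Gamma_add_one _ (by simpa using hS 0)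
      have g2 : Complex.Gamma (1 - S) = -S * Complex.Gamma (1 - (S + 1)) := by
        rw [show 1 - S = -S + 1 by ring, Complex.Gamma_add_one _ (by simpa using hS 0)]
        ring_nf
      have g3 := Complex.one_div_Gamma_eq_self_mul_one_div_Gamma_add_one (S + α)
      have g4 := Complex.one_div_Gamma_eq_self_mul_one_div_Gamma_add_one (S + β)
      rw [g1, g2, g3, g4, add_right_comm S 1 α, add_right_comm S 1 β]
      ring
  · obtain ⟨N, hN⟩ := exists_nat_gt S.re
    replace hN : S.re - N < 0 := by linarith
    induction N generalizing S X Y with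
    | zero => exact h.eq_of_re_neg hS (by simpa using hN)
    | succ N ih =>
      have hS' : ∀ m : ℤ, S - 1 ≠ m := fun m hm => hS (m + 1) (by
        push_cast; linear_combination hm)
      obtain ⟨X', Y', h'⟩ := exists_isConn α β hS'
      have e := ih hS' h' (by push_cast at hN; simp; linarith)
      have h1 : IsConn α β (S - 1 + 1) X Y := by rwa [sub_add_cancel]
      have e2 := (h'.succ hS' h1).2
      have e3 : Y = -Y' := by rw [e2, neg_neg]
      rw [e3, e, connY, connY]
      have g1 : Complex.Gamma (1 + S) = S * Complex.Gamma (1 + (S - 1)) := by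
        rw [add_comm, Complex.Gamma_add_one _ (by simpa using hS 0)]
        ring_nf
      have g2 : Complex.Gamma (-(S - 1)) = -S * Complex.Gamma (-S) := by
        rw [show -(S - 1) = -S + 1 by ring, Complex.Gamma_add_one _ (by simpa using hS 0)]
      rw [g1, g2]
      ring

/-- The connection formula for Gauss series. -/
theorem isConn (α β : ℂ) {S : ℂ} (hS : ∀ m : ℤ, S ≠ m) :
    IsConn α β S (connX α β S) (connY α β S) := by
  obtain ⟨X, Y, h⟩ := exists_isConn α β hS
  obtain ⟨rfl, rfl⟩ := h.eq hS
  exact h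

/-! ### The expansion at `1` in a small disc. -/

lemma Gamma_reflect_nat {S : ℂ} (hS : ∀ m : ℤ, S ≠ m) (m : ℕ) :
    Complex.Gamma S * Complex.Gamma (1 - S) * (Complex.Gamma (1 - S + m))⁻¹
      = (-1) ^ m * Complex.Gamma (S - m) := by
  induction m with
  | zero =>
    have := inv_ne_zero (inv_Gamma_one_add_ne_zero hS).2
    rw [inv_inv] at this
    simp
    field_simp
  | succ m ih =>
    have h1 : S - m - 1 ≠ 0 := fun h => hS (m + 1) (by push_cast; linear_combination h)
    have h2 : 1 - S + m ≠ 0 := fun h => h1 (by linear_combination -h)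
    have e1 : Complex.Gamma (S - m) = (S - m - 1) * Complex.Gamma (S - (m + 1 : ℕ)) := by
      have := Complex.Gamma_add_one _ h1
      rw [sub_add_cancel] at this
      rw [this]
      push_cast
      ring_nf
    have e2 := inv_Gamma_eq (1 - S) m
    have e3 : 1 - S + ((m + 1 : ℕ) : ℂ) = 1 - S + 1 + m := by push_cast; ring
    rw [e2, e1] at ih
    rw [e3]
    refine mul_left_cancel₀ h2 ?_
    rw [pow_succ]
    linear_combination ih

/-- A non-integral `s` has positive distance from the integers. The form `2|j| + 1` is the one used
in `factorial_mul_norm_Gamma_le`. -/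
lemma exists_le_norm_add_int {s : ℂ} (hs : ∀ m : ℤ, s ≠ m) :
    ∃ K : ℝ, 0 < K ∧ ∀ j : ℤ, 2 * |(j : ℝ)| + 1 ≤ K * ‖s + j‖ := by
  obtain ⟨d, hd, h⟩ : ∃ d : ℝ, 0 < d ∧ ∀ j : ℤ, d ≤ ‖s + j‖ := by
    by_cases him : s.im = 0
    · refine ⟨|s.re - round s.re|, abs_pos.2 fun h0 => hs (round s.re) ?_, fun j => ?_⟩
      · apply Complex.ext
        · simpa using sub_eq_zero.1 h0
        · simpa using him
      · have h1 := round_le s.re (-j)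
        have h2 := Complex.abs_re_le_norm (s + j)
        simp at h1 h2
        linarith
    · refine ⟨|s.im|, abs_pos.2 him, fun j => ?_⟩
      simpa using Complex.abs_im_le_norm (s + j)
  refine ⟨2 + (2 * ‖s‖ + 1) / d, by positivity, fun j => ?_⟩
  have h1 : |(j : ℝ)| ≤ ‖s + j‖ + ‖s‖ := by
    have := norm_sub_le (s + j) s
    simpa using this
  have h2 : (2 * ‖s‖ + 1) ≤ (2 * ‖s‖ + 1) / d * ‖s + j‖ := by
    rw [div_mul_eq_mul_div, le_div_iff₀ hd]
    exact mul_le_mul_of_nonneg_left (h j) (by positivity)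
  linarith

/-- A product of `m` consecutive points of `s + ℤ` is at least `m! / K ^ m` in modulus: among `m +
1` of them, the larger of `|j|` and `|j + m|` is at least `m / 2`, so the corresponding end factor
is at least `(m + 1) / K` and can be split off. The uniformity in `j` is needed for `Γ(s + k - m)`.
-/
lemma factorial_mul_norm_Gamma_le {s : ℂ} (hs : ∀ m : ℤ, s ≠ m) :
    ∃ K : ℝ, 0 < K ∧ ∀ (m : ℕ) (j : ℤ),
      (m ! : ℝ) * ‖Complex.Gamma (s + j)‖ ≤ K ^ m * ‖Complex.Gamma (s + j + m)‖ := by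
  obtain ⟨K, hK, h⟩ := exists_le_norm_add_int hs
  refine ⟨K, hK, fun m => ?_⟩
  induction m with
  | zero => intro j; simp
  | succ m ih =>
    intro j
    have hne : ∀ i : ℤ, s + i ≠ 0 := fun i hi => hs (-i) (by push_cast; linear_combination hi)
    have hm : (m : ℝ) ≤ |(j : ℝ)| + |((j + m : ℤ) : ℝ)| := by
      have := abs_sub ((j + m : ℤ) : ℝ) (j : ℝ)
      push_cast at this ⊢
      rw [add_sub_cancel_left, abs_of_nonneg m.cast_nonneg] at this
      linarith
    rw [Nat.factorial_succ, pow_succ]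
    push_cast
    rcases le_total |((j + m : ℤ) : ℝ)| |(j : ℝ)| with hc | hc
    · have h1 : (m : ℝ) + 1 ≤ K * ‖s + j‖ := by linarith [h j]
      have h2 := ih (j + 1)
      have e : s + ((j + 1 : ℤ) : ℂ) = s + j + 1 := by push_cast; ring
      rw [e, Complex.Gamma_add_one _ (hne j), norm_mul] at h2
      calc ((m : ℝ) + 1) * m ! * ‖Complex.Gamma (s + j)‖
          ≤ (K * ‖s + j‖) * m ! * ‖Complex.Gamma (s + j)‖ := by gcongr
        _ = K * ((m ! : ℝ) * (‖s + j‖ * ‖Complex.Gamma (s + j)‖)) := by ring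
        _ ≤ K * (K ^ m * ‖Complex.Gamma (s + j + 1 + m)‖) := by gcongr
        _ = _ := by
          rw [show s + j + (m + 1) = s + j + 1 + m by ring]
          ring
    · have h1 : (m : ℝ) + 1 ≤ K * ‖s + (j + m : ℤ)‖ := by linarith [h (j + m)]
      have h2 := ih j
      have e : s + ((j + m : ℤ) : ℂ) = s + j + m := by push_cast; ring
      have g := Complex.Gamma_add_one _ (hne (j + m))
      rw [e] at g h1
      rw [← add_assoc, g, norm_mul]
      calc ((m : ℝ) + 1) * m ! * ‖Complex.Gamma (s + j)‖
          = ((m : ℝ) + 1) * (m ! * ‖Complex.Gamma (s + j)‖) := by ring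
        _ ≤ (K * ‖s + j + m‖) * (K ^ m * ‖Complex.Gamma (s + j + m)‖) := by gcongr
        _ = _ := by ring

/-- The coefficients of the part of the expansion at `1` that is analytic, before summation. -/
def analyticTerm (p : ℕ) (a b : ℕ → ℂ) (k m : ℕ) : ℂ :=
  coeffA p a b k * (Complex.Gamma (a 1 + m) * Complex.Gamma (a 2 + m) / (m ! : ℂ)
    * ((-1) ^ m * Complex.Gamma (excess p a b + k - m))
    * ((Complex.Gamma (a 1 + excess p a b + k))⁻¹ * (Complex.Gamma (a 2 + excess p a b + k))⁻¹))

/-- The coefficients of the singular part of the expansion at `1`, before summation. -/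
def singularTerm (p : ℕ) (a b : ℕ → ℂ) (k m : ℕ) : ℂ :=
  coeffA p a b k * (Complex.Gamma (a 1 + excess p a b + (k + m : ℕ))
      * Complex.Gamma (a 2 + excess p a b + (k + m : ℕ)) / (m ! : ℂ)
    * ((-1) ^ m * Complex.Gamma (-excess p a b - (k + m : ℕ)))
    * ((Complex.Gamma (a 1 + excess p a b + k))⁻¹ * (Complex.Gamma (a 2 + excess p a b + k))⁻¹))

section

variable {p : ℕ} {a b : ℕ → ℂ}

/-- The loss `K ^ m` is harmless in a small disc; what matters is that the decay in `k` stays `k ^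
(-1 - δ)` for every `m`. -/
lemma norm_analyticTerm_le (hp : 2 ≤ p) {δ : ℝ} (h : ∀ j ∈ Icc 3 (p + 1), δ < (a j).re)
    (hs : ∀ m : ℤ, excess p a b ≠ m) : ∃ C K r : ℝ, 0 < C ∧ 0 < K ∧ ∀ k m,
      ‖analyticTerm p a b k m‖ ≤ C * wt (-1 - δ) k * (wt r m * K ^ m) := by
  set s := excess p a b with hsd
  obtain ⟨C1, hC1, b1⟩ := isBigO_wt_iff.1 (isSymbol_coeffA hp (b := b) h).isBigO
  obtain ⟨C2, hC2, b2⟩ := norm_Gamma_add_nat_le (a 1)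
  obtain ⟨C3, hC3, b3⟩ := norm_Gamma_add_nat_le (a 2)
  obtain ⟨C4, hC4, b4⟩ := norm_inv_Gamma_add_nat_le (a 1 + s)
  obtain ⟨C5, hC5, b5⟩ := norm_inv_Gamma_add_nat_le (a 2 + s)
  obtain ⟨C6, hC6, b6⟩ := norm_Gamma_add_nat_le s
  obtain ⟨K, hK, b7⟩ := factorial_mul_norm_Gamma_le hs
  refine ⟨C1 * C2 * C3 * C4 * C5 * C6, K, ((a 1).re - 1) + ((a 2).re - 1), by positivity, hK,
    fun k m => ?_⟩
  have b1' : ‖coeffA p a b k‖ ≤ C1 * wt ((s + a 1 + a 2).re - δ - 2) k * k ! := by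
    have := b1 k
    rwa [norm_div, Complex.norm_natCast, div_le_iff₀ (by positivity)] at this
  have b7' : ‖Complex.Gamma (s + k - m)‖ ≤ K ^ m * (C6 * (wt (s.re - 1) k * k !)) / m ! := by
    rw [le_div_iff₀ (by positivity), mul_comm]
    have := b7 m (k - m)
    rw [show s + ((k - m : ℤ) : ℂ) + m = s + k by push_cast; ring,
      show s + ((k - m : ℤ) : ℂ) = s + k - m by push_cast; ring] at this
    exact this.trans (mul_le_mul_of_nonneg_left (b6 k) (by positivity))
  have w1 := wt_pos ((s + a 1 + a 2).re - δ - 2) k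
  have w2 := wt_pos ((a 1).re - 1) m
  have w3 := wt_pos ((a 2).re - 1) m
  have w4 := wt_pos (1 - (a 1 + s).re) k
  have w5 := wt_pos (1 - (a 2 + s).re) k
  have w6 := wt_pos (s.re - 1) k
  simp only [analyticTerm, norm_mul, norm_div, Complex.norm_natCast, norm_pow, norm_neg,
    norm_one, one_pow, one_mul, ← hsd]
  calc _ ≤ (C1 * wt ((s + a 1 + a 2).re - δ - 2) k * k !)
        * ((C2 * (wt ((a 1).re - 1) m * m !)) * (C3 * (wt ((a 2).re - 1) m * m !)) / m !
          * (K ^ m * (C6 * (wt (s.re - 1) k * k !)) / m !)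
          * ((C4 * (wt (1 - (a 1 + s).re) k / k !)) * (C5 * (wt (1 - (a 2 + s).re) k / k !)))) := by
        gcongr
        exacts [b2 m, b3 m, b4 k, b5 k]
    _ = _ := by
        rw [show (-1 - δ : ℝ) = ((s + a 1 + a 2).re - δ - 2) + (1 - (a 1 + s).re)
          + (1 - (a 2 + s).re) + (s.re - 1) by simp; ring, wt_add, wt_add, wt_add, wt_add]
        field_simp

lemma norm_singularTerm_le (hp : 2 ≤ p) {δ : ℝ} (h : ∀ j ∈ Icc 3 (p + 1), δ < (a j).re)
    (hs : ∀ m : ℤ, excess p a b ≠ m) : ∃ C K r r' : ℝ, 0 < C ∧ 0 < K ∧ ∀ k m,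
      ‖singularTerm p a b k m‖ ≤ C * (wt r k * K ^ k) * (wt r' m * K ^ m) := by
  set s := excess p a b with hsd
  have hs' : ∀ m : ℤ, -s ≠ m := fun m hm => hs (-m) (by push_cast; linear_combination -hm)
  obtain ⟨C1, hC1, b1⟩ := isBigO_wt_iff.1 (isSymbol_coeffA hp (b := b) h).isBigO
  obtain ⟨C2, hC2, b2⟩ := norm_Gamma_add_nat_le (a 1 + s)
  obtain ⟨C3, hC3, b3⟩ := norm_Gamma_add_nat_le (a 2 + s)
  obtain ⟨C4, hC4, b4⟩ := norm_inv_Gamma_add_nat_le (a 1 + s)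
  obtain ⟨C5, hC5, b5⟩ := norm_inv_Gamma_add_nat_le (a 2 + s)
  obtain ⟨K, hK, b7⟩ := factorial_mul_norm_Gamma_le hs'
  set x := (a 1 + s).re - 1
  set y := (a 2 + s).re - 1
  -- The factor `2` bounds the binomial coefficient of `k + m` over `k`. Geometric growth in `k` is
  -- allowed, since this term comes with `t ^ (k + m)`.
  refine ⟨C1 * C2 * C3 * C4 * C5 * (‖Complex.Gamma (-s)‖ + 1), 2 * K,
    ((s + a 1 + a 2).re - δ - 2) + (1 - (a 1 + s).re) + (1 - (a 2 + s).re) + x + y, |x| + |y|,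
    by positivity, by positivity, fun k m => ?_⟩
  have b1' : ‖coeffA p a b k‖ ≤ C1 * wt ((s + a 1 + a 2).re - δ - 2) k * k ! := by
    have := b1 k
    rwa [norm_div, Complex.norm_natCast, div_le_iff₀ (by positivity)] at this
  have b7' : ‖Complex.Gamma (-s - (k + m : ℕ))‖
      ≤ K ^ (k + m) * (‖Complex.Gamma (-s)‖ + 1) / (k + m)! := by
    rw [le_div_iff₀ (by positivity), mul_comm]
    have := b7 (k + m) (-(k + m : ℕ))
    rw [show -s + ((-(k + m : ℕ) : ℤ) : ℂ) + (k + m : ℕ) = -s by push_cast; ring,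
      show -s + ((-(k + m : ℕ) : ℤ) : ℂ) = -s - (k + m : ℕ) by push_cast; ring] at this
    exact this.trans (mul_le_mul_of_nonneg_left (by linarith) (by positivity))
  have w1 := wt_pos ((s + a 1 + a 2).re - δ - 2) k
  have w2 := wt_pos x (k + m)
  have w3 := wt_pos y (k + m)
  have w2' := wt_pos |x| m
  have w4 := wt_pos (1 - (a 1 + s).re) k
  have w5 := wt_pos (1 - (a 2 + s).re) k
  have w6 := wt_pos |y| m
  have w7 := wt_pos x k
  have w8 := wt_pos y k
  have e1 : wt x (k + m) ≤ wt |x| m * wt x k := by rw [add_comm]; exact wt_add_le _ _ _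
  have e2 : wt y (k + m) ≤ wt |y| m * wt y k := by rw [add_comm]; exact wt_add_le _ _ _
  have e3 : ((k + m)! : ℝ) ≤ 2 ^ k * 2 ^ m * (k ! * m !) := by
    have h1 := Nat.add_choose_mul_factorial_mul_factorial k m
    have h2 : (k + m).choose k ≤ 2 ^ (k + m) := Nat.choose_le_two_pow _ _
    rw [pow_add] at h2
    have h3 : (k + m).choose m = (k + m).choose k := by
      rw [← Nat.choose_symm_add]
    rw [h3] at h1
    rw [← h1]
    push_cast
    rw [mul_assoc]
    have h4 : ((k + m).choose k : ℝ) ≤ 2 ^ k * 2 ^ m := by exact_mod_cast h2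
    gcongr
  simp only [singularTerm, norm_mul, norm_div, Complex.norm_natCast, norm_pow, norm_neg,
    norm_one, one_pow, one_mul, ← hsd]
  calc _ ≤ (C1 * wt ((s + a 1 + a 2).re - δ - 2) k * k !)
        * ((C2 * (wt x (k + m) * (k + m)!)) * (C3 * (wt y (k + m) * (k + m)!)) / m !
          * (K ^ (k + m) * (‖Complex.Gamma (-s)‖ + 1) / (k + m)!)
          * ((C4 * (wt (1 - (a 1 + s).re) k / k !)) * (C5 * (wt (1 - (a 2 + s).re) k / k !)))) := by
        gcongr
        exacts [b2 (k + m), b3 (k + m), b4 k, b5 k]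
    _ = C1 * C2 * C3 * C4 * C5 * (‖Complex.Gamma (-s)‖ + 1)
        * (wt ((s + a 1 + a 2).re - δ - 2) k * wt (1 - (a 1 + s).re) k * wt (1 - (a 2 + s).re) k)
        * K ^ (k + m) * (wt x (k + m) * wt y (k + m) * ((k + m)! / (k ! * m !))) := by
        field_simp
    _ ≤ C1 * C2 * C3 * C4 * C5 * (‖Complex.Gamma (-s)‖ + 1)
        * (wt ((s + a 1 + a 2).re - δ - 2) k * wt (1 - (a 1 + s).re) k * wt (1 - (a 2 + s).re) k)
        * K ^ (k + m) * ((wt |x| m * wt x k) * (wt |y| m * wt y k) * (2 ^ k * 2 ^ m)) := by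
        gcongr
        rwa [div_le_iff₀ (by positivity)]
    _ = _ := by
        rw [wt_add, wt_add, wt_add, wt_add, wt_add, mul_pow, mul_pow, pow_add]
        ring

lemma analyticTerm_eq (hs : ∀ m : ℤ, excess p a b ≠ m)
    (h1 : ∀ m : ℕ, a 1 + excess p a b ≠ -(m : ℂ))
    (h2 : ∀ m : ℕ, a 2 + excess p a b ≠ -(m : ℂ)) (k m : ℕ) :
    analyticTerm p a b k m = (-1) ^ m
      * (Complex.Gamma (a 1 + 0 + m) * Complex.Gamma (a 2 + 0 + m)
        * Complex.Gamma (excess p a b - 2 * 0 - m))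
      / (Complex.Gamma (a 1 + excess p a b) * Complex.Gamma (a 2 + excess p a b) * (m ! : ℂ))
      * gTerm p a b m 0 k := by
  have h3 : ∀ i : ℕ, excess p a b - m ≠ -(i : ℂ) := fun i hi =>
    hs (m - i) (by push_cast; linear_combination hi)
  unfold analyticTerm gTerm
  rw [Gamma_add_nat h1, Gamma_add_nat h2, add_sub_right_comm, Gamma_add_nat h3]
  simp only [add_zero, mul_zero, sub_zero]
  field_simp [Complex.Gamma_ne_zero h1, Complex.Gamma_ne_zero h2, poch_ne_zero h1 k,
    poch_ne_zero h2 k]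

lemma tsum_analyticTerm (hs : ∀ m : ℤ, excess p a b ≠ m)
    (h1 : ∀ m : ℕ, a 1 + excess p a b ≠ -(m : ℂ))
    (h2 : ∀ m : ℕ, a 2 + excess p a b ≠ -(m : ℂ)) (m : ℕ) :
    ∑' k, analyticTerm p a b k m = gCoeff p a b m 0 := by
  simp only [analyticTerm_eq hs h1 h2]
  rw [tsum_mul_left, gCoeff]

lemma gTerm_excess_eq_zero {n k : ℕ} (h : n < k) : gTerm p a b n (excess p a b) k = 0 := by
  rw [gTerm, sub_self, zero_sub, poch_neg_eq_zero h]
  simp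

lemma sum_singularTerm (h1 : ∀ m : ℕ, a 1 + excess p a b ≠ -(m : ℂ))
    (h2 : ∀ m : ℕ, a 2 + excess p a b ≠ -(m : ℂ)) (n : ℕ) :
    ∑ q ∈ antidiagonal n, singularTerm p a b q.1 q.2 = gCoeff p a b n (excess p a b) := by
  rw [gCoeff, tsum_eq_sum (s := range (n + 1)) (fun k hk => gTerm_excess_eq_zero (by
    simpa using hk)), Finset.Nat.sum_antidiagonal_eq_sum_range_succ_mk, mul_sum]
  refine sum_congr rfl fun k hk => ?_
  obtain ⟨m, rfl⟩ := Nat.exists_eq_add_of_le (Nat.lt_succ_iff.1 (mem_range.1 hk))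
  have e := poch_reflect 1 m k
  rw [poch_one, poch_one, add_comm m k, sub_self, zero_sub] at e
  simp only [add_tsub_cancel_left, singularTerm, gTerm]
  rw [Gamma_add_nat h1 k, Gamma_add_nat h2 k, sub_self, zero_sub,
    show excess p a b - 2 * excess p a b = -excess p a b by ring, pow_add]
  have n1 := factorial_cast_ne_zero (k + m)
  rw [e] at n1 ⊢
  have n2 := factorial_cast_ne_zero m
  have n3 : poch (-((k + m : ℕ) : ℂ)) k ≠ 0 := fun h0 => n1 (by rw [h0]; simp)
  have n4 : (-1 : ℂ) ^ k ≠ 0 := by simp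
  field_simp [Complex.Gamma_ne_zero h1, Complex.Gamma_ne_zero h2, poch_ne_zero h1 k,
    poch_ne_zero h2 k]

lemma gaussReg_eq_PS (α β c z : ℂ) : gaussReg α β c z = PS (gaussTerm α β c) z :=
  gaussReg_eq_tsum α β c z

/-- The connection formula with `S = s + k`: the analytic part keeps the exponents `m`, while `t ^
S` moves the singular part to `t ^ s t ^ (k + m)`. -/
lemma gaussReg_one_sub (hp : 2 ≤ p) (ha : ∀ j ∈ Icc 1 (p + 1), ∀ m : ℕ, a j ≠ -(m : ℂ))
    (hs : ∀ m : ℤ, excess p a b ≠ m)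
    (h1 : ∀ m : ℕ, a 1 + excess p a b ≠ -(m : ℂ))
    (h2 : ∀ m : ℕ, a 2 + excess p a b ≠ -(m : ℂ)) {t : ℂ} (ht : t ∈ lens 1) (k : ℕ) :
    coeffA p a b k * (Complex.Gamma (a 1) * Complex.Gamma (a 2) *
        gaussReg (a 1) (a 2) (excess p a b + a 1 + a 2 + k) (1 - t))
      = ∑' m, analyticTerm p a b k m * t ^ m
        + t ^ excess p a b * ∑' m, singularTerm p a b k m * t ^ (k + m) := by
  set s := excess p a b with hsd
  have hS : ∀ m : ℤ, s + k ≠ m := fun m hm => hs (m - k) (by push_cast; linear_combination hm)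
  have hS' : ∀ m : ℤ, -(s + k) ≠ m := fun m hm => hS (-m) (by push_cast; linear_combination -hm)
  have ht0 : t ≠ 0 := by
    rintro rfl
    simpa using re_pos_of_norm_one_sub_lt (mem_lens.1 ht).2
  have ha1 := ha 1 (by simp)
  have ha2 := ha 2 (by simp; omega)
  have n1 := Complex.Gamma_ne_zero ha1
  have n2 := Complex.Gamma_ne_zero ha2
  rw [gaussReg_eq_PS, show s + a 1 + a 2 + k = s + k + a 1 + a 2 by ring, isConn _ _ hS t ht,
    Complex.cpow_add _ _ ht0, Complex.cpow_natCast]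
  have e1 : ∀ m, analyticTerm p a b k m * t ^ m
      = coeffA p a b k * (Complex.Gamma (a 1) * Complex.Gamma (a 2)) * connX (a 1) (a 2) (s + k)
        * (gaussTerm (a 1) (a 2) (1 - (s + k)) m * t ^ m) := by
    intro m
    have g := Gamma_reflect_nat hS m
    simp only [analyticTerm, connX, gaussTerm, ← hsd]
    rw [← g, Gamma_add_nat ha1, Gamma_add_nat ha2, show s + k + a 1 = a 1 + s + k by ring,
      show s + k + a 2 = a 2 + s + k by ring]
    ring
  have e2 : ∀ m, singularTerm p a b k m * t ^ (k + m)
      = coeffA p a b k * (Complex.Gamma (a 1) * Complex.Gamma (a 2)) * connY (a 1) (a 2) (s + k)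
        * t ^ k * (gaussTerm (a 1 + (s + k)) (a 2 + (s + k)) (1 + (s + k)) m * t ^ m) := by
    intro m
    have g := Gamma_reflect_nat hS' m
    have p1 : ∀ i : ℕ, a 1 + (s + k) ≠ -(i : ℂ) := fun i hi =>
      h1 (k + i) (by push_cast; linear_combination hi)
    have p2 : ∀ i : ℕ, a 2 + (s + k) ≠ -(i : ℂ) := fun i hi =>
      h2 (k + i) (by push_cast; linear_combination hi)
    simp only [singularTerm, connY, gaussTerm, ← hsd]
    rw [show -s - ((k + m : ℕ) : ℂ) = -(s + k) - m by push_cast; ring, ← g,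
      show a 1 + s + ((k + m : ℕ) : ℂ) = a 1 + (s + k) + m by push_cast; ring,
      show a 2 + s + ((k + m : ℕ) : ℂ) = a 2 + (s + k) + m by push_cast; ring,
      Gamma_add_nat p1, Gamma_add_nat p2, add_assoc (a 1), add_assoc (a 2), sub_neg_eq_add,
      pow_add]
    have := Complex.Gamma_ne_zero p1
    have := Complex.Gamma_ne_zero p2
    field_simp
  simp only [e1, e2, tsum_mul_left, PS]
  ring

/-- The expansion at `1` in a small disc. -/
theorem exists_expansion (hp : 2 ≤ p)
    (ha : ∀ j ∈ Icc 1 (p + 1), ∀ m : ℕ, a j ≠ -(m : ℂ))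
    (hb : ∀ j ∈ Icc 1 p, ∀ m : ℕ, b j ≠ -(m : ℂ))
    (h : ∀ j ∈ Icc 3 (p + 1), 0 < (a j).re)
    (hs : ∀ m : ℤ, excess p a b ≠ m)
    (h1 : ∀ m : ℕ, a 1 + excess p a b ≠ -(m : ℂ))
    (h2 : ∀ m : ℕ, a 2 + excess p a b ≠ -(m : ℂ)) :
    ∃ R : ℝ, 0 < R ∧ R ≤ 1 ∧ ConvRad R (fun n => gCoeff p a b n 0) ∧
      ConvRad R (fun n => gCoeff p a b n (excess p a b)) ∧
      ∀ t ∈ lens R, gammaFactor p a b * hypF p a b (1 - t)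
        = PS (fun n => gCoeff p a b n 0) t
          + t ^ excess p a b * PS (fun n => gCoeff p a b n (excess p a b)) t := by
  obtain ⟨δ, h0, hδ⟩ := exists_between_re h
  obtain ⟨C, K, r, hC, hK, bA⟩ := norm_analyticTerm_le hp hδ hs
  obtain ⟨C', K', r1, r2, hC', hK', bS⟩ := norm_singularTerm_le hp hδ hs
  set R := min 1 (min K⁻¹ K'⁻¹) with hR
  have hR1 : R ≤ 1 := min_le_left _ _
  have lt_one : ∀ t : ℂ, ‖t‖ < R → K * ‖t‖ < 1 ∧ K' * ‖t‖ < 1 := by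
    intro t ht
    have e1 : ‖t‖ < K⁻¹ := ht.trans_le ((min_le_right _ _).trans (min_le_left _ _))
    have e2 : ‖t‖ < K'⁻¹ := ht.trans_le ((min_le_right _ _).trans (min_le_right _ _))
    exact ⟨by rwa [mul_comm, ← lt_div_iff₀ hK, one_div],
      by rwa [mul_comm, ← lt_div_iff₀ hK', one_div]⟩
  have sA : ∀ t : ℂ, ‖t‖ < R → Summable fun q : ℕ × ℕ => analyticTerm p a b q.1 q.2 * t ^ q.2 := by
    intro t ht
    have q1 := (summable_wt (r := -1 - δ) (by linarith)).mul_left C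
    have q2 := summable_wt_mul_pow r (x := K * ‖t‖) (by positivity) (lt_one t ht).1
    have q3 := q1.mul_of_nonneg q2 (fun k => by have := wt_pos (-1 - δ) k; positivity)
      (fun m => by have := wt_pos r m; positivity)
    refine Summable.of_norm_bounded q3 fun q => ?_
    rw [norm_mul, norm_pow, mul_pow, ← mul_assoc (wt _ _), ← mul_assoc (_ * _)]
    exact mul_le_mul_of_nonneg_right (bA q.1 q.2) (by positivity)
  have sS : ∀ t : ℂ, ‖t‖ < R →
      Summable fun q : ℕ × ℕ => singularTerm p a b q.1 q.2 * t ^ (q.1 + q.2) := by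
    intro t ht
    have q1 := (summable_wt_mul_pow r1 (x := K' * ‖t‖) (by positivity) (lt_one t ht).2).mul_left C'
    have q2 := summable_wt_mul_pow r2 (x := K' * ‖t‖) (by positivity) (lt_one t ht).2
    have q3 := q1.mul_of_nonneg q2 (fun k => by have := wt_pos r1 k; positivity)
      (fun m => by have := wt_pos r2 m; positivity)
    refine Summable.of_norm_bounded q3 fun q => ?_
    rw [norm_mul, norm_pow, mul_pow, mul_pow, pow_add]
    calc _ ≤ _ := mul_le_mul_of_nonneg_right (bS q.1 q.2) (by positivity)
      _ = _ := by ring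
  -- For each `m`, summing the analytic part over `k` gives `g_m(0)`; in `hSg` the singular part is
  -- collected along `k + m = n`.
  have hA : ∀ t : ℂ, ‖t‖ < R → HasSum (fun m => gCoeff p a b m 0 * t ^ m)
      (∑' q : ℕ × ℕ, analyticTerm p a b q.1 q.2 * t ^ q.2) := by
    intro t ht
    have e := (sA t ht).prod_symm
    have := e.hasSum.prod_fiberwise fun m => (e.prod_factor m).hasSum
    simp only [Prod.fst_swap, Prod.snd_swap, tsum_mul_right, tsum_analyticTerm hs h1 h2] at this
    convert this using 1
    exact ((Equiv.prodComm ℕ ℕ).tsum_eq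
      (fun q : ℕ × ℕ => analyticTerm p a b q.1 q.2 * t ^ q.2)).symm
  have hSg : ∀ t : ℂ, ‖t‖ < R → HasSum (fun n => gCoeff p a b n (excess p a b) * t ^ n)
      (∑' q : ℕ × ℕ, singularTerm p a b q.1 q.2 * t ^ (q.1 + q.2)) := by
    intro t ht
    refine (hasSum_antidiagonal (sS t ht).hasSum).congr_fun fun n => ?_
    rw [← sum_singularTerm h1 h2, sum_mul]
    refine sum_congr rfl fun q hq => ?_
    rw [mem_antidiagonal.1 hq]
  refine ⟨R, by positivity, hR1, fun t ht => (hA t ht).summable, fun t ht => (hSg t ht).summable,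
    fun t ht => ?_⟩
  obtain ⟨ht1, ht2⟩ := mem_lens.1 ht
  have key := hasSum_gauss_expansion hp ha hb h ht2
  simp only [gaussReg_one_sub hp ha hs h1 h2 (mem_lens.2 ⟨ht1.trans_le hR1, ht2⟩)] at key
  refine key.unique ?_
  rw [PS, PS, (hA t ht1).tsum_eq, (hSg t ht1).tsum_eq]
  exact ((sA t ht1).hasSum.prod_fiberwise fun k => ((sA t ht1).prod_factor k).hasSum).add
    (((sS t ht1).hasSum.prod_fiberwise fun k => ((sS t ht1).prod_factor k).hasSum).mul_left _)

end

/-! ### The differential equation and convergence in the unit disc. -/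

/-- The effect of the Euler operator in `1 - t` on the coefficients of `t ^ σ ∑ y_n t ^ n`,
if `σ y_0 = 0`. -/
def eulerCoeff (σ : ℂ) (y : ℕ → ℂ) (n : ℕ) : ℂ := (n + σ) * y n - (n + 1 + σ) * y (n + 1)

lemma ConvRad.shift {R : ℝ} {y : ℕ → ℂ} (h : ConvRad R y) : ConvRad R (fun n => y (n + 1)) := by
  intro z hz
  rcases eq_or_ne z 0 with rfl | h0
  · refine summable_of_ne_finset_zero (s := {0}) fun n hn => ?_
    simp at hn
    simp [hn]
  · refine (((summable_nat_add_iff 1).2 (h z hz)).mul_left z⁻¹).congr fun n => ?_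
    rw [pow_succ]
    field_simp

lemma eulerCoeff_eq {σ : ℂ} {y : ℕ → ℂ} (h0 : σ * y 0 = 0) (n : ℕ) :
    eulerCoeff σ y n = zcoeff (fun n => (n + 1 + σ) * y (n + 1)) n
      + -1 * ((n + 1 + σ) * y (n + 1)) := by
  cases n with
  | zero => simp [eulerCoeff, zcoeff, h0]
  | succ n => simp [eulerCoeff, zcoeff]; ring

lemma ConvRad.mul_add {R : ℝ} {y : ℕ → ℂ} (h : ConvRad R y) (σ : ℂ) :
    ConvRad R (fun n => (n + 1 + σ) * y (n + 1)) := by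
  convert h.dcoeff.add (h.shift.const_mul σ) using 2
  simp only [_root_.dcoeff]
  ring

lemma PS_mul_add {R : ℝ} {y : ℕ → ℂ} (h : ConvRad R y) (σ : ℂ) {t : ℂ} (ht : ‖t‖ < R) :
    PS (fun n => (n + 1 + σ) * y (n + 1)) t
      = PS (dcoeff y) t + σ * PS (fun n => y (n + 1)) t := by
  refine ((h.mul_add σ).hasSum ht).unique ?_
  refine ((h.dcoeff.hasSum ht).add ((h.shift.hasSum ht).mul_left σ)).congr_fun fun n => ?_
  simp only [_root_.dcoeff]
  ring

lemma ConvRad.eulerCoeff {R : ℝ} {y : ℕ → ℂ} (h : ConvRad R y) {σ : ℂ} (h0 : σ * y 0 = 0) :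
    ConvRad R (eulerCoeff σ y) := by
  rw [show _root_.eulerCoeff σ y = _ from funext (eulerCoeff_eq h0)]
  exact (h.mul_add σ).zcoeff.add ((h.mul_add σ).const_mul _)

lemma PS_eulerCoeff {R : ℝ} {y : ℕ → ℂ} (h : ConvRad R y) {σ : ℂ} (h0 : σ * y 0 = 0) {t : ℂ}
    (ht : ‖t‖ < R) : PS (eulerCoeff σ y) t
      = -(1 - t) * (PS (dcoeff y) t + σ * PS (fun n => y (n + 1)) t) := by
  rw [← PS_mul_add h σ ht]
  have h1 := (h.mul_add σ).hasSum ht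
  refine ((h.eulerCoeff h0).hasSum ht).unique ?_
  rw [show -(1 - t) * PS (fun n => (n + 1 + σ) * y (n + 1)) t
    = t * PS (fun n => (n + 1 + σ) * y (n + 1)) t
      + -1 * PS (fun n => (n + 1 + σ) * y (n + 1)) t by ring]
  refine ((ConvRad.hasSum_z h1).add (h1.mul_left (-1))).congr_fun fun n => ?_
  rw [eulerCoeff_eq h0]
  ring

lemma PS_eq_mul_shift {R : ℝ} {y : ℕ → ℂ} (h : ConvRad R y) (h0 : y 0 = 0) {t : ℂ}
    (ht : ‖t‖ < R) : PS y t = t * PS (fun n => y (n + 1)) t := by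
  refine (h.hasSum ht).unique ?_
  refine (ConvRad.hasSum_z (h.shift.hasSum ht)).congr_fun fun n => ?_
  cases n with
  | zero => simp [h0, zcoeff]
  | succ n => rfl

lemma ne_zero_of_mem_lens {R : ℝ} {t : ℂ} (ht : t ∈ lens R) : t ≠ 0 := by
  rintro rfl
  simpa using re_pos_of_norm_one_sub_lt (mem_lens.1 ht).2

lemma mem_slitPlane_of_mem_lens {R : ℝ} {t : ℂ} (ht : t ∈ lens R) : t ∈ Complex.slitPlane :=
  Or.inl (re_pos_of_norm_one_sub_lt (mem_lens.1 ht).2)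

/-- `f` is the sum of a power series and of `t ^ ρ` times a power series on a lens. -/
def HasExpansion (R : ℝ) (f : ℂ → ℂ) (ρ : ℂ) (c y : ℕ → ℂ) : Prop :=
  ConvRad R c ∧ ConvRad R y ∧ ∀ t ∈ lens R, f t = PS c t + t ^ ρ * PS y t

/-- With `z = 1 - t` the Euler operator `z d/dz` is `-(1 - t) d/dt`. The condition `y 0 = 0`
prevents the exponent from dropping to `ρ - 1`. -/
lemma HasExpansion.euler {R : ℝ} {f f' : ℂ → ℂ} {ρ : ℂ} {c y : ℕ → ℂ}
    (h : HasExpansion R f ρ c y) (h0 : y 0 = 0) (hf : ∀ t ∈ lens R, HasDerivAt f (f' t) t) :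
    HasExpansion R (fun t => -(1 - t) * f' t) ρ (eulerCoeff 0 c) (eulerCoeff ρ y) := by
  obtain ⟨hc, hy, e⟩ := h
  have h0' : ρ * y 0 = 0 := by rw [h0, mul_zero]
  have h0c : (0 : ℂ) * c 0 = 0 := zero_mul _
  refine ⟨hc.eulerCoeff h0c, hy.eulerCoeff h0', fun t ht => ?_⟩
  have ht1 := (mem_lens.1 ht).1
  have ht0 := ne_zero_of_mem_lens ht
  have d1 := (hc.hasDerivAt ht1).add (((hasDerivAt_id t).cpow_const (c := ρ)
    (mem_slitPlane_of_mem_lens ht)).mul (hy.hasDerivAt ht1))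
  have d2 := (hf t ht).congr_of_eventuallyEq (f₁ := fun t => PS c t + t ^ ρ * PS y t)
    (by filter_upwards [(isOpen_lens R).mem_nhds ht] with u hu using (e u hu).symm)
  change -(1 - t) * f' t = _
  rw [d2.unique d1, PS_eulerCoeff hc h0c ht1, PS_eulerCoeff hy h0' ht1,
    PS_eq_mul_shift hy h0 ht1]
  have e1 : (id t : ℂ) ^ ρ = t * t ^ (ρ - 1) := by
    rw [Complex.cpow_sub _ _ ht0, Complex.cpow_one, id]
    field_simp
  have e2 : t ^ ρ = t * t ^ (ρ - 1) := e1
  rw [e1, e2, id]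
  ring

lemma PS_pow_succ {e : ℕ → ℂ} (he : ConvRad 1 e) {z : ℂ} (hz : ‖z‖ < 1) :
    z * PS (dcoeff e) z = PS (fun n => n * e n) z ∧ ConvRad 1 (fun n => (n : ℂ) * e n) := by
  have hz' : zcoeff (dcoeff e) = fun n : ℕ => (n : ℂ) * e n := by
    funext n
    cases n <;> simp [zcoeff, dcoeff]
  have h2 := he.dcoeff.zcoeff
  rw [hz'] at h2
  refine ⟨?_, h2⟩
  have h1 := ConvRad.hasSum_z (he.dcoeff.hasSum hz)
  rw [hz'] at h1
  exact h1.unique (h2.hasSum hz)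

lemma convRad_pow_mul {e : ℕ → ℂ} (he : ConvRad 1 e) (j : ℕ) :
    ConvRad 1 (fun n => (n : ℂ) ^ j * e n) := by
  induction j with
  | zero => simpa using he
  | succ j ih =>
    have := (PS_pow_succ ih (z := 0) (by simp)).2
    convert this using 2
    ring

/-- Each application uses up one leading zero of the singular part, so `N` zeros permit `N`
applications. -/
lemma HasExpansion.euler_iterate {R : ℝ} {ρ : ℂ} {c y e : ℕ → ℂ} (he : ConvRad 1 e)
    (h : HasExpansion R (fun t => PS e (1 - t)) ρ c y) {N : ℕ} (h0 : ∀ n < N, y n = 0) (j : ℕ)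
    (hj : j ≤ N) :
    HasExpansion R (fun t => PS (fun n => (n : ℂ) ^ j * e n) (1 - t)) ρ ((eulerCoeff 0)^[j] c)
      ((eulerCoeff ρ)^[j] y) ∧ ∀ n, n + j < N → (eulerCoeff ρ)^[j] y n = 0 := by
  induction j with
  | zero => simpa using ⟨h, h0⟩
  | succ j ih =>
    obtain ⟨i1, i2⟩ := ih (by omega)
    have hej := convRad_pow_mul he j
    constructor
    · rw [Function.iterate_succ_apply', Function.iterate_succ_apply']
      have := i1.euler (i2 0 (by omega))
        (f' := fun t => -PS (dcoeff (fun n => (n : ℂ) ^ j * e n)) (1 - t)) (fun t ht => by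
          have d := (hej.hasDerivAt (mem_lens.1 ht).2).comp t ((hasDerivAt_id t).const_sub 1)
          exact d.congr_deriv (by simp))
      refine ⟨this.1, this.2.1, fun t ht => ?_⟩
      rw [← this.2.2 t ht]
      change _ = -(1 - t) * -PS (dcoeff fun n => (n : ℂ) ^ j * e n) (1 - t)
      rw [neg_mul_neg, (PS_pow_succ hej (mem_lens.1 ht).2).1]
      refine tsum_congr fun n => ?_
      ring
    · intro n hn
      rw [Function.iterate_succ_apply', eulerCoeff, i2 n (by omega), i2 (n + 1) (by omega)]
      simp

/-- Since `α N = β N = 1`, the relation expresses the `N`-th Euler iterate through the lower ones.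
For `S n`, the sum of the moduli of the lower iterates at `n`, this gives `(n - K) S (n + 1) ≤ (n +
K) S n`, a growth ratio with limit at most `1`. -/
lemma convRad_one_of_relation {N : ℕ} (hN : 0 < N) {σ : ℂ} {y α β : ℕ → ℂ} (hα : α N = 1)
    (hβ : β N = 1) (h : ∀ n, ∑ j ∈ range (N + 1), ((β j - α j) * (eulerCoeff σ)^[j] y (n + 1)
      + α j * (eulerCoeff σ)^[j] y n) = 0) : ConvRad 1 y := by
  set Y : ℕ → ℕ → ℂ := fun j => (eulerCoeff σ)^[j] y with hY
  have hrec : ∀ j n, Y (j + 1) n = (n + σ) * Y j n - (n + 1 + σ) * Y j (n + 1) := by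
    intro j n
    simp only [hY]
    rw [Function.iterate_succ_apply', eulerCoeff]
  set S : ℕ → ℝ := fun n => ∑ j ∈ range N, ‖Y j n‖ with hS
  set M : ℝ := ∑ j ∈ range N, (‖β j - α j‖ + ‖α j‖) with hM
  have hM0 : 0 ≤ M := sum_nonneg fun _ _ => by positivity
  have hS0 : ∀ n, 0 ≤ S n := fun n => sum_nonneg fun _ _ => norm_nonneg _
  have hle : ∀ j ∈ range N, ∀ n, ‖Y j n‖ ≤ S n := fun j hj n =>
    single_le_sum (f := fun j => ‖Y j n‖) (fun _ _ => norm_nonneg _) hj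
  have htop : ∀ n, ‖Y N n‖ ≤ M * (S (n + 1) + S n) := by
    intro n
    have h1 := h n
    rw [sum_range_succ, hα, hβ, sub_self, zero_mul, zero_add, one_mul] at h1
    rw [show Y N n = _ from eq_neg_of_add_eq_zero_right h1, norm_neg, hM, sum_mul]
    refine norm_sum_le_of_le _ fun j hj => (norm_add_le _ _).trans ?_
    rw [norm_mul, norm_mul]
    have a1 := mul_le_mul_of_nonneg_left (hle j hj (n + 1)) (norm_nonneg (β j - α j))
    have a2 := mul_le_mul_of_nonneg_left (hle j hj n) (norm_nonneg (α j))
    have a3 := mul_nonneg (norm_nonneg (β j - α j)) (hS0 n)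
    have a4 := mul_nonneg (norm_nonneg (α j)) (hS0 (n + 1))
    change ‖β j - α j‖ * ‖Y j (n + 1)‖ + ‖α j‖ * ‖Y j n‖ ≤ _
    linarith
  have hstep : ∀ n : ℕ, ‖(n : ℂ) + 1 + σ‖ * S (n + 1)
      ≤ ‖(n : ℂ) + σ‖ * S n + (S n + M * (S (n + 1) + S n)) := by
    intro n
    have h1 : ∑ j ∈ range N, ‖Y (j + 1) n‖ ≤ S n + ‖Y N n‖ := by
      have e1 := sum_range_succ (fun j => ‖Y j n‖) N
      rw [sum_range_succ'] at e1
      have := norm_nonneg (Y 0 n)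
      simp only [hS]
      linarith
    have h2 : ‖(n : ℂ) + 1 + σ‖ * S (n + 1)
        ≤ ‖(n : ℂ) + σ‖ * S n + ∑ j ∈ range N, ‖Y (j + 1) n‖ := by
      simp only [hS]
      rw [mul_sum, mul_sum, ← sum_add_distrib]
      refine sum_le_sum fun j _ => ?_
      rw [← norm_mul, ← norm_mul]
      have : ((n : ℂ) + 1 + σ) * Y j (n + 1) = (n + σ) * Y j n - Y (j + 1) n := by
        rw [hrec]; ring
      rw [this]
      exact norm_sub_le _ _
    linarith [htop n]
  intro z hz
  set K : ℝ := ‖σ‖ + 1 + M with hK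
  have hK2 : ∀ n : ℕ, ((n : ℝ) - K) * S (n + 1) ≤ (n + K) * S n := by
    intro n
    have n1 : (n : ℝ) + 1 - ‖σ‖ ≤ ‖(n : ℂ) + 1 + σ‖ := by
      have := norm_sub_le ((n : ℂ) + 1 + σ) σ
      rw [add_sub_cancel_right, ← Nat.cast_succ, Complex.norm_natCast] at this
      push_cast at this
      linarith
    have n2 : ‖(n : ℂ) + σ‖ ≤ n + ‖σ‖ := by
      have := norm_add_le (n : ℂ) σ
      rwa [Complex.norm_natCast] at this
    have a1 := mul_le_mul_of_nonneg_right n1 (hS0 (n + 1))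
    have a2 := mul_le_mul_of_nonneg_right n2 (hS0 n)
    have := hstep n
    have := hS0 n
    have := hS0 (n + 1)
    rw [hK]
    nlinarith
  have hsum : Summable fun n => S n * ‖z‖ ^ n := by
    have hl : (1 + ‖z‖) / 2 < 1 := by linarith
    refine summable_of_ratio_norm_eventually_le hl ?_
    -- From `n > 4K / (1 - ‖z‖)` follows `(n + K) ‖z‖ ≤ (n - K) (1 + ‖z‖) / 2`, which is `k3`.
    obtain ⟨n0, hn0⟩ := exists_nat_gt (max K (4 * K / (1 - ‖z‖)))
    filter_upwards [eventually_ge_atTop n0] with n hn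
    have hn1 : max K (4 * K / (1 - ‖z‖)) < n := hn0.trans_le (by exact_mod_cast hn)
    have k1 : 0 < (n : ℝ) - K := sub_pos.2 ((le_max_left _ _).trans_lt hn1)
    have k2 : 4 * K < n * (1 - ‖z‖) :=
      (div_lt_iff₀ (by linarith)).1 ((le_max_right _ _).trans_lt hn1)
    have z0 := norm_nonneg z
    have hKp : 0 ≤ K := by positivity
    rw [Real.norm_of_nonneg (mul_nonneg (hS0 _) (by positivity)),
      Real.norm_of_nonneg (mul_nonneg (hS0 _) (by positivity)), pow_succ]
    have k3 : ((n : ℝ) + K) * ‖z‖ ≤ (1 + ‖z‖) / 2 * (n - K) := by nlinarith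
    have k4 : S (n + 1) * ‖z‖ ≤ (1 + ‖z‖) / 2 * S n := by
      refine le_of_mul_le_mul_left ?_ k1
      calc ((n : ℝ) - K) * (S (n + 1) * ‖z‖) = (n - K) * S (n + 1) * ‖z‖ := by ring
        _ ≤ (n + K) * S n * ‖z‖ := mul_le_mul_of_nonneg_right (hK2 n) z0
        _ = (n + K) * ‖z‖ * S n := by ring
        _ ≤ (1 + ‖z‖) / 2 * (n - K) * S n := mul_le_mul_of_nonneg_right k3 (hS0 n)
        _ = _ := by ring
    calc S (n + 1) * (‖z‖ ^ n * ‖z‖) = S (n + 1) * ‖z‖ * ‖z‖ ^ n := by ring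
      _ ≤ (1 + ‖z‖) / 2 * S n * ‖z‖ ^ n := mul_le_mul_of_nonneg_right k4 (by positivity)
      _ = _ := by ring
  refine Summable.of_norm_bounded hsum fun n => ?_
  rw [norm_mul, norm_pow]
  exact mul_le_mul_of_nonneg_right (hle 0 (mem_range.2 hN) n) (by positivity)

/-- The hypergeometric equation `P(θ) f = z Q(θ) f` with `θ = z d/dz`, read off from the recurrence;
`P(0) = 0` settles the constant term. -/
lemma PS_poly_relation {e : ℕ → ℂ} (he : ConvRad 1 e) {N : ℕ} {P Q : Polynomial ℂ}
    (hP : P.natDegree ≤ N) (hQ : Q.natDegree ≤ N) (hP0 : P.eval 0 = 0)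
    (hrec : ∀ n : ℕ, P.eval ((n : ℂ) + 1) * e (n + 1) = Q.eval (n : ℂ) * e n) {z : ℂ}
    (hz : ‖z‖ < 1) : ∑ j ∈ range (N + 1), (P.coeff j - z * Q.coeff j)
      * PS (fun n => (n : ℂ) ^ j * e n) z = 0 := by
  have key : ∀ A : Polynomial ℂ, A.natDegree ≤ N → HasSum (fun n : ℕ => A.eval (n : ℂ) * e n * z ^ n)
      (∑ j ∈ range (N + 1), A.coeff j * PS (fun n => (n : ℂ) ^ j * e n) z) := by
    intro A hA
    refine (hasSum_sum fun j _ =>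
      ((convRad_pow_mul he j).hasSum hz).mul_left (A.coeff j)).congr_fun fun n => ?_
    rw [Polynomial.eval_eq_sum_range' (Nat.lt_succ_of_le hA), sum_mul, sum_mul]
    exact sum_congr rfl fun j _ => by ring
  have h1 := key P hP
  have h2 := ConvRad.hasSum_z (key Q hQ)
  have e1 : ∀ n : ℕ, P.eval (n : ℂ) * e n = zcoeff (fun n : ℕ => Q.eval (n : ℂ) * e n) n := by
    intro n
    cases n with
    | zero => simp [zcoeff, hP0]
    | succ n => simp [zcoeff, ← hrec n]
  simp only [e1] at h1
  have h3 := h1.unique h2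
  simp only [sub_mul, sum_sub_distrib]
  rw [h3, mul_sum]
  simp only [mul_assoc, sub_self]

lemma zcoeff_iterate_eq_zero (g : ℕ → ℂ) (N n : ℕ) (h : n < N) : zcoeff^[N] g n = 0 := by
  induction N generalizing n with
  | zero => omega
  | succ N ih =>
    rw [Function.iterate_succ_apply']
    cases n with
    | zero => rfl
    | succ n => exact ih n (by omega)

lemma convRad_zcoeff_iterate {R : ℝ} {g : ℕ → ℂ} (N : ℕ) :
    ConvRad R (zcoeff^[N] g) ↔ ConvRad R g := by
  induction N with
  | zero => rfl
  | succ N ih =>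
    rw [Function.iterate_succ_apply', ← ih]
    exact ⟨fun h => h.shift, fun h => h.zcoeff⟩

lemma PS_zcoeff_iterate {R : ℝ} {g : ℕ → ℂ} (hg : ConvRad R g) (N : ℕ) {t : ℂ} (ht : ‖t‖ < R) :
    PS (zcoeff^[N] g) t = t ^ N * PS g t := by
  induction N with
  | zero => simp
  | succ N ih =>
    have h := (convRad_zcoeff_iterate N).2 hg
    rw [Function.iterate_succ_apply', pow_succ', mul_assoc, ← ih]
    exact (h.zcoeff.hasSum ht).unique (ConvRad.hasSum_z (h.hasSum ht))

/-- If the coefficients of a power series satisfy a hypergeometric recurrence, then its expansion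
at `1` converges in the unit disc. -/
theorem HasExpansion.convRad_one {R : ℝ} (hR : 0 < R) {s : ℂ} (hs : ∀ m : ℤ, s ≠ m)
    {c g e : ℕ → ℂ} (he : ConvRad 1 e) (h : HasExpansion R (fun t => PS e (1 - t)) s c g) {N : ℕ}
    (hN : 0 < N) {P Q : Polynomial ℂ} (hP : P.Monic) (hQ : Q.Monic) (hPN : P.natDegree = N)
    (hQN : Q.natDegree = N) (hP0 : P.eval 0 = 0)
    (hrec : ∀ n : ℕ, P.eval ((n : ℂ) + 1) * e (n + 1) = Q.eval (n : ℂ) * e n) :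
    ConvRad 1 c ∧ ConvRad 1 g := by
  obtain ⟨hc, hg, hexp⟩ := h
  -- Writing `t ^ s g` as `t ^ (s - N)` times `t ^ N g` creates the `N` leading zeros needed to
  -- apply the Euler operator `N` times.
  set ρ : ℂ := s - N
  have hρ : ∀ m : ℤ, ρ ≠ m := fun m hm => hs (m + N) (by push_cast; linear_combination hm)
  have h' : HasExpansion R (fun t => PS e (1 - t)) ρ c (zcoeff^[N] g) := by
    refine ⟨hc, (convRad_zcoeff_iterate N).2 hg, fun t ht => ?_⟩
    have ht0 := ne_zero_of_mem_lens ht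
    rw [hexp t ht, PS_zcoeff_iterate hg N (mem_lens.1 ht).1, Complex.cpow_sub _ _ ht0,
      Complex.cpow_natCast]
    field_simp
  set y := zcoeff^[N] g
  have H := fun j hj => h'.euler_iterate he (zcoeff_iterate_eq_zero g N) j hj
  set cj : ℕ → ℕ → ℂ := fun j => (eulerCoeff 0)^[j] c with hcj
  set yj : ℕ → ℕ → ℂ := fun j => (eulerCoeff ρ)^[j] y with hyj
  have hH : ∀ j ∈ range (N + 1),
      HasExpansion R (fun t => PS (fun n => (n : ℂ) ^ j * e n) (1 - t)) ρ (cj j) (yj j) :=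
    fun j hj => (H j (Nat.lt_succ_iff.1 (mem_range.1 hj))).1
  -- The coefficients of the equation in `t`: `P_j - (1 - t) Q_j = (P_j - Q_j) + t Q_j`. By
  -- uniqueness they vanish separately for the analytic and the singular part.
  let comb : (ℕ → ℕ → ℂ) → ℕ → ℂ := fun u n =>
    ∑ j ∈ range (N + 1), ((P.coeff j - Q.coeff j) * u j n + Q.coeff j * zcoeff (u j) n)
  have hcomb : ∀ u : ℕ → ℕ → ℂ, (∀ j ∈ range (N + 1), ConvRad R (u j)) → ∀ t : ℂ, ‖t‖ < R →
      HasSum (fun n => comb u n * t ^ n)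
        (∑ j ∈ range (N + 1), (P.coeff j - (1 - t) * Q.coeff j) * PS (u j) t) := by
    intro u hu t ht
    have h1 := hasSum_sum fun j (hj : j ∈ range (N + 1)) =>
      (((hu j hj).hasSum ht).mul_left (P.coeff j - Q.coeff j)).add
        ((ConvRad.hasSum_z ((hu j hj).hasSum ht)).mul_left (Q.coeff j))
    rw [show ∑ j ∈ range (N + 1), (P.coeff j - (1 - t) * Q.coeff j) * PS (u j) t = _ from
      sum_congr rfl fun j _ => show _ = (P.coeff j - Q.coeff j) * PS (u j) t
        + Q.coeff j * (t * PS (u j) t) by ring]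
    refine h1.congr_fun fun n => ?_
    simp only [comb, sum_mul]
    exact sum_congr rfl fun j _ => by ring
  have hc' := hcomb cj fun j hj => (hH j hj).1
  have hy' := hcomb yj fun j hj => (hH j hj).2.1
  obtain ⟨z1, z2⟩ := coeff_eq_zero_of_add_cpow_mul_eq_zero hR hρ
    (fun t ht => (hc' t ht).summable) (fun t ht => (hy' t ht).summable) (fun t ht => by
      obtain ⟨ht1, ht2⟩ := mem_lens.1 ht
      rw [PS, PS, (hc' t ht1).tsum_eq, (hy' t ht1).tsum_eq,
        ← PS_poly_relation he hPN.le hQN.le hP0 hrec ht2, mul_sum, ← sum_add_distrib]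
      refine sum_congr rfl fun j hj => ?_
      have := (hH j hj).2.2 t ht
      simp only at this
      rw [this]
      ring)
  have lP : P.coeff N = 1 := by rw [← hPN]; exact hP
  have lQ : Q.coeff N = 1 := by rw [← hQN]; exact hQ
  refine ⟨convRad_one_of_relation hN lQ lP fun n => congrFun z1 (n + 1), ?_⟩
  rw [← convRad_zcoeff_iterate N]
  exact convRad_one_of_relation hN lQ lP fun n => congrFun z2 (n + 1)

lemma HasExpansion.extend {R R' : ℝ} (hR : 0 < R) (hRR : R ≤ R') {f : ℂ → ℂ}
    (hf : DifferentiableOn ℂ f (lens R')) {s : ℂ} {c g : ℕ → ℂ} (h : HasExpansion R f s c g)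
    (hc : ConvRad R' c) (hg : ConvRad R' g) : HasExpansion R' f s c g := by
  refine ⟨hc, hg, ?_⟩
  have d2 : DifferentiableOn ℂ (fun t => PS c t + t ^ s * PS g t) (lens R') := by
    intro t ht
    have ht1 := (mem_lens.1 ht).1
    exact ((hc.hasDerivAt ht1).add (((hasDerivAt_id t).cpow_const (c := s)
      (mem_slitPlane_of_mem_lens ht)).mul
        (hg.hasDerivAt ht1))).differentiableAt.differentiableWithinAt
  have hx : 0 < min R 1 / 2 := by positivity
  have hx1 : min R 1 / 2 < R := by linarith [min_le_left R 1]
  have hx2 : min R 1 / 2 < 2 := by linarith [min_le_right R 1]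
  exact (hf.analyticOnNhd (isOpen_lens R')).eqOn_of_preconnected_of_eventuallyEq
    (d2.analyticOnNhd (isOpen_lens R')) (convex_lens R').isPreconnected
    (ofReal_mem_lens hx hx2 (hx1.trans_le hRR))
    (by
      filter_upwards [(isOpen_lens R).mem_nhds (ofReal_mem_lens hx hx2 hx1)] with t ht
      exact h.2.2 t ht)

/-! ### Radius one for `Φ`, and removal of the conditions on real parts. -/

/-- The coefficients of the hypergeometric series multiplied by `gammaFactor`. -/
def phiCoeff (p : ℕ) (a b : ℕ → ℂ) (n : ℕ) : ℂ :=
  (∏ j ∈ Icc 1 (p + 1), Complex.Gamma (a j + n))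
    * (∏ j ∈ Icc 1 p, (Complex.Gamma (b j + n))⁻¹) / (n ! : ℂ)

section

variable {p : ℕ} {a b : ℕ → ℂ}

lemma gammaFactor_mul_hypF (ha : ∀ j ∈ Icc 1 (p + 1), ∀ m : ℕ, a j ≠ -(m : ℂ))
    (hb : ∀ j ∈ Icc 1 p, ∀ m : ℕ, b j ≠ -(m : ℂ)) (z : ℂ) :
    gammaFactor p a b * hypF p a b z = PS (phiCoeff p a b) z := by
  rw [hypF, ← tsum_mul_left]
  exact tsum_congr fun n => gammaFactor_mul_hypTerm ha hb z n

/-- A product of Gamma quotients; the resulting polynomial bound makes the power series of `Φ`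
converge in the unit disc. -/
lemma exists_isSymbol_phiCoeff (p : ℕ) (a b : ℕ → ℂ) : ∃ r, IsSymbol r (phiCoeff p a b) := by
  induction p with
  | zero =>
    refine ⟨_, (isSymbol_Gamma_div (a 1) 1).congr (Eventually.of_forall fun n => ?_)⟩
    simp [phiCoeff, Gamma_nat_eq]
  | succ p ih =>
    obtain ⟨r, hr⟩ := ih
    refine ⟨_, (hr.mul (isSymbol_Gamma_div (a (p + 2)) (b (p + 1)))).congr
      (Eventually.of_forall fun n => ?_)⟩
    simp only [phiCoeff]
    rw [prod_Icc_succ_top (by omega : 1 ≤ p + 1 + 1), prod_Icc_succ_top (f := fun j => (Complex.Gamma (b j + n))⁻¹) (by omega : 1 ≤ p + 1)]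
    ring

lemma convRad_phiCoeff (p : ℕ) (a b : ℕ → ℂ) : ConvRad 1 (phiCoeff p a b) := by
  obtain ⟨r, hr⟩ := exists_isSymbol_phiCoeff p a b
  obtain ⟨C, -, h⟩ := isBigO_wt_iff.1 hr.isBigO
  exact ConvRad.of_norm_le h

lemma dcoeff_phiCoeff (p : ℕ) (a b : ℕ → ℂ) :
    dcoeff (phiCoeff p a b) = phiCoeff p (fun j => a j + 1) (fun j => b j + 1) := by
  funext n
  have e : ∀ x : ℂ, x + ((n + 1 : ℕ) : ℂ) = x + 1 + n := fun x => by push_cast; ring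
  simp only [dcoeff, phiCoeff, e, Nat.factorial_succ]
  push_cast
  have h1 := factorial_cast_ne_zero n
  have h2 : (n : ℂ) + 1 ≠ 0 := by exact_mod_cast n.succ_ne_zero
  field_simp

/-- The polynomial of the numerator parameters. -/
def numPoly (p : ℕ) (a : ℕ → ℂ) : Polynomial ℂ :=
  ∏ j ∈ Icc 1 (p + 1), (Polynomial.X + Polynomial.C (a j))

/-- The polynomial of the denominator parameters. -/
def denPoly (p : ℕ) (b : ℕ → ℂ) : Polynomial ℂ :=
  Polynomial.X * ∏ j ∈ Icc 1 p, (Polynomial.X + Polynomial.C (b j - 1))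

lemma monic_prod_X_add_C (s : Finset ℕ) (f : ℕ → ℂ) :
    (∏ j ∈ s, (Polynomial.X + Polynomial.C (f j))).Monic ∧
      (∏ j ∈ s, (Polynomial.X + Polynomial.C (f j))).natDegree = #s := by
  refine ⟨Polynomial.monic_prod_of_monic _ _ fun j _ => Polynomial.monic_X_add_C _, ?_⟩
  rw [Polynomial.natDegree_prod_of_monic _ _ fun j _ => Polynomial.monic_X_add_C _]
  simp

lemma phiCoeff_rec (ha : ∀ j ∈ Icc 1 (p + 1), ∀ m : ℕ, a j ≠ -(m : ℂ)) (n : ℕ) :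
    (denPoly p b).eval ((n : ℂ) + 1) * phiCoeff p a b (n + 1)
      = (numPoly p a).eval (n : ℂ) * phiCoeff p a b n := by
  have e1 : ∀ j ∈ Icc 1 (p + 1), Complex.Gamma (a j + ((n + 1 : ℕ) : ℂ))
      = (n + a j) * Complex.Gamma (a j + n) := by
    intro j hj
    have h : a j + n ≠ 0 := fun h => ha j hj n (eq_neg_of_add_eq_zero_left h)
    rw [Nat.cast_succ, ← add_assoc, Complex.Gamma_add_one _ h, add_comm (n : ℂ)]
  have e2 : ∀ j ∈ Icc 1 p, (Complex.Gamma (b j + n))⁻¹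
      = (n + b j) * (Complex.Gamma (b j + ((n + 1 : ℕ) : ℂ)))⁻¹ := by
    intro j _
    rw [inv_Gamma_eq]
    push_cast
    ring_nf
  have e3 : ∏ j ∈ Icc 1 p, ((n : ℂ) + 1 + (b j - 1)) = ∏ j ∈ Icc 1 p, ((n : ℂ) + b j) :=
    prod_congr rfl fun j _ => by ring
  simp only [denPoly, numPoly, phiCoeff, Polynomial.eval_mul, Polynomial.eval_X,
    Polynomial.eval_prod, Polynomial.eval_add, Polynomial.eval_C]
  rw [e3, prod_congr rfl e1, prod_congr rfl e2, prod_mul_distrib, prod_mul_distrib,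
    Nat.factorial_succ]
  push_cast
  have h1 := factorial_cast_ne_zero n
  have h2 : (n : ℂ) + 1 ≠ 0 := by exact_mod_cast n.succ_ne_zero
  field_simp

lemma HasExpansion.convRad_one_phiCoeff {R : ℝ} (hR : 0 < R)
    (ha : ∀ j ∈ Icc 1 (p + 1), ∀ m : ℕ, a j ≠ -(m : ℂ)) {s : ℂ} (hs : ∀ m : ℤ, s ≠ m)
    {c g : ℕ → ℂ} (h : HasExpansion R (fun t => PS (phiCoeff p a b) (1 - t)) s c g) :
    ConvRad 1 c ∧ ConvRad 1 g := by
  obtain ⟨hQ, hQN⟩ := monic_prod_X_add_C (Icc 1 (p + 1)) a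
  obtain ⟨hP, hPN⟩ := monic_prod_X_add_C (Icc 1 p) (fun j => b j - 1)
  refine h.convRad_one hR hs (convRad_phiCoeff p a b) (N := p + 1) (by omega)
    (P := denPoly p b) (Q := numPoly p a) (Polynomial.monic_X.mul hP) hQ ?_ ?_ ?_
    (phiCoeff_rec ha)
  · rw [denPoly, Polynomial.monic_X.natDegree_mul hP, hPN]
    simp [add_comm]
  · rw [numPoly, hQN]
    simp
  · simp [denPoly]

lemma hasDerivAt_PS_one_sub {e : ℕ → ℂ} (he : ConvRad 1 e) {t : ℂ} (ht : ‖1 - t‖ < 1) :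
    HasDerivAt (fun t => PS e (1 - t)) (-PS (dcoeff e) (1 - t)) t :=
  ((he.hasDerivAt ht).comp t ((hasDerivAt_id t).const_sub 1)).congr_deriv (by simp)

lemma hasExpansion_one_of_re_pos (hp : 2 ≤ p)
    (ha : ∀ j ∈ Icc 1 (p + 1), ∀ m : ℕ, a j ≠ -(m : ℂ))
    (hb : ∀ j ∈ Icc 1 p, ∀ m : ℕ, b j ≠ -(m : ℂ))
    (h : ∀ j ∈ Icc 3 (p + 1), 0 < (a j).re)
    (hs : ∀ m : ℤ, excess p a b ≠ m)
    (h1 : ∀ m : ℕ, a 1 + excess p a b ≠ -(m : ℂ))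
    (h2 : ∀ m : ℕ, a 2 + excess p a b ≠ -(m : ℂ)) :
    HasExpansion 1 (fun t => PS (phiCoeff p a b) (1 - t)) (excess p a b)
      (fun n => gCoeff p a b n 0) (fun n => gCoeff p a b n (excess p a b)) := by
  obtain ⟨R, hR, hR1, e1, e2, e3⟩ := exists_expansion hp ha hb h hs h1 h2
  have H : HasExpansion R (fun t => PS (phiCoeff p a b) (1 - t)) (excess p a b)
      (fun n => gCoeff p a b n 0) (fun n => gCoeff p a b n (excess p a b)) :=
    ⟨e1, e2, fun t ht => by rw [← e3 t ht, gammaFactor_mul_hypF ha hb]⟩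
  obtain ⟨c1, c2⟩ := H.convRad_one_phiCoeff hR ha hs
  exact H.extend hR hR1 (fun t ht => (hasDerivAt_PS_one_sub (convRad_phiCoeff p a b)
    (mem_lens.1 ht).2).differentiableAt.differentiableWithinAt) c1 c2

lemma excess_shift (p : ℕ) (a b : ℕ → ℂ) :
    excess p (fun j => a j + 1) (fun j => b j + 1) = excess p a b - 1 := by
  simp [excess, sum_add_distrib]
  ring

lemma gCoeff_zero_shift (p : ℕ) (a b : ℕ → ℂ) (n : ℕ) :
    gCoeff p (fun j => a j + 1) (fun j => b j + 1) n 0 = -((n + 1) * gCoeff p a b (n + 1) 0) := by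
  simp only [gCoeff, gTerm, excess_shift, coeffA_shift]
  have e : ∀ x : ℂ, x + 1 + (excess p a b - 1) = x + excess p a b := fun x => by ring
  have e' : ∀ x : ℂ, x + 1 + 0 + n = x + 0 + (n + 1) := fun x => by ring
  have e1 : excess p a b - 1 - 2 * 0 - n = excess p a b - 2 * 0 - (n + 1) := by ring
  have e2 : excess p a b - 1 - 0 - n = excess p a b - 0 - (n + 1) := by ring
  simp only [e, e', e1, e2, Nat.factorial_succ, pow_succ]
  push_cast
  have h1 := factorial_cast_ne_zero n
  have h2 : (n : ℂ) + 1 ≠ 0 := by exact_mod_cast n.succ_ne_zero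
  field_simp

lemma gCoeff_excess_shift (hs : ∀ m : ℤ, excess p a b ≠ m) (n : ℕ) :
    gCoeff p (fun j => a j + 1) (fun j => b j + 1) n (excess p a b - 1)
      = -((n + excess p a b) * gCoeff p a b n (excess p a b)) := by
  simp only [gCoeff, gTerm, excess_shift, coeffA_shift]
  have e : ∀ x : ℂ, x + 1 + (excess p a b - 1) = x + excess p a b := fun x => by ring
  have e1 : excess p a b - 1 - 2 * (excess p a b - 1) - n
      = excess p a b - 2 * excess p a b - n + 1 := by ring
  have e2 : excess p a b - 2 * excess p a b - n ≠ 0 := fun h =>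
    hs (-n) (by push_cast; linear_combination -h)
  simp only [e, e1, sub_self]
  rw [Complex.Gamma_add_one _ e2]
  ring

lemma exists_antideriv {c' : ℕ → ℂ} (hc : ConvRad 1 c') (κ : ℂ) : ∃ c : ℕ → ℂ,
    ConvRad 1 c ∧ c 0 = κ ∧ dcoeff c = c' := by
  refine ⟨fun n => Nat.casesOn n κ fun n => c' n / (n + 1), fun z hz => ?_, rfl, ?_⟩
  · rw [← summable_nat_add_iff 1]
    refine Summable.of_norm_bounded ((hc z hz).norm.mul_left ‖z‖) fun n => ?_
    have h : (1 : ℝ) ≤ ‖(n : ℂ) + 1‖ := by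
      rw [← Nat.cast_succ, Complex.norm_natCast]
      push_cast
      linarith [n.cast_nonneg (α := ℝ)]
    simp only [norm_mul, norm_div, norm_pow, pow_succ]
    have := div_le_self (norm_nonneg (c' n)) h
    calc _ ≤ ‖c' n‖ * (‖z‖ ^ n * ‖z‖) := by gcongr
      _ = _ := by ring
  · funext n
    have h2 : (n : ℂ) + 1 ≠ 0 := by exact_mod_cast n.succ_ne_zero
    simp only [dcoeff]
    field_simp

lemma PS_add_const {c : ℕ → ℂ} (hc : ConvRad 1 c) (κ : ℂ) :
    ConvRad 1 (fun n => c n + if n = 0 then κ else 0) ∧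
      ∀ t, ‖t‖ < 1 → PS (fun n => c n + if n = 0 then κ else 0) t = PS c t + κ := by
  have h : ∀ t, ‖t‖ < 1 → HasSum (fun n => (c n + if n = 0 then κ else 0) * t ^ n)
      (PS c t + κ) := by
    intro t ht
    have h1 : HasSum (fun n => if n = 0 then κ else 0) κ := by
      simpa using hasSum_ite_eq 0 κ
    refine ((hc.hasSum ht).add h1).congr_fun fun n => ?_
    cases n <;> simp
  exact ⟨fun t ht => (h t ht).summable, fun t ht => (h t ht).tsum_eq⟩

/-- Termwise integration. In the singular part no constant arises: `g'` is divided by `n + s`, which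
stays away from `0`. In the analytic part the constant goes into `c 0`, on which nothing is
asserted. -/
lemma HasExpansion.integrate {s : ℂ} (hs : ∀ m : ℤ, s ≠ m) {e c' g g' : ℕ → ℂ}
    (he : ConvRad 1 e)
    (h : HasExpansion 1 (fun t => PS (dcoeff e) (1 - t)) (s - 1) c' g')
    (hg : ∀ n, g' n = -((n + s) * g n)) :
    ∃ c : ℕ → ℂ, HasExpansion 1 (fun t => PS e (1 - t)) s c g ∧
      ∀ n : ℕ, (n + 1) * c (n + 1) = -c' n := by
  obtain ⟨hc', hg', hexp⟩ := h
  obtain ⟨c, hc, -, hd⟩ := exists_antideriv (hc'.const_mul (-1)) 0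
  have hgc : ConvRad 1 g := by
    obtain ⟨K, hK, hKs⟩ := exists_le_norm_add_int hs
    intro z hz
    refine Summable.of_norm_bounded ((hg' z hz).norm.mul_left K) fun n => ?_
    have h1 := hKs n
    rw [hg, norm_mul, norm_mul, norm_neg, norm_mul, add_comm (n : ℂ)]
    have h2 : 1 ≤ K * ‖s + n‖ := by
      have := abs_nonneg ((n : ℤ) : ℝ)
      push_cast at h1 this
      linarith
    calc ‖g n‖ * ‖z ^ n‖ ≤ (K * ‖s + n‖) * (‖g n‖ * ‖z ^ n‖) :=
          le_mul_of_one_le_left (by positivity) h2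
      _ = _ := by ring
  have hder : ∀ t ∈ lens 1, HasDerivAt
      (fun t => PS e (1 - t) - (PS c t + t ^ s * PS g t)) 0 t := by
    intro t ht
    obtain ⟨ht1, ht2⟩ := mem_lens.1 ht
    have ht0 := ne_zero_of_mem_lens ht
    refine ((hasDerivAt_PS_one_sub he ht2).sub ((hc.hasDerivAt ht1).add
      (((hasDerivAt_id t).cpow_const (c := s) (mem_slitPlane_of_mem_lens ht)).mul
        (hgc.hasDerivAt ht1)))).congr_deriv ?_
    have e1 := hexp t ht
    have e2 : PS (dcoeff c) t = -1 * PS c' t := by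
      rw [hd]
      exact ((hc'.const_mul (-1)).hasSum ht1).unique
        (((hc'.hasSum ht1).mul_left (-1)).congr_fun fun n => by ring)
    have e3 : PS g' t = -(t * PS (dcoeff g) t + s * PS g t) := by
      rw [(PS_pow_succ hgc ht1).1]
      refine (hg'.hasSum ht1).unique ?_
      refine ((((PS_pow_succ hgc ht1).2.hasSum ht1).add
        ((hgc.hasSum ht1).mul_left s)).neg).congr_fun fun n => ?_
      rw [hg]
      ring
    have e4 : t ^ s = t * t ^ (s - 1) := by
      rw [Complex.cpow_sub _ _ ht0, Complex.cpow_one]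
      field_simp
    simp only at e1
    rw [e1, e2, e3, id, e4]
    ring
  obtain ⟨κ, hκ⟩ := (isOpen_lens 1).exists_is_const_of_deriv_eq_zero (𝕜 := ℂ)
    (convex_lens 1).isPreconnected
    (fun t ht => (hder t ht).differentiableAt.differentiableWithinAt)
    (fun t ht => (hder t ht).deriv)
  obtain ⟨k1, k2⟩ := PS_add_const hc κ
  refine ⟨_, ⟨k1, hgc, fun t ht => ?_⟩, fun n => ?_⟩
  · rw [k2 t (mem_lens.1 ht).1]
    linear_combination hκ t ht
  · have := congrFun hd n
    simp only [dcoeff] at this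
    simpa using this

/-- The expansion at `1`, without restriction on the real parts of the parameters. -/
theorem exists_hasExpansion_one (hp : 2 ≤ p) (N : ℕ)
    (ha : ∀ j ∈ Icc 1 (p + 1), ∀ m : ℕ, a j ≠ -(m : ℂ))
    (hb : ∀ j ∈ Icc 1 p, ∀ m : ℕ, b j ≠ -(m : ℂ))
    (h : ∀ j ∈ Icc 3 (p + 1), 0 < (a j + N).re)
    (hs : ∀ m : ℤ, excess p a b ≠ m)
    (h1 : ∀ m : ℕ, a 1 + excess p a b ≠ -(m : ℂ))
    (h2 : ∀ m : ℕ, a 2 + excess p a b ≠ -(m : ℂ)) :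
    ∃ c : ℕ → ℂ, HasExpansion 1 (fun t => PS (phiCoeff p a b) (1 - t)) (excess p a b) c
      (fun n => gCoeff p a b n (excess p a b)) ∧
      ∀ n : ℕ, (∀ j ∈ Icc 3 (p + 1), 0 < (a j + n).re) → c n = gCoeff p a b n 0 := by
  induction N generalizing a b with
  | zero =>
    exact ⟨_, hasExpansion_one_of_re_pos hp ha hb (by simpa using h) hs h1 h2, fun _ _ => rfl⟩
  | succ N ih =>
    -- If the real parts are already positive, integration would lose the formula for `c 0`; the
    -- direct expansion keeps it.
    by_cases h0 : ∀ j ∈ Icc 3 (p + 1), 0 < (a j).re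
    · exact ⟨_, hasExpansion_one_of_re_pos hp ha hb h0 hs h1 h2, fun _ _ => rfl⟩
    have shift_ne : ∀ x : ℂ, (∀ m : ℕ, x ≠ -(m : ℂ)) → ∀ m : ℕ, x + 1 ≠ -(m : ℂ) :=
      fun x hx m hm => hx (m + 1) (by push_cast; linear_combination hm)
    have e : ∀ x : ℂ, x + 1 + (excess p a b - 1) = x + excess p a b := fun x => by ring
    -- The induction hypothesis is applied to the parameters of `Φ'`, all raised by one, for which
    -- `N` is one less.
    obtain ⟨c', hexp, hc'⟩ := ih (a := fun j => a j + 1) (b := fun j => b j + 1)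
      (fun j hj => shift_ne _ (ha j hj)) (fun j hj => shift_ne _ (hb j hj))
      (fun j hj => by
        have := h j hj
        push_cast at this
        simp at this ⊢
        linarith)
      (fun m hm => hs (m + 1) (by
        rw [excess_shift] at hm
        push_cast
        linear_combination hm))
      (by simpa only [excess_shift, e] using h1) (by simpa only [excess_shift, e] using h2)
    rw [excess_shift, ← dcoeff_phiCoeff] at hexp
    obtain ⟨c, k1, k2⟩ := hexp.integrate hs (convRad_phiCoeff p a b) (gCoeff_excess_shift hs)
    refine ⟨c, k1, fun n hn => ?_⟩
    cases n with
    | zero => exact absurd (by simpa using hn) h0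
    | succ n =>
      have e1 := k2 n
      rw [hc' n (fun j hj => by
        have := hn j hj
        push_cast at this
        simp at this ⊢
        linarith), gCoeff_zero_shift, neg_neg] at e1
      exact mul_left_cancel₀ (by exact_mod_cast n.succ_ne_zero) e1

end

/-! ### The analytic continuation. -/

lemma isOpen_slitDisc : IsOpen slitDisc := by
  have h1 : IsOpen {z : ℂ | ‖1 - z‖ < 1} :=
    isOpen_lt (by fun_prop) continuous_const
  exact h1.inter (Complex.isOpen_slitPlane.preimage (by fun_prop : Continuous fun z : ℂ => 1 - z))

theorem exists_continuation {p : ℕ} (hp : 2 ≤ p) {a b : ℕ → ℂ}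
    (ha : ∀ j ∈ Icc 1 (p + 1), ∀ m : ℕ, a j ≠ -(m : ℂ))
    (hb : ∀ j ∈ Icc 1 p, ∀ m : ℕ, b j ≠ -(m : ℂ))
    (hs : ∀ m : ℤ, excess p a b ≠ (m : ℂ))
    (h1 : ∀ m : ℕ, a 1 + excess p a b ≠ -(m : ℂ))
    (h2 : ∀ m : ℕ, a 2 + excess p a b ≠ -(m : ℂ)) :
    ∃ (F : ℂ → ℂ) (c : ℕ → ℂ),
        DifferentiableOn ℂ F (Metric.ball 0 1 ∪ slitDisc) ∧
        (∀ z : ℂ, ‖z‖ < 1 → F z = gammaFactor p a b * hypF p a b z) ∧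
        (∀ n : ℕ, (∀ j ∈ Icc 3 (p + 1), 0 < (a j + n).re) →
          Summable (gTerm p a b n 0) ∧ c n = gCoeff p a b n 0) ∧
        (∀ n k : ℕ, n < k → gTerm p a b n (excess p a b) k = 0) ∧
        ∀ z ∈ slitDisc,
          Summable (fun n : ℕ => c n * (1 - z) ^ n) ∧
          Summable (fun n : ℕ => gCoeff p a b n (excess p a b) * (1 - z) ^ n) ∧
          F z = ∑' n : ℕ, c n * (1 - z) ^ n +
            (1 - z) ^ excess p a b *
              ∑' n : ℕ, gCoeff p a b n (excess p a b) * (1 - z) ^ n := by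
  obtain ⟨N, hN⟩ : ∃ N : ℕ, ∀ j ∈ Icc 3 (p + 1), 0 < (a j + N).re := by
    refine Eventually.exists (f := atTop) ((eventually_all_finset _).2 fun j _ => ?_)
    filter_upwards [eventually_gt_atTop ⌈-(a j).re⌉₊] with n hn
    have := Nat.lt_of_ceil_lt hn
    simp
    linarith
  obtain ⟨c, ⟨hc, hg, hexp⟩, hcg⟩ := exists_hasExpansion_one hp N ha hb hN hs h1 h2
  set s := excess p a b
  set g : ℕ → ℂ := fun n => gCoeff p a b n s
  have hφ := convRad_phiCoeff p a b
  let G : ℂ → ℂ := fun z => PS c (1 - z) + (1 - z) ^ s * PS g (1 - z)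
  -- The two branches agree where the unit disc meets `slitDisc`, because there `1 - z` lies in
  -- `lens 1`; so `F` is locally one of two differentiable functions.
  let F : ℂ → ℂ := fun z => if ‖z‖ < 1 then PS (phiCoeff p a b) z else G z
  have F1 : ∀ z, ‖z‖ < 1 → F z = PS (phiCoeff p a b) z := fun z hz => if_pos hz
  have F2 : ∀ z ∈ slitDisc, F z = G z := by
    intro z hz
    by_cases h : ‖z‖ < 1
    · rw [F1 z h]
      have := hexp (1 - z) (mem_lens.2 ⟨hz.1, by rwa [sub_sub_cancel]⟩)
      simpa only [sub_sub_cancel] using this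
    · exact if_neg h
  refine ⟨F, c, ?_, fun z hz => by rw [F1 z hz, gammaFactor_mul_hypF ha hb],
    fun n hn => ⟨summable_gTerm_zero hp h1 h2 n hn, hcg n hn⟩,
    fun n k hnk => gTerm_excess_eq_zero hnk,
    fun z hz => ⟨hc _ hz.1, hg _ hz.1, F2 z hz⟩⟩
  rintro z (hz | hz)
  · have e : F =ᶠ[𝓝 z] PS (phiCoeff p a b) := by
      filter_upwards [Metric.isOpen_ball.mem_nhds hz] with w hw using F1 w (mem_ball_zero_iff.1 hw)
    exact ((hφ.hasDerivAt (mem_ball_zero_iff.1 hz)).congr_of_eventuallyEq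
      e).differentiableAt.differentiableWithinAt
  · have e : F =ᶠ[𝓝 z] G := by
      filter_upwards [isOpen_slitDisc.mem_nhds hz] with w hw using F2 w hw
    have d : HasDerivAt (fun z : ℂ => 1 - z) (-1) z := by
      simpa using (hasDerivAt_id z).const_sub 1
    have dc := (hc.hasDerivAt hz.1).comp z d
    have dg := (hg.hasDerivAt hz.1).comp z d
    have dp := d.cpow_const (c := s) hz.2
    exact ((dc.add (dp.mul dg)).congr_of_eventuallyEq e).differentiableAt.differentiableWithinAt

end

end

theorem mainTheorem3 (p : ℕ) (hp : 2 ≤ p) (a b : ℕ → ℂ)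
    (ha : ∀ j ∈ Finset.Icc 1 (p + 1), ∀ m : ℕ, a j ≠ -(m : ℂ))
    (hb : ∀ j ∈ Finset.Icc 1 p, ∀ m : ℕ, b j ≠ -(m : ℂ)) :
    -- the nested sum with Pochhammer denominators, wherever these do not vanish
    ((∀ i ∈ Finset.Icc 1 (p - 2), ∀ m : ℕ,
        tailDiff p a b i ≠ -(m : ℂ) ∧ b i - a (i + 2) ≠ -(m : ℂ)) →
      ∀ k : ℕ, coeffA p a b k = coeffAFrac p a b k) ∧
    -- the expansion in Gauss series
    ((∀ j ∈ Finset.Icc 3 (p + 1), 0 < (a j).re) →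
      ∀ z : ℂ, ‖z‖ < 1 →
        HasSum
          (fun k : ℕ => coeffA p a b k *
            (Complex.Gamma (a 1) * Complex.Gamma (a 2) *
              gaussReg (a 1) (a 2) (excess p a b + a 1 + a 2 + k) z))
          (gammaFactor p a b * hypF p a b z)) ∧
    -- the analytic continuation near `z = 1`
    ((∀ m : ℤ, excess p a b ≠ (m : ℂ)) →
      (∀ m : ℕ, a 1 + excess p a b ≠ -(m : ℂ)) →
      (∀ m : ℕ, a 2 + excess p a b ≠ -(m : ℂ)) →
      ∃ (F : ℂ → ℂ) (c : ℕ → ℂ),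
        DifferentiableOn ℂ F (Metric.ball 0 1 ∪ slitDisc) ∧
        (∀ z : ℂ, ‖z‖ < 1 → F z = gammaFactor p a b * hypF p a b z) ∧
        (∀ n : ℕ, (∀ j ∈ Finset.Icc 3 (p + 1), 0 < (a j + n).re) →
          Summable (gTerm p a b n 0) ∧ c n = gCoeff p a b n 0) ∧
        (∀ n k : ℕ, n < k → gTerm p a b n (excess p a b) k = 0) ∧
        ∀ z ∈ slitDisc,
          Summable (fun n : ℕ => c n * (1 - z) ^ n) ∧
          Summable (fun n : ℕ => gCoeff p a b n (excess p a b) * (1 - z) ^ n) ∧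
          F z = ∑' n : ℕ, c n * (1 - z) ^ n +
            (1 - z) ^ excess p a b *
              ∑' n : ℕ, gCoeff p a b n (excess p a b) * (1 - z) ^ n) ∧
    -- the generalized Gauss summation formula
    (0 < (excess p a b).re →
      (∀ j ∈ Finset.Icc 3 (p + 1), 0 < (a j).re) →
      (∀ m : ℕ, a 1 + excess p a b ≠ -(m : ℂ)) →
      (∀ m : ℕ, a 2 + excess p a b ≠ -(m : ℂ)) →
      Summable (hypTerm p a b 1) ∧
      Summable (fun k : ℕ => poch (excess p a b) k /
        (poch (a 1 + excess p a b) k * poch (a 2 + excess p a b) k) * coeffA p a b k) ∧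
      gammaFactor p a b * hypF p a b 1 =
        Complex.Gamma (a 1) * Complex.Gamma (a 2) * Complex.Gamma (excess p a b) /
          (Complex.Gamma (a 1 + excess p a b) * Complex.Gamma (a 2 + excess p a b)) *
          ∑' k : ℕ, poch (excess p a b) k /
            (poch (a 1 + excess p a b) k * poch (a 2 + excess p a b) k) * coeffA p a b k) := by
  refine ⟨fun h k => coeffA_eq_coeffAFrac a b (fun i hi m => (h i hi m).1)
      (fun i hi m => (h i hi m).2) k,
    fun h z hz => hasSum_gauss_expansion hp ha hb h hz,
    fun hs h1 h2 => exists_continuation hp ha hb hs h1 h2,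
    fun hs h h1 h2 => gauss_summation hp ha hb hs h h1 h2⟩
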